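/- Let $r\ge 2$, $n=2^r-2$ and $N=2^{r-1}$. Let $R(Sp(n))$ be the complex representation ring of the compact symplectic group $Sp(n)=Sp(2n,\mathbb C)\cap U(2n)$, and let $x\in R(Sp(n))$ be the class of the defining representation $\mathbb C^{2n}$. Put $a_k=\Lambda^k(x)-\Lambda^{k-2}(x)$ (with $\Lambda^k=0$ for $k<0$), so that $a_1,\dots,a_n$ are the fundamental representations. The irreducible representation of $Sp(n)$ whose Young diagram has exactly two columns, of lengths $n\ge\mu_1\ge\mu_2\ge 1$ (an irreducible representation of level $2$), has class $$\det\begin{pmatrix} a_{\mu_1} & a_{\mu_1+1}+a_{\mu_1-1}\\ a_{\mu_2-1} & a_{\mu_2}+a_{\mu_2-2}\end{pmatrix}\in R(Sp(n)).$$ The Verlinde algebra $V$ of $Sp(n)$ at representation level $1$ is the quotient of $R(Sp(n))$ by the ideal generated by the irreducible representations of level $2$. Filter $R(Sp(n))$ by the Atiyah--Hirzebruch filtration of $K^0(BSp(n))$: $F^kR(Sp(n))$ consists of the elements of topological filtration at least $4k$, that is, of those elements whose restriction to the maximal torus $T=U(1)^n$ lies in $I_T^{2k}$, where $I_T$ is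 the augmentation ideal of $R(T)$. Let $F^kV$ be the image of $F^kR(Sp(n))$ in $V$, and let $\operatorname{gr}V=\bigoplus_{k\ge 0}F^kV/F^{k+1}V$. Define $\gamma_1=x-2n$ and $$\gamma_{i+1}=\Lambda^{i+1}(x-2n+2i)-\Lambda^{i-1}(x-2n+2i),\qquad 1\le i\le n-1,$$ in $R(Sp(n))$, where $\Lambda^k(x-c)$ is the coefficient of $t^k$ in $(1+t)^{-c}\sum_j\Lambda^j(x)t^j$. **Theorem.** For $1\le i\le n$ the image of $\gamma_i$ in $V$ lies in $F^iV$, and sending the variable $\gamma_i$ to the class of $\gamma_i$ in $F^iV/F^{i+1}V$ defines a ring isomorphism from the quotient of $\mathbb Z[\gamma_1,\dots,\gamma_n]$ by the ideal generated by * $2$, * $\gamma_i+\gamma_1^i$ for $2\le i\le N-1$, * $\gamma_i+\gamma_N\gamma_1^{\,i-N}$ for $N+1\le i\le 2^r-2$, * $\gamma_N\gamma_1^{\,N-1}$ onto $\operatorname{gr}V$. Moreover, the element $2\in V$ lies in $F^NV$ but not in $F^{N+1}V$, and its class in $F^NV/F^{N+1}V$ is represented by $\gamma_N+\gamma_1^N$,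 that is, by $\gamma_{2^{r-1}}+\gamma_1^{2^{r-1}}$. -/

import Mathlib

noncomputable section

namespace SymplecticVerlinde

/-! ## Virtual characters of a topological group -/

/-- `χ` is the character of a continuous finite-dimensional complex representation of `G`
(given in matrix form). -/
def IsCharacter {G : Type} [Group G] [TopologicalSpace G] (χ : G → ℂ) : Prop :=
  ∃ (d : ℕ) (ρ : G →* Matrix (Fin d) (Fin d) ℂ), Continuous ρ ∧ χ = fun g => (ρ g).trace

/-- The representation ring `R(G)` of a compact group `G`, realised as its ring of virtual
characters: the ring of functions on `G` generated by the characters of the continuous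
finite-dimensional complex representations (as characters are closed under sums and products,
these are exactly the differences of two characters). -/
def repRing (G : Type) [Group G] [TopologicalSpace G] : Subring (G → ℂ) :=
  Subring.closure {χ | IsCharacter χ}

/-- The augmentation `R(G) → ℂ` (virtual dimension), evaluation at the unit. -/
def augmentation (G : Type) [Group G] [TopologicalSpace G] : repRing G →+* ℂ :=
  (Pi.evalRingHom (fun _ : G => ℂ) 1).comp (repRing G).subtype

/-- The augmentation ideal of `R(G)`. -/
def augmentationIdeal (G : Type) [Group G] [TopologicalSpace G] : Ideal (repRing G) :=
  RingHom.ker (augmentation G)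

/-- Composition with a homomorphism `f : H → G`, as a ring homomorphism on functions. -/
def pullback {H G : Type} (f : H → G) : (G → ℂ) →+* (H → ℂ) where
  toFun χ := fun h => χ (f h)
  map_one' := rfl
  map_mul' _ _ := rfl
  map_zero' := rfl
  map_add' _ _ := rfl

theorem pullback_mem {H G : Type} [Group H] [TopologicalSpace H] [Group G] [TopologicalSpace G]
    (f : H →ₜ* G) {χ : G → ℂ} (hχ : χ ∈ repRing G) : pullback f χ ∈ repRing H := by
  have h : repRing G ≤ (repRing H).comap (pullback f) := by
    refine Subring.closure_le.2 ?_
    rintro χ ⟨d, ρ, hρ, rfl⟩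
    exact Subring.subset_closure ⟨d, ρ.comp f.toMonoidHom, hρ.comp f.continuous_toFun, rfl⟩
  exact h hχ

/-- The restriction homomorphism `R(G) → R(H)` along a continuous homomorphism `H → G`. -/
def restrict {H G : Type} [Group H] [TopologicalSpace H] [Group G] [TopologicalSpace G]
    (f : H →ₜ* G) : repRing G →+* repRing H :=
  ((pullback f).comp (repRing G).subtype).codRestrict (repRing H)
    (fun χ => pullback_mem f χ.2)

/-! ## Decreasing filtrations and their associated graded rings -/

/-- A decreasing multiplicative filtration of a commutative ring by ideals. -/
structure RingFiltration (R : Type) [CommRing R] where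
  piece : ℕ → Ideal R
  piece_zero : piece 0 = ⊤
  antitone : Antitone piece
  mul_le : ∀ i j, piece i * piece j ≤ piece (i + j)

namespace RingFiltration

variable {R : Type} [CommRing R]

/-- The image of a filtration in a quotient ring. -/
def quotient (F : RingFiltration R) (J : Ideal R) : RingFiltration (R ⧸ J) where
  piece k := (F.piece k).map (Ideal.Quotient.mk J)
  piece_zero := by rw [F.piece_zero, Ideal.map_top]
  antitone _ _ h := Ideal.map_mono (F.antitone h)
  mul_le i j := by
    rw [← Ideal.map_mul]
    exact Ideal.map_mono (F.mul_le i j)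

/-- The Rees ring `⨁ₖ Fᵏ Tᵏ ⊆ R[T]`. -/
def rees (F : RingFiltration R) : Subring (Polynomial R) where
  carrier := {p | ∀ k, p.coeff k ∈ F.piece k}
  mul_mem' := by
    intro p q hp hq k
    rw [Polynomial.coeff_mul]
    refine Ideal.sum_mem _ fun c hc => ?_
    rw [← Finset.HasAntidiagonal.mem_antidiagonal.1 hc]
    exact F.mul_le _ _ (Ideal.mul_mem_mul (hp _) (hq _))
  one_mem' := by
    intro k
    rw [Polynomial.coeff_one]
    split_ifs with h
    · rw [h, F.piece_zero]; trivial
    · exact Ideal.zero_mem _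
  add_mem' := by
    intro p q hp hq k
    rw [Polynomial.coeff_add]
    exact Ideal.add_mem _ (hp k) (hq k)
  zero_mem' := by
    intro k
    rw [Polynomial.coeff_zero]
    exact Ideal.zero_mem _
  neg_mem' := by
    intro p hp k
    rw [Polynomial.coeff_neg]
    exact neg_mem (hp k)

/-- The ideal `⨁ₖ Fᵏ⁺¹ Tᵏ` of the Rees ring. -/
def reesIdeal (F : RingFiltration R) : Ideal F.rees where
  carrier := {p | ∀ k, (p : Polynomial R).coeff k ∈ F.piece (k + 1)}
  add_mem' := by
    intro p q hp hq k
    rw [Subring.coe_add, Polynomial.coeff_add]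
    exact Ideal.add_mem _ (hp k) (hq k)
  zero_mem' := by
    intro k
    rw [Subring.coe_zero, Polynomial.coeff_zero]
    exact Ideal.zero_mem _
  smul_mem' := by
    intro p q hq k
    rw [smul_eq_mul, Subring.coe_mul, Polynomial.coeff_mul]
    refine Ideal.sum_mem _ fun c hc => ?_
    rw [← Finset.HasAntidiagonal.mem_antidiagonal.1 hc, add_assoc]
    exact F.mul_le _ _ (Ideal.mul_mem_mul (p.2 _) (hq _))

/-- The associated graded ring `⨁ₖ Fᵏ / Fᵏ⁺¹` (as the quotient of `⨁ₖ Fᵏ Tᵏ` by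
`⨁ₖ Fᵏ⁺¹ Tᵏ`, which carries the multiplication induced from `R`). -/
def Gr (F : RingFiltration R) : Type := F.rees ⧸ F.reesIdeal

instance (F : RingFiltration R) : CommRing F.Gr := inferInstanceAs (CommRing (F.rees ⧸ F.reesIdeal))

/-- The class in `Fᵏ / Fᵏ⁺¹`, the degree `k` part of the associated graded ring, of an element of
`Fᵏ`. -/
def cls (F : RingFiltration R) (k : ℕ) (a : R) (ha : a ∈ F.piece k) : F.Gr :=
  Ideal.Quotient.mk F.reesIdeal ⟨Polynomial.monomial k a, by
    intro j
    rw [Polynomial.coeff_monomial]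
    split_ifs with h
    · exact h ▸ ha
    · exact Ideal.zero_mem _⟩

end RingFiltration

/-! ## The compact symplectic group and its maximal torus -/

/-- The compact symplectic group `Sp(n) = Sp(2n, ℂ) ∩ U(2n)`. -/
def Sp (n : ℕ) : Subgroup (Matrix.unitaryGroup (Fin n ⊕ Fin n) ℂ) where
  carrier := {A | (A : Matrix (Fin n ⊕ Fin n) (Fin n ⊕ Fin n) ℂ) ∈
    Matrix.symplecticGroup (Fin n) ℂ}
  mul_mem' := fun {A B} hA hB => by
    show _ ∈ Matrix.symplecticGroup (Fin n) ℂ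
    exact Submonoid.mul_mem _ hA hB
  one_mem' := by
    show _ ∈ Matrix.symplecticGroup (Fin n) ℂ
    exact Submonoid.one_mem _
  inv_mem' := fun {A} hA => by
    have h1 : ((A⁻¹ : Matrix.unitaryGroup (Fin n ⊕ Fin n) ℂ) :
        Matrix (Fin n ⊕ Fin n) (Fin n ⊕ Fin n) ℂ) * A = 1 := by
      rw [← Matrix.UnitaryGroup.mul_val, inv_mul_cancel, Matrix.UnitaryGroup.one_val]
    have h2 : (A : Matrix (Fin n ⊕ Fin n) (Fin n ⊕ Fin n) ℂ) *
        (((⟨A, hA⟩ : Matrix.symplecticGroup (Fin n) ℂ)⁻¹ : Matrix.symplecticGroup (Fin n) ℂ) :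
          Matrix (Fin n ⊕ Fin n) (Fin n ⊕ Fin n) ℂ) = 1 :=
      congrArg Subtype.val (mul_inv_cancel (⟨A, hA⟩ : Matrix.symplecticGroup (Fin n) ℂ))
    have h3 := left_inv_eq_right_inv h1 h2
    show _ ∈ Matrix.symplecticGroup (Fin n) ℂ
    rw [h3]
    exact Subtype.property _

/-- The defining representation `Sp(n) → GL(2n, ℂ)`, in matrix form. -/
def defRep (n : ℕ) : Sp n →* Matrix (Fin n ⊕ Fin n) (Fin n ⊕ Fin n) ℂ :=
  (Matrix.unitaryGroup (Fin n ⊕ Fin n) ℂ).subtype.comp (Sp n).subtype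

/-- The matrix `diag(t₁, …, tₙ, t₁⁻¹, …, tₙ⁻¹)`. -/
def torusMatrix (n : ℕ) (t : Fin n → Circle) : Matrix (Fin n ⊕ Fin n) (Fin n ⊕ Fin n) ℂ :=
  Matrix.diagonal (Sum.elim (fun i => (t i : ℂ)) (fun i => ((t i)⁻¹ : Circle)))

theorem torusMatrix_mem_unitary (n : ℕ) (t : Fin n → Circle) :
    torusMatrix n t ∈ Matrix.unitaryGroup (Fin n ⊕ Fin n) ℂ := by
  rw [Matrix.mem_unitaryGroup_iff, torusMatrix, Matrix.star_eq_conjTranspose,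
    Matrix.diagonal_conjTranspose, Matrix.diagonal_mul_diagonal, ← Matrix.diagonal_one]
  congr 1
  ext i
  rcases i with i | i
  · show (t i : ℂ) * (starRingEnd ℂ) (t i : ℂ) = 1
    rw [← Circle.coe_inv_eq_conj, ← Circle.coe_mul, mul_inv_cancel, Circle.coe_one]
  · show (((t i)⁻¹ : Circle) : ℂ) * (starRingEnd ℂ) (((t i)⁻¹ : Circle) : ℂ) = 1
    rw [← Circle.coe_inv_eq_conj, ← Circle.coe_mul, mul_inv_cancel, Circle.coe_one]

theorem torusMatrix_mem_symplectic (n : ℕ) (t : Fin n → Circle) :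
    torusMatrix n t ∈ Matrix.symplecticGroup (Fin n) ℂ := by
  have h : torusMatrix n t = Matrix.fromBlocks (Matrix.diagonal fun i => (t i : ℂ)) 0 0
      (Matrix.diagonal fun i => (((t i)⁻¹ : Circle) : ℂ)) := by
    rw [Matrix.fromBlocks_diagonal]; rfl
  rw [SymplecticGroup.mem_iff, h, Matrix.J, Matrix.fromBlocks_transpose,
    Matrix.fromBlocks_multiply, Matrix.fromBlocks_multiply]
  have h1 : (Matrix.diagonal fun _ : Fin n => (-1 : ℂ)) = -1 := by
    rw [← Matrix.diagonal_one, Matrix.diagonal_neg]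
  simp [h1]

/-- The inclusion of the standard maximal torus `T = U(1)ⁿ` in `Sp(n)`. -/
def torusIncl (n : ℕ) : (Fin n → Circle) →ₜ* Sp n where
  toFun t := ⟨⟨torusMatrix n t, torusMatrix_mem_unitary n t⟩, torusMatrix_mem_symplectic n t⟩
  map_one' := by
    refine Subtype.ext (Subtype.ext ?_)
    show torusMatrix n 1 = 1
    rw [torusMatrix, ← Matrix.diagonal_one]
    congr 1
    ext i
    rcases i with i | i <;> simp
  map_mul' s t := by
    refine Subtype.ext (Subtype.ext ?_)
    show torusMatrix n (s * t) = torusMatrix n s * torusMatrix n t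
    rw [torusMatrix, torusMatrix, torusMatrix, Matrix.diagonal_mul_diagonal]
    congr 1
    ext i
    rcases i with i | i
    · simp
    · simp [mul_comm]
  continuous_toFun := by
    refine Continuous.subtype_mk (Continuous.subtype_mk ?_ _) _
    refine Continuous.matrix_diagonal (continuous_pi fun i => ?_)
    rcases i with i | i
    · exact continuous_subtype_val.comp (continuous_apply i)
    · exact continuous_subtype_val.comp (continuous_apply i).inv

/-! ## Exterior powers -/

/-- The character of the exterior power `Λᵏ(ℂ²ⁿ)` of the defining representation. -/
def extChar (n k : ℕ) : Sp n → ℂ := fun g =>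
  LinearMap.trace ℂ (⋀[ℂ]^k (Fin n ⊕ Fin n → ℂ))
    (exteriorPower.map k (Matrix.toLin' (defRep n g)))

theorem continuous_defRep (n : ℕ) : Continuous (defRep n) :=
  continuous_subtype_val.comp continuous_subtype_val

theorem multilinear_continuous {ι : Type} [Fintype ι] [DecidableEq ι] {k : ℕ}
    (f : MultilinearMap ℂ (fun _ : Fin k => ι → ℂ) ℂ) : Continuous fun v => f v := by
  have h : ∀ v : Fin k → ι → ℂ, f v =
      ∑ s : Fin k → ι, (∏ i, v i (s i)) • f (fun i => Pi.single (s i) (1 : ℂ)) := by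
    intro v
    have hv : v = fun i => ∑ j, v i j • (Pi.single j (1 : ℂ) : ι → ℂ) := by
      funext i
      exact pi_eq_sum_univ' (v i)
    conv_lhs => rw [hv]
    rw [MultilinearMap.map_sum]
    exact Finset.sum_congr rfl fun s _ => MultilinearMap.map_smul_univ f _ _
  refine (continuous_congr h).2 ?_
  fun_prop

theorem extMap_continuous (n k : ℕ) (φ : ⋀[ℂ]^k (Fin n ⊕ Fin n → ℂ) →ₗ[ℂ] ℂ)
    (w : ⋀[ℂ]^k (Fin n ⊕ Fin n → ℂ)) :
    Continuous fun g : Sp n => φ (exteriorPower.map k (Matrix.toLin' (defRep n g)) w) := by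
  have hw : w ∈ Submodule.span ℂ
      (Set.range (exteriorPower.ιMulti ℂ k (M := Fin n ⊕ Fin n → ℂ))) := by
    rw [exteriorPower.ιMulti_span]; trivial
  induction hw using Submodule.span_induction with
  | mem x hx =>
    obtain ⟨m, rfl⟩ := hx
    simp only [exteriorPower.map_apply_ιMulti]
    have hc : Continuous fun v : Fin k → (Fin n ⊕ Fin n → ℂ) =>
        (φ.compMultilinearMap (exteriorPower.ιMulti ℂ k
          (M := Fin n ⊕ Fin n → ℂ)).toMultilinearMap) v :=
      multilinear_continuous _
    refine hc.comp (continuous_pi fun i => ?_)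
    show Continuous fun g : Sp n => Matrix.mulVec (defRep n g) (m i)
    exact (continuous_defRep n).matrix_mulVec continuous_const
  | zero => simpa using continuous_const
  | add x y _ _ hx hy =>
    simp only [map_add]
    exact hx.add hy
  | smul a x _ hx =>
    simp only [map_smul]
    exact hx.const_smul a

theorem extChar_isCharacter (n k : ℕ) : IsCharacter (extChar n k) := by
  let b := Module.finBasis ℂ (⋀[ℂ]^k (Fin n ⊕ Fin n → ℂ))
  refine ⟨_, ⟨⟨fun g => LinearMap.toMatrix b b
    (exteriorPower.map k (Matrix.toLin' (defRep n g))), ?_⟩, ?_⟩, ?_, ?_⟩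
  · have h : exteriorPower.map k (Matrix.toLin' (defRep n 1)) = LinearMap.id := by
      rw [map_one, Matrix.toLin'_one, exteriorPower.map_id]
    rw [h, LinearMap.toMatrix_id]
  · intro g h
    have h : exteriorPower.map k (Matrix.toLin' (defRep n (g * h))) =
        exteriorPower.map k (Matrix.toLin' (defRep n g)) ∘ₗ
          exteriorPower.map k (Matrix.toLin' (defRep n h)) := by
      rw [map_mul, Matrix.toLin'_mul, ← exteriorPower.map_comp]
    simp only [h]
    exact LinearMap.toMatrix_comp b b b _ _
  · refine continuous_pi fun i => continuous_pi fun j => ?_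
    have := extMap_continuous n k (b.coord i) (b j)
    simpa [LinearMap.toMatrix_apply] using this
  · funext g
    exact LinearMap.trace_eq_matrix_trace ℂ b _

/-- The class `Λᵏ(x)` in `R(Sp(n))`, where `x` is the defining representation. -/
def ext (n k : ℕ) : repRing (Sp n) :=
  ⟨extChar n k, Subring.subset_closure (extChar_isCharacter n k)⟩

/-- `Λᵏ(x)` for an integer `k`, with `Λᵏ = 0` for `k < 0`. -/
def extZ (n : ℕ) (k : ℤ) : repRing (Sp n) := if 0 ≤ k then ext n k.toNat else 0

/-- `Λᵏ(x - c)` for the virtual representation `x - c`: the coefficient of `tᵏ` in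
`λ_t(x) (1 + t)⁻ᶜ`, where `λ_t(x) = ∑ⱼ Λʲ(x) tʲ`. -/
def extShift (n k : ℕ) (c : ℤ) : repRing (Sp n) :=
  ∑ j ∈ Finset.range (k + 1), Ring.choose (-c) (k - j) • ext n j

/-- The elements `γ₁ = x - 2n` and, for `2 ≤ k ≤ n`,
`γₖ = Λᵏ(x - 2n + 2(k - 1)) - Λᵏ⁻²(x - 2n + 2(k - 1))` of `R(Sp(n))`. -/
def gam (n k : ℕ) : repRing (Sp n) :=
  if k ≤ 1 then ext n 1 - (2 * n : ℕ)
  else extShift n k (2 * n - 2 * (k - 1)) - extShift n (k - 2) (2 * n - 2 * (k - 1))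

/-! ## The Verlinde algebra -/

/-- The sequence `aₖ = Λᵏ(x) - Λᵏ⁻²(x)`, i.e. `…, 0, 1, x₁, …, xₙ, 0, -xₙ, …, -x₁, -1, 0, …`
with `a₀ = 1`, where `x₁, …, xₙ` are the fundamental representations. -/
def fund (n : ℕ) (k : ℤ) : repRing (Sp n) := extZ n k - extZ n (k - 2)

/-- The term with index `c` of the sequence `aⱼ, aⱼ₊₁ + aⱼ₋₁, aⱼ₊₂ + aⱼ₋₂, …`
(the sequence `a` bent at `j`). -/
def bent (n : ℕ) (j : ℤ) (c : ℕ) : repRing (Sp n) :=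
  if c = 0 then fund n j else fund n (j + c) + fund n (j - c)

/-- The class in `R(Sp(n))` of the irreducible representation of `Sp(n)` whose Young diagram has
`q` columns, of lengths `μ₁ ≥ … ≥ μ_q`: the determinant of the `q × q` matrix whose `i`-th row is
formed by the first `q` terms of the sequence `a` bent at `μᵢ - i + 1`. (Here `i` starts at `0`.) -/
def irrepClass (n q : ℕ) (μ : Fin q → ℕ) : repRing (Sp n) :=
  Matrix.det (Matrix.of fun i c : Fin q => bent n ((μ i : ℤ) - (i : ℕ)) c)

/-- The ideal of `R(Sp(n))` generated by the irreducible representations of level `q`, i.e. those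
whose Young diagram has exactly `q` columns (and at most `n` rows). -/
def levelIdeal (n q : ℕ) : Ideal (repRing (Sp n)) :=
  Ideal.span {χ | ∃ μ : Fin q → ℕ, Antitone μ ∧ (∀ i, 1 ≤ μ i ∧ μ i ≤ n) ∧ χ = irrepClass n q μ}

/-- The Verlinde algebra of `Sp(n)` at representation level `l`: the quotient of `R(Sp(n))` by the
ideal generated by the irreducible representations of level `l + 1`. -/
abbrev VerlindeAlgebra (n l : ℕ) : Type := repRing (Sp n) ⧸ levelIdeal n (l + 1)

/-! ## The Atiyah-Hirzebruch filtration -/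

/-- The Atiyah-Hirzebruch filtration of `R(Sp(n)) ⊆ K⁰(BSp(n))`, indexed so that its `k`-th piece
consists of the elements of topological filtration at least `4k` (only the degrees divisible by `4`
occur, because `H*(BSp(n); ℤ)` is concentrated there). Since `H*(BSp(n); ℤ) → H*(BT; ℤ)` is
injective, the filtration is the one induced by restriction to the maximal torus `T`; as
`BT = (ℂP^∞)ⁿ`, an element of `R(T)` has topological filtration at least `2m` if and only if it
lies in the `m`-th power of the augmentation ideal of `R(T)`. -/
def ahFiltration (n : ℕ) : RingFiltration (repRing (Sp n)) where
  piece k := (augmentationIdeal (Fin n → Circle) ^ (2 * k)).comap (restrict (torusIncl n))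
  piece_zero := by simp
  antitone _ _ h := Ideal.comap_mono (Ideal.pow_le_pow_right (by omega))
  mul_le i j := by
    rw [mul_add, pow_add]
    exact Ideal.le_comap_mul _

/-- The Atiyah-Hirzebruch filtration of the Verlinde algebra, as a quotient of `R(Sp(n))`. -/
def verlindeFiltration (n l : ℕ) : RingFiltration (VerlindeAlgebra n l) :=
  (ahFiltration n).quotient (levelIdeal n (l + 1))

/-- The image of `γₖ` in the Verlinde algebra. -/
def gamV (n l k : ℕ) : VerlindeAlgebra n l := Ideal.Quotient.mk (levelIdeal n (l + 1)) (gam n k)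

/-! ## The presentation -/

/-- The polynomial variable `γₖ` of `ℤ[γ₁, …, γₙ]`, for `1 ≤ k ≤ n`. -/
def gVar (n k : ℕ) : MvPolynomial (Fin n) ℤ :=
  if h : k - 1 < n then MvPolynomial.X ⟨k - 1, h⟩ else 0

/-- The relations in `ℤ[γ₁, …, γₙ]`, where `n = 2^r - 2` and `N = 2^(r-1)`: `2`;
`γᵢ + γ₁ⁱ` for `2 ≤ i ≤ N - 1`; `γᵢ + γ_N γ₁^(i - N)` for `N + 1 ≤ i ≤ n`; `γ_N γ₁^(N - 1)`. -/
def relations (n N : ℕ) : Set (MvPolynomial (Fin n) ℤ) :=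
  {2} ∪ {p | ∃ i, 2 ≤ i ∧ i < N ∧ p = gVar n i + gVar n 1 ^ i}
    ∪ {p | ∃ i, N < i ∧ i ≤ n ∧ p = gVar n i + gVar n N * gVar n 1 ^ (i - N)}
    ∪ {gVar n N * gVar n 1 ^ (N - 1)}

/-- The ring `ℤ[γ₁, …, γₙ] / (relations)`. -/
abbrev PresentedRing (n N : ℕ) : Type := MvPolynomial (Fin n) ℤ ⧸ Ideal.span (relations n N)

/-- The class of `γₖ` in the presented ring. -/
def gP (n N k : ℕ) : PresentedRing n N := Ideal.Quotient.mk (Ideal.span (relations n N)) (gVar n k)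

end SymplecticVerlinde

end

/-! Restriction to the maximal torus turns a virtual character into a symmetric polynomial in `uⱼ =
tⱼ + tⱼ⁻¹ - 2`, and `γₖ` becomes the `k`-th elementary symmetric function of the `uⱼ`
(`restrict_gam`). Each `uⱼ` lies in the square of the augmentation ideal and vanishes to exactly
second order along suitable curves through `1`, so the Atiyah-Hirzebruch filtration is the
filtration of `ℤ[γ₁, …, γₙ]` by weight (`mem_piece_iff`). Injectivity of the restriction is not
needed: its kernel lies in every piece of the filtration.

The diagrams with columns `(k+1, 1)` say `aₖ₊₂ = x aₖ₊₁ - aₖ`, a Chebyshev recursion that ends with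
`aₙ₊₁ = 0`. Putting `x = q + q⁻¹` and `v = x + 2`, the last equation is `(q^(2^r) - q^(-2^r)) / (q -
q⁻¹) = ∏_{i<r} (q^(2^i) + q^(-2^i)) = 0`, that is `cPol r = 0` at `v`. So, up to the kernel of
restriction, the Verlinde algebra is `ℤ[v] / (cPol r)`, where `γₖ = ∑_{j≤k} eⱼ vᵏ⁻ʲ` is a truncation
of `cPol r` with coefficients `eⱼ` (`toModel_levelIdeal`, `mem_map_of_toModel_eq_zero`).

Modulo `4` and `2 X^N`, `cPol r` is `X^(2N-1) + 2 X^(N-1)` (`exists_cPol_eq_four`). Hence the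
filtration is the one in which `v` has weight `1` and `2` has weight `N` (`map_weightIdeal_eq`), and
`γₖ` has leading form `vᵏ` for `k < N` and `vᵏ + 2 vᵏ⁻ᴺ` for `k ≥ N` (`Model.g_sub_lead`). The
relations follow: signs are immaterial because doubling raises the filtration by `N`; `γ_N γ₁^(N-1)`
has the leading form of `cPol r`, which is zero; and `2 = (v^N + 2) - v^N`.

There are no further relations if the elements `v^a (v^N + 2)^b` with `b = 0` or `a ≤ N - 2` are
independent over `𝔽₂` in each degree (`two_dvd_of_sum_mem`). This uses `cPol r = cPol (r-1) * dPol
(r-1)`. Modulo `dPol (r-1)` the filtration is contained in the `v`-adic one and `v^N + 2` is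
divisible by `v^(N+1)`, so the pure powers of `v` are detected. Modulo `cPol (r-1)` the power
`v^(N-1)` is divisible by `2` and `v^N + 2` is `2` times an element congruent to `1` modulo `v`, so
the monomials with `b ≥ 1`, `a ≤ N - 2` are detected. -/

noncomputable section

namespace SymplecticVerlinde

open MeasureTheory

/-! ## Characters of a torus -/

/-- The continuous character `t ↦ ∏ tᵢ ^ kᵢ` of the torus. -/
def torusChar {n : ℕ} (k : Fin n → ℤ) : (Fin n → Circle) →* ℂ :=
  Circle.coeHom.comp
    { toFun := fun t => ∏ i, t i ^ k i
      map_one' := by simp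
      map_mul' := fun s t => by simp [mul_zpow, Finset.prod_mul_distrib] }

theorem torusChar_apply {n : ℕ} (k : Fin n → ℤ) (t : Fin n → Circle) :
    torusChar k t = ((∏ i, t i ^ k i : Circle) : ℂ) := rfl

theorem torusChar_eq_prod {n : ℕ} (k : Fin n → ℤ) (t : Fin n → Circle) :
    torusChar k t = ∏ i, (t i : ℂ) ^ k i := by
  rw [torusChar_apply]
  exact (map_prod Circle.coeHom (fun i => t i ^ k i) Finset.univ).trans
    (by simp only [map_zpow]; rfl)

theorem torusChar_add {n : ℕ} (k l : Fin n → ℤ) (t : Fin n → Circle) :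
    torusChar (k + l) t = torusChar k t * torusChar l t := by
  rw [torusChar_apply, torusChar_apply, torusChar_apply, ← Circle.coe_mul,
    ← Finset.prod_mul_distrib]
  simp [zpow_add]

theorem torusChar_zero {n : ℕ} (t : Fin n → Circle) : torusChar 0 t = 1 := by
  simp [torusChar_apply]

theorem torusChar_injective {n : ℕ} :
    Function.Injective (torusChar : (Fin n → ℤ) → ((Fin n → Circle) →* ℂ)) := by
  intro k l h
  funext i
  by_contra hne
  have hc : ((k i - l i : ℤ) : ℝ) ≠ 0 := by exact_mod_cast sub_ne_zero.2 hne
  have h1 : ∀ z : Circle, z ^ k i = z ^ l i := by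
    intro z
    have h2 := DFunLike.congr_fun h (Pi.mulSingle i z)
    rw [torusChar_apply, torusChar_apply] at h2
    have h3 := Circle.coe_injective h2
    rwa [Finset.prod_eq_single i (fun j _ hj => by simp [hj]) (by simp),
      Finset.prod_eq_single i (fun j _ hj => by simp [hj]) (by simp), Pi.mulSingle_eq_same] at h3
  -- The angle is chosen so that the power `k i - l i` of the point is `exp(iπ) = -1`.
  have h2 : (Circle.exp (Real.pi / ((k i - l i : ℤ) : ℝ))) ^ (k i - l i) = 1 := by
    rw [zpow_sub, h1, mul_inv_cancel]
  rw [← Circle.exp_zsmul, zsmul_eq_mul, mul_div_cancel₀ _ hc] at h2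
  exact Circle.exp_pi_ne_one h2

theorem linearIndependent_torusChar (n : ℕ) :
    LinearIndependent ℂ (fun (k : Fin n → ℤ) => (torusChar k : (Fin n → Circle) → ℂ)) :=
  (linearIndependent_monoidHom (Fin n → Circle) ℂ).comp _ torusChar_injective

/-- The ring of Laurent polynomials with integral coefficients, as functions on the torus. -/
def laurent (n : ℕ) : AddMonoidAlgebra ℤ (Fin n → ℤ) →ₐ[ℤ] ((Fin n → Circle) → ℂ) :=
  AddMonoidAlgebra.lift ℤ ((Fin n → Circle) → ℂ) (Fin n → ℤ)
    { toFun := fun k => torusChar k.toAdd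
      map_one' := by funext t; simp [torusChar_zero]
      map_mul' := fun k l => by funext t; simp [torusChar_add] }

theorem laurent_apply {n : ℕ} (c : AddMonoidAlgebra ℤ (Fin n → ℤ)) (t : Fin n → Circle) :
    laurent n c t = ∑ k ∈ c.coeff.support, (c.coeff k : ℂ) * torusChar k t := by
  simp [laurent, AddMonoidAlgebra.lift_apply, Finsupp.sum]

theorem laurent_ofCoeff {n : ℕ} (c : (Fin n → ℤ) →₀ ℤ) (t : Fin n → Circle) :
    laurent n (.ofCoeff c) t = ∑ k ∈ c.support, (c k : ℂ) * torusChar k t :=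
  laurent_apply _ _

theorem laurent_injective (n : ℕ) : Function.Injective (laurent n) := by
  rw [injective_iff_map_eq_zero]
  intro c hc
  have h := linearIndependent_iff'.1 (linearIndependent_torusChar n) c.coeff.support
    (fun k => (c.coeff k : ℂ)) (by
      funext t
      have := congrFun hc t
      rw [laurent_apply] at this
      simpa using this)
  ext k
  by_cases hk : k ∈ c.coeff.support
  · simpa using h k hk
  · simpa using hk

/-! ## Characters of continuous representations of a torus -/

-- Normalised Haar measure, against which the Fourier coefficients below are integrated.
local instance : MeasureSpace UnitAddCircle := ⟨AddCircle.haarAddCircle⟩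

local instance : Measure.IsAddHaarMeasure (volume : Measure UnitAddCircle) :=
  inferInstanceAs (Measure.IsAddHaarMeasure AddCircle.haarAddCircle)

/-- The standard homomorphism from `(ℝ/ℤ)ⁿ` to the torus. -/
def expTorus {n : ℕ} (x : UnitAddTorus (Fin n)) : Fin n → Circle := fun i => (x i).toCircle

theorem expTorus_add {n : ℕ} (x y : UnitAddTorus (Fin n)) :
    expTorus (x + y) = expTorus x * expTorus y := by
  funext i
  exact AddCircle.toCircle_add _ _

theorem continuous_expTorus (n : ℕ) : Continuous (expTorus (n := n)) :=
  continuous_pi fun i => AddCircle.continuous_toCircle.comp (continuous_apply i)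

theorem expTorus_surjective (n : ℕ) : Function.Surjective (expTorus (n := n)) := by
  intro t
  have h : ∀ z : Circle, ∃ x : UnitAddCircle, x.toCircle = z := fun z => by
    obtain ⟨x, hx⟩ := (AddCircle.homeomorphCircle (T := 1) one_ne_zero).surjective z
    exact ⟨x, by rw [← hx, AddCircle.homeomorphCircle_apply]⟩
  choose g hg using h
  exact ⟨fun i => g (t i), funext fun i => hg _⟩

theorem mFourier_eq_torusChar {n : ℕ} (k : Fin n → ℤ) (x : UnitAddTorus (Fin n)) :
    UnitAddTorus.mFourier k x = torusChar k (expTorus x) := by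
  rw [torusChar_eq_prod]
  show ∏ i, fourier (k i) (x i) = _
  refine Finset.prod_congr rfl fun i _ => ?_
  rw [fourier_apply, AddCircle.toCircle_zsmul]
  simp [expTorus]

theorem mFourierCoeff_translate {n : ℕ} (f : UnitAddTorus (Fin n) → ℂ) (k : Fin n → ℤ)
    (w : UnitAddTorus (Fin n)) :
    UnitAddTorus.mFourierCoeff (fun x => f (x + w)) k =
      torusChar k (expTorus w) * UnitAddTorus.mFourierCoeff f k := by
  have h := integral_add_right_eq_self (μ := (volume : Measure (UnitAddTorus (Fin n))))
    (fun x => UnitAddTorus.mFourier (-k) (x - w) • f x) w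
  simp only [add_sub_cancel_right] at h
  refine Eq.trans (b := ∫ x, UnitAddTorus.mFourier (-k) x • f (x + w)) rfl ?_
  rw [h]
  refine Eq.trans ?_ (integral_const_mul (torusChar k (expTorus w)) _)
  refine integral_congr_ae (Filter.Eventually.of_forall fun x => ?_)
  simp only [smul_eq_mul, ← mul_assoc]
  congr 1
  have h2 : UnitAddTorus.mFourier (-k) x = torusChar (-k) (expTorus ((x - w) + w)) := by
    rw [sub_add_cancel, mFourier_eq_torusChar]
  rw [mFourier_eq_torusChar, h2, expTorus_add, map_mul, ← mul_assoc,
    mul_right_comm, ← torusChar_add]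
  simp [torusChar_zero]

/-- The matrix of Fourier coefficients of a matrix representation of the torus. -/
def fourierMatrix {n d : ℕ} (ρ : (Fin n → Circle) →* Matrix (Fin d) (Fin d) ℂ) (k : Fin n → ℤ) :
    Matrix (Fin d) (Fin d) ℂ :=
  Matrix.of fun i j => UnitAddTorus.mFourierCoeff (fun x => ρ (expTorus x) i j) k

section

variable {n d : ℕ} {ρ : (Fin n → Circle) →* Matrix (Fin d) (Fin d) ℂ}

theorem continuous_entry (hρ : Continuous ρ) (i j : Fin d) :
    Continuous fun x : UnitAddTorus (Fin n) => ρ (expTorus x) i j :=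
  (hρ.comp (continuous_expTorus n)).matrix_elem i j

/-- Left multiplication by `ρ t` translates the entries of `ρ`, and translation multiplies a Fourier
coefficient by a character. So the columns of the coefficient matrix are weight vectors of weight
`k`. -/
theorem mul_fourierMatrix (hρ : Continuous ρ) (k : Fin n → ℤ) (t : Fin n → Circle) :
    ρ t * fourierMatrix ρ k = torusChar k t • fourierMatrix ρ k := by
  obtain ⟨w, rfl⟩ := expTorus_surjective n t
  ext i l
  rw [Matrix.mul_apply, Matrix.smul_apply, smul_eq_mul]
  refine Eq.trans ?_ (mFourierCoeff_translate (fun x => ρ (expTorus x) i l) k w)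
  have h : ∀ x, ρ (expTorus (x + w)) i l = ∑ j, ρ (expTorus w) i j * ρ (expTorus x) j l := by
    intro x
    rw [add_comm, expTorus_add, map_mul, Matrix.mul_apply]
  simp only [h]
  simp only [fourierMatrix, Matrix.of_apply, UnitAddTorus.mFourierCoeff, smul_eq_mul]
  simp only [Finset.mul_sum]
  refine Eq.trans ?_ (integral_finsetSum Finset.univ fun j _ => ?_).symm
  · refine Finset.sum_congr rfl fun j _ => ?_
    rw [← integral_const_mul]
    refine integral_congr_ae (Filter.Eventually.of_forall fun x => ?_)
    simp only
    ring
  · refine Continuous.integrable_of_hasCompactSupport ?_ (HasCompactSupport.of_compactSpace _)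
    exact (UnitAddTorus.mFourier (-k)).continuous.mul
      (continuous_const.mul (continuous_entry hρ j l))

/-- Nonzero coefficient matrices are eigenvectors for distinct characters, hence linearly
independent in a finite-dimensional space of matrices. -/
theorem finite_fourierMatrix_ne_zero (hρ : Continuous ρ) :
    {k | fourierMatrix ρ k ≠ 0}.Finite := by
  have h : LinearIndependent ℂ fun k : {k | fourierMatrix ρ k ≠ 0} => fourierMatrix ρ k := by
    rw [linearIndependent_iff']
    intro s a ha k hk
    have hne := k.2
    obtain ⟨i, j, hij⟩ : ∃ i j, fourierMatrix ρ k i j ≠ 0 := by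
      by_contra! h0
      exact hne (Matrix.ext h0)
    have hli := (linearIndependent_torusChar n).comp
      (Subtype.val : {k | fourierMatrix ρ k ≠ 0} → _) Subtype.val_injective
    have h1 := linearIndependent_iff'.1 hli s (fun k => a k * fourierMatrix ρ k i j) (by
      funext t
      have h2 := congrArg (fun M => (ρ t * M) i j) ha
      simp only [Finset.mul_sum, Matrix.mul_smul, mul_fourierMatrix hρ, Matrix.mul_zero,
        Matrix.zero_apply, Matrix.sum_apply, Matrix.smul_apply, smul_eq_mul] at h2
      rw [Finset.sum_apply, Pi.zero_apply, ← h2]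
      refine Finset.sum_congr rfl fun l _ => ?_
      simp only [Pi.smul_apply, Function.comp_apply, smul_eq_mul]
      ring) k hk
    exact (mul_eq_zero.1 h1).resolve_right hij
  exact h.finite_of_isNoetherian

/-- With finitely many nonzero coefficients the Fourier series is summable, so it converges
pointwise to the continuous entries of `ρ`. -/
theorem eq_sum_fourierMatrix (hρ : Continuous ρ) (t : Fin n → Circle) :
    ρ t = ∑ k ∈ (finite_fourierMatrix_ne_zero hρ).toFinset, torusChar k t • fourierMatrix ρ k := by
  obtain ⟨x, rfl⟩ := expTorus_surjective n t
  ext i j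
  have hz : ∀ k ∉ (finite_fourierMatrix_ne_zero hρ).toFinset,
      UnitAddTorus.mFourierCoeff
        (⟨fun x => ρ (expTorus x) i j, continuous_entry hρ i j⟩ : C(UnitAddTorus (Fin n), ℂ)) k
        = 0 := by
    intro k hk
    have : fourierMatrix ρ k = 0 := by simpa using hk
    exact congrFun (congrFun this i) j
  have hs := UnitAddTorus.hasSum_mFourier_series_apply_of_summable (d := Fin n)
    (f := ⟨fun x => ρ (expTorus x) i j, continuous_entry hρ i j⟩)
    (hasSum_sum_of_ne_finset_zero hz).summable x
  have hs2 := hasSum_sum_of_ne_finset_zero (L := .unconditional _) (f := fun k => UnitAddTorus.mFourierCoeff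
    (⟨fun x => ρ (expTorus x) i j, continuous_entry hρ i j⟩ : C(UnitAddTorus (Fin n), ℂ)) k •
      UnitAddTorus.mFourier k x) (s := (finite_fourierMatrix_ne_zero hρ).toFinset)
    (fun k hk => by rw [hz k hk, zero_smul])
  refine (hs.unique hs2).trans ?_
  rw [Matrix.sum_apply]
  refine Finset.sum_congr rfl fun k _ => ?_
  rw [Matrix.smul_apply, mFourier_eq_torusChar, smul_eq_mul, smul_eq_mul, mul_comm]
  rfl

/-- Expanding `ρ t` in its Fourier series inside `ρ t * Pₖ = χₖ(t) Pₖ` and comparing coefficients of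
the independent characters gives `Pₖ Pₖ = Pₖ`. The trace of `Pₖ` is then the dimension of a weight
space, which is what makes the character an integral Laurent polynomial. -/
theorem isIdempotentElem_fourierMatrix (hρ : Continuous ρ) (k : Fin n → ℤ) :
    IsIdempotentElem (fourierMatrix ρ k) := by
  by_cases hk : fourierMatrix ρ k = 0
  · rw [hk]; exact IsIdempotentElem.zero
  have hk' : k ∈ (finite_fourierMatrix_ne_zero hρ).toFinset := by simpa using hk
  ext i j
  have h := linearIndependent_iff'.1 (linearIndependent_torusChar n)
    (finite_fourierMatrix_ne_zero hρ).toFinset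
    (fun l => (fourierMatrix ρ l * fourierMatrix ρ k) i j -
      if l = k then fourierMatrix ρ k i j else 0) (by
    funext t
    have h1 := mul_fourierMatrix hρ k t
    conv_lhs at h1 => rw [eq_sum_fourierMatrix hρ t]
    have h2 := congrFun (congrFun h1 i) j
    simp only [Finset.sum_mul, Matrix.smul_mul, Matrix.sum_apply, Matrix.smul_apply,
      smul_eq_mul] at h2
    simp only [Finset.sum_apply, Pi.smul_apply, smul_eq_mul, sub_mul, Finset.sum_sub_distrib,
      ite_mul, zero_mul, Finset.sum_ite_eq', if_pos hk', Pi.zero_apply]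
    rw [mul_comm (fourierMatrix ρ k i j), ← h2, sub_eq_zero]
    exact Finset.sum_congr rfl fun l _ => mul_comm _ _) k hk'
  simpa [sub_eq_zero] using h

theorem exists_trace_eq_natCast {P : Matrix (Fin d) (Fin d) ℂ} (hP : IsIdempotentElem P) :
    ∃ m : ℕ, P.trace = m := by
  have h : IsIdempotentElem (Matrix.toLin' P) := by
    rw [IsIdempotentElem, Module.End.mul_eq_comp, ← Matrix.toLin'_mul, hP]
  have := ((LinearMap.isProj_range_iff_isIdempotentElem _).2 h).trace
  rw [Matrix.trace_toLin'_eq] at this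
  exact ⟨_, this⟩

end

/-- Every virtual character of the torus is a Laurent polynomial with integral coefficients. -/
theorem repRing_torus_le (n : ℕ) : repRing (Fin n → Circle) ≤ (laurent n).toRingHom.range := by
  refine Subring.closure_le.2 ?_
  rintro χ ⟨d, ρ, hρ, rfl⟩
  choose m hm using fun k => exists_trace_eq_natCast (isIdempotentElem_fourierMatrix hρ k)
  refine ⟨∑ k ∈ (finite_fourierMatrix_ne_zero hρ).toFinset, AddMonoidAlgebra.single k (m k : ℤ), ?_⟩
  funext t
  have h : ∀ k : Fin n → ℤ, ∀ a : ℤ,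
      laurent n (AddMonoidAlgebra.single k a) t = a * torusChar k t := by
    intro k a
    simp [laurent, AddMonoidAlgebra.lift_single]
  show laurent n _ t = _
  conv_rhs => rw [eq_sum_fourierMatrix hρ t]
  rw [map_sum, Finset.sum_apply, Matrix.trace_sum]
  refine Finset.sum_congr rfl fun k _ => ?_
  rw [h, Matrix.trace_smul, hm, smul_eq_mul, mul_comm]
  simp

theorem torusChar_mem_repRing {n : ℕ} (k : Fin n → ℤ) :
    (torusChar k : (Fin n → Circle) → ℂ) ∈ repRing (Fin n → Circle) := by
  refine Subring.subset_closure ⟨1, (Matrix.scalar (Fin 1)).toMonoidHom.comp (torusChar k), ?_, ?_⟩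
  · have h : Continuous (torusChar k : (Fin n → Circle) → ℂ) :=
      continuous_subtype_val.comp
        (show Continuous fun t : Fin n → Circle => ∏ i, t i ^ k i from
          continuous_finsetProd _ fun i _ => (continuous_apply i).zpow (k i))
    exact Continuous.matrix_diagonal (continuous_pi fun _ => h)
  · funext t
    simp [Matrix.trace]

end SymplecticVerlinde
end

noncomputable section

namespace SymplecticVerlinde

open MvPolynomial

/-! ## Symmetries of the restriction of a virtual character to the maximal torus -/

theorem repRing_conj {G : Type} [Group G] [TopologicalSpace G] {χ : G → ℂ} (hχ : χ ∈ repRing G)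
    (g h : G) : χ (g * h * g⁻¹) = χ h := by
  induction hχ using Subring.closure_induction with
  | mem χ hχ =>
    obtain ⟨d, ρ, -, rfl⟩ := hχ
    show (ρ (g * h * g⁻¹)).trace = (ρ h).trace
    rw [map_mul, Matrix.trace_mul_comm, ← map_mul, inv_mul_cancel_left]
  | zero => rfl
  | one => rfl
  | add χ ψ _ _ h1 h2 => exact congrArg₂ (· + ·) h1 h2
  | mul χ ψ _ _ h1 h2 => exact congrArg₂ (· * ·) h1 h2
  | neg χ _ h1 => exact congrArg (- ·) h1

/-- A unitary symplectic matrix, as an element of `Sp(n)`. -/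
def Sp.mk {n : ℕ} (M : Matrix (Fin n ⊕ Fin n) (Fin n ⊕ Fin n) ℂ)
    (h1 : M ∈ Matrix.unitaryGroup (Fin n ⊕ Fin n) ℂ)
    (h2 : M ∈ Matrix.symplecticGroup (Fin n) ℂ) : Sp n := ⟨⟨M, h1⟩, h2⟩

/-- Source of the Weyl group symmetry. The hypothesis is `g t = s g` rather than a conjugation, so
no inverse matrix has to be computed. -/
theorem torus_eq_of_intertwine {n : ℕ} (a : repRing (Sp n)) (g : Sp n) (s t : Fin n → Circle)
    (h : (g : Matrix (Fin n ⊕ Fin n) (Fin n ⊕ Fin n) ℂ) * torusMatrix n t =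
      torusMatrix n s * (g : Matrix (Fin n ⊕ Fin n) (Fin n ⊕ Fin n) ℂ)) :
    (a : Sp n → ℂ) (torusIncl n s) = (a : Sp n → ℂ) (torusIncl n t) := by
  have h1 : g * torusIncl n t = torusIncl n s * g := Subtype.ext (Subtype.ext h)
  rw [← repRing_conj a.2 g (torusIncl n t), h1, mul_inv_cancel_right]

theorem torus_perm {n : ℕ} (a : repRing (Sp n)) (σ : Equiv.Perm (Fin n)) (t : Fin n → Circle) :
    (a : Sp n → ℂ) (torusIncl n (t ∘ σ)) = (a : Sp n → ℂ) (torusIncl n t) := by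
  let P : Matrix (Fin n) (Fin n) ℂ := (1 : Matrix (Fin n) (Fin n) ℂ).submatrix σ id
  have hP : P * P.transpose = 1 := by
    ext i j
    simp [P, Matrix.mul_apply, Matrix.one_apply, eq_comm]
  have hc : P.conjTranspose = P.transpose := by
    ext i j
    simp [P, Matrix.one_apply, apply_ite]
  have hd : ∀ v : Fin n → ℂ, P * Matrix.diagonal v = Matrix.diagonal (v ∘ σ) * P := by
    intro v
    ext i j
    rw [Matrix.mul_diagonal, Matrix.diagonal_mul]
    by_cases h : σ i = j
    · simp [P, h, mul_comm]
    · simp [P, h]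
  have ht : ∀ t : Fin n → Circle, torusMatrix n t =
      Matrix.fromBlocks (Matrix.diagonal fun i => (t i : ℂ)) 0 0
      (Matrix.diagonal fun i => (((t i)⁻¹ : Circle) : ℂ)) := by
    intro t
    rw [Matrix.fromBlocks_diagonal]; rfl
  refine torus_eq_of_intertwine a (Sp.mk (Matrix.fromBlocks P 0 0 P) ?_ ?_) _ _ ?_
  · rw [Matrix.mem_unitaryGroup_iff, Matrix.star_eq_conjTranspose, Matrix.fromBlocks_conjTranspose,
      Matrix.fromBlocks_multiply, hc]
    simp [hP]
  · rw [SymplecticGroup.mem_iff, Matrix.J, Matrix.fromBlocks_transpose,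
      Matrix.fromBlocks_multiply, Matrix.fromBlocks_multiply]
    simp [hP]
  · show Matrix.fromBlocks P 0 0 P * _ = _ * Matrix.fromBlocks P 0 0 P
    rw [ht, ht, Matrix.fromBlocks_multiply, Matrix.fromBlocks_multiply]
    simp only [hd, Matrix.mul_zero, Matrix.zero_mul, add_zero, zero_add]
    rfl

/-- Inversion of the coordinates of a torus element in a given set. -/
def flip {n : ℕ} (A : Finset (Fin n)) (t : Fin n → Circle) : Fin n → Circle :=
  fun i => if i ∈ A then (t i)⁻¹ else t i

theorem torus_flip {n : ℕ} (a : repRing (Sp n)) (A : Finset (Fin n)) (t : Fin n → Circle) :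
    (a : Sp n → ℂ) (torusIncl n (flip A t)) = (a : Sp n → ℂ) (torusIncl n t) := by
  -- The conjugating element is a quarter turn in the planes indexed by `A` and the identity in the
  -- others.
  let x : Fin n → ℂ := fun i => if i ∈ A then 0 else 1
  let y : Fin n → ℂ := fun i => if i ∈ A then 1 else 0
  have ht : ∀ t : Fin n → Circle, torusMatrix n t =
      Matrix.fromBlocks (Matrix.diagonal fun i => (t i : ℂ)) 0 0
      (Matrix.diagonal fun i => (((t i)⁻¹ : Circle) : ℂ)) := by
    intro t
    rw [Matrix.fromBlocks_diagonal]; rfl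
  have hx : star x = x := by
    funext i; by_cases h : i ∈ A <;> simp [x, h]
  have hy : star y = y := by
    funext i; by_cases h : i ∈ A <;> simp [y, h]
  have hy' : ∀ i, (starRingEnd ℂ) (y i) = y i := congrFun hy
  have h1 : ∀ i, x i * x i + y i * y i = 1 := by
    intro i; by_cases h : i ∈ A <;> simp [x, y, h]
  have h1' : ∀ i, y i * y i + x i * x i = 1 := fun i => by rw [add_comm, h1]
  have h1n : (Matrix.diagonal fun i => -(y i * y i) + -(x i * x i)) =
      (-1 : Matrix (Fin n) (Fin n) ℂ) := by
    rw [← Matrix.diagonal_one, Matrix.diagonal_neg]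
    congr 1
    funext i
    rw [← neg_add, h1']
  have h0 : ∀ i, x i * y i = 0 := by
    intro i; by_cases h : i ∈ A <;> simp [x, y, h]
  have h0' : ∀ i, y i * x i = 0 := fun i => by rw [mul_comm, h0]
  refine torus_eq_of_intertwine a (Sp.mk (Matrix.fromBlocks (Matrix.diagonal x) (Matrix.diagonal y)
    (-Matrix.diagonal y) (Matrix.diagonal x)) ?_ ?_) _ _ ?_
  · rw [Matrix.mem_unitaryGroup_iff, Matrix.star_eq_conjTranspose, Matrix.fromBlocks_conjTranspose,
      Matrix.fromBlocks_multiply]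
    simp [hx, hy', h1, h1', h0, h0']
  · rw [SymplecticGroup.mem_iff, Matrix.J, Matrix.fromBlocks_transpose,
      Matrix.fromBlocks_multiply, Matrix.fromBlocks_multiply]
    simp [h1, h0, h0', h1n]
  · show Matrix.fromBlocks _ _ _ _ * _ = _ * Matrix.fromBlocks _ _ _ _
    rw [ht, ht, Matrix.fromBlocks_multiply, Matrix.fromBlocks_multiply]
    simp only [Matrix.mul_zero, Matrix.zero_mul, add_zero, zero_add, Matrix.diagonal_mul_diagonal,
      Matrix.neg_mul, Matrix.mul_neg, neg_zero]
    congr 1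
    all_goals
      try apply congrArg Neg.neg
      apply congrArg Matrix.diagonal
      funext i
      by_cases h : i ∈ A <;> simp [x, y, flip, h]

/-! ## The restriction to the maximal torus as a polynomial -/

theorem eq_zero_of_aeval_eq_zero {n : ℕ} {s : Fin n → Set ℂ} (hs : ∀ i, (s i).Infinite)
    {P : MvPolynomial (Fin n) ℤ} (h : ∀ x ∈ Set.pi Set.univ s, aeval x P = 0) : P = 0 := by
  refine map_injective (Int.castRingHom ℂ) Int.cast_injective ?_
  rw [map_zero]
  refine funext_set s hs fun x hx => ?_
  rw [eval_map]
  exact h x hx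

/-- The function `t + t⁻¹ - 2` on the circle. -/
def circleU (z : Circle) : ℂ := z + ((z⁻¹ : Circle) : ℂ) - 2

theorem circleU_exp (θ : ℝ) : circleU (Circle.exp θ) = ((2 * Real.cos θ - 2 : ℝ) : ℂ) := by
  rw [circleU, ← Circle.exp_neg, Circle.coe_exp, Circle.coe_exp]
  push_cast
  rw [Complex.two_cos]

theorem infinite_range_circleU : (Set.range circleU).Infinite := by
  refine Set.infinite_of_injOn_mapsTo (s := Set.Icc 0 Real.pi)
    (f := fun θ : ℝ => circleU (Circle.exp θ)) ?_ (fun θ _ => ⟨_, rfl⟩)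
    (Set.Icc_infinite Real.pi_pos)
  intro θ hθ φ hφ h
  simp only [circleU_exp, Complex.ofReal_inj] at h
  exact Real.injOn_cos hθ hφ (by linarith)

/-- Evaluation of polynomials at `uⱼ = tⱼ + tⱼ⁻¹ - 2`, as functions on the torus. -/
def evalU (n : ℕ) : MvPolynomial (Fin n) ℤ →ₐ[ℤ] ((Fin n → Circle) → ℂ) :=
  aeval fun j t => circleU (t j)

theorem evalU_apply {n : ℕ} (P : MvPolynomial (Fin n) ℤ) (t : Fin n → Circle) :
    evalU n P t = aeval (fun j => circleU (t j)) P := by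
  have h : (Pi.evalAlgHom ℤ (fun _ : Fin n → Circle => ℂ) t).comp (evalU n) =
      aeval fun j => circleU (t j) := by
    ext j
    simp [evalU]
  exact DFunLike.congr_fun h P

theorem evalU_injective (n : ℕ) : Function.Injective (evalU n) := by
  rw [injective_iff_map_eq_zero]
  intro P hP
  refine eq_zero_of_aeval_eq_zero (fun _ => infinite_range_circleU) fun x hx => ?_
  choose t ht using fun i => hx i (Set.mem_univ i)
  have := congrFun hP t
  rw [evalU_apply] at this
  simp only [ht] at this
  exact this

/-- Evaluation of polynomials at the elementary symmetric functions of
`uⱼ = tⱼ + tⱼ⁻¹ - 2`, as functions on the torus. -/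
def evalE (n : ℕ) : MvPolynomial (Fin n) ℤ →ₐ[ℤ] ((Fin n → Circle) → ℂ) :=
  (evalU n).comp ((symmetricSubalgebra (Fin n) ℤ).val.comp (esymmAlgHom (Fin n) ℤ n))

theorem evalE_X {n : ℕ} (i : Fin n) : evalE n (X i) = evalU n (esymm (Fin n) ℤ (i + 1)) := by
  simp [evalE, esymmAlgHom_apply]

theorem evalE_injective (n : ℕ) : Function.Injective (evalE n) :=
  (evalU_injective n).comp (Subtype.val_injective.comp
    (esymmAlgHom_injective ℤ (by simp)))

/-- The polynomial expressing `tᵐ + t⁻ᵐ` (or `1` if `m = 0`) in `t + t⁻¹ - 2`. -/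
def symPow (m : ℕ) : Polynomial ℤ :=
  if m = 0 then 1 else (Polynomial.dickson 1 1 m).comp (Polynomial.X + 2)

/-- The right side runs over a set, which collapses to `{0}` when `m = 0`. This is why `symPow 0` is
`1` and not the Dickson value `2`. -/
theorem aeval_symPow (m : ℕ) (z : Circle) :
    Polynomial.aeval (circleU z) (symPow m) = ∑ j ∈ ({(m : ℤ), -(m : ℤ)} : Finset ℤ), (z : ℂ) ^ j := by
  by_cases hm : m = 0
  · simp [symPow, hm]
  · rw [Finset.sum_pair (by omega), symPow, if_neg hm, Polynomial.aeval_comp]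
    have h := Polynomial.dickson_one_one_eval_add_inv (z : ℂ) (z : ℂ)⁻¹
      (mul_inv_cancel₀ (Circle.coe_ne_zero z)) m
    rw [Polynomial.aeval_def, Polynomial.eval₂_eq_eval_map, Polynomial.map_dickson]
    simpa [circleU, show (Polynomial.aeval ((z : ℂ) + (z : ℂ)⁻¹ - 2)) (2 : Polynomial ℤ) = 2 from
      map_ofNat _ 2] using h

theorem torusChar_flip {n : ℕ} (A : Finset (Fin n)) (k : Fin n → ℤ) (t : Fin n → Circle) :
    torusChar k (flip A t) = torusChar (fun i => if i ∈ A then - k i else k i) t := by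
  rw [torusChar_apply, torusChar_apply]
  congr 1
  refine Finset.prod_congr rfl fun i _ => ?_
  by_cases h : i ∈ A <;> simp [flip, h] <;> rfl

/-- Invariance of the function passes to the coefficients, because a Laurent polynomial is
determined by its values on the torus. -/
theorem coeff_flip {n : ℕ} {c : (Fin n → ℤ) →₀ ℤ} (A : Finset (Fin n))
    (h : ∀ t, laurent n (.ofCoeff c) (flip A t) = laurent n (.ofCoeff c) t) (k : Fin n → ℤ) :
    c (fun i => if i ∈ A then - k i else k i) = c k := by
  let φ : (Fin n → ℤ) → (Fin n → ℤ) := fun k i => if i ∈ A then - k i else k i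
  have hφ : Function.Involutive φ := by
    intro k
    funext i
    by_cases h : i ∈ A <;> simp [φ, h]
  have h1 : laurent n (.ofCoeff (Finsupp.equivMapDomain hφ.toPerm c)) = laurent n (.ofCoeff c) := by
    funext t
    rw [← h t, laurent_ofCoeff, laurent_ofCoeff]
    refine Finset.sum_nbij' φ φ ?_ ?_ (fun k _ => hφ k) (fun k _ => hφ k) ?_
    · intro k hk
      simpa [Finsupp.equivMapDomain_apply] using hk
    · intro k hk
      simpa [Finsupp.equivMapDomain_apply, hφ k] using hk
    · intro k _
      rw [torusChar_flip]
      show _ = _ * torusChar (φ (φ k)) t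
      rw [hφ k]
      rfl
  have h2 := congrArg AddMonoidAlgebra.coeff (laurent_injective n h1)
  have h3 := DFunLike.congr_fun h2 k
  exact h3

/-- A Laurent polynomial which is invariant under inversion of any set of coordinates is a
polynomial in `uⱼ = tⱼ + tⱼ⁻¹ - 2`. -/
theorem exists_evalU_eq {n : ℕ} {f : (Fin n → Circle) → ℂ} (hf : f ∈ (laurent n).toRingHom.range)
    (h : ∀ A t, f (flip A t) = f t) : ∃ P, evalU n P = f := by
  obtain ⟨⟨c⟩, rfl⟩ := hf
  change ∀ A t, laurent n (.ofCoeff c) (flip A t) = laurent n (.ofCoeff c) t at h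
  show ∃ P, evalU n P = laurent n (.ofCoeff c)
  -- Flipping exactly the coordinates with negative exponent shows that a coefficient depends only
  -- on the absolute values of the exponents.
  have hc : ∀ k, c (fun i => ((k i).natAbs : ℤ)) = c k := by
    intro k
    rw [← coeff_flip (Finset.univ.filter fun i => k i < 0) (h _) k]
    congr 1
    funext i
    by_cases hi : k i < 0
    · simp [hi, abs_of_neg]
    · simp [hi, abs_of_nonneg (not_lt.1 hi)]
  let abs : (Fin n → ℤ) → (Fin n → ℕ) := fun k i => (k i).natAbs
  refine ⟨∑ m ∈ c.support.image abs, C (c fun i => (m i : ℤ)) *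
    ∏ i, Polynomial.aeval (X i : MvPolynomial (Fin n) ℤ) (symPow (m i)), ?_⟩
  funext t
  rw [evalU_apply, laurent_ofCoeff, map_sum,
    ← Finset.sum_fiberwise_of_maps_to (t := c.support.image abs) (g := abs)
      (fun k hk => Finset.mem_image_of_mem _ hk)]
  refine Finset.sum_congr rfl fun m hm => ?_
  obtain ⟨k₀, hk₀, rfl⟩ := Finset.mem_image.1 hm
  -- The exponents with prescribed absolute values form a product of sets `{m, -m}`, so the sum of
  -- characters over them factors into one-variable sums `symPow`.
  have hfib : c.support.filter (fun k => abs k = abs k₀) =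
      Fintype.piFinset fun i => ({(abs k₀ i : ℤ), -(abs k₀ i : ℤ)} : Finset ℤ) := by
    ext k
    simp only [Finset.mem_filter, Fintype.mem_piFinset, Finset.mem_insert, Finset.mem_singleton]
    constructor
    · rintro ⟨-, hk⟩ i
      rw [← hk]
      exact Int.natAbs_eq _
    · intro hk
      have hk' : abs k = abs k₀ := by
        funext i
        rcases hk i with h | h <;> · show (k i).natAbs = _; rw [h]; simp
      refine ⟨?_, hk'⟩
      rw [Finsupp.mem_support_iff] at hk₀ ⊢
      rw [← hc] at hk₀ ⊢
      have : (fun i => ((k i).natAbs : ℤ)) = fun i => ((k₀ i).natAbs : ℤ) := by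
        funext i; exact congrArg Nat.cast (congrFun hk' i)
      rwa [this]
  rw [hfib, map_mul, map_prod, aeval_C]
  simp only [← Polynomial.aeval_algHom_apply, aeval_X, aeval_symPow]
  rw [Finset.prod_univ_sum, Finset.mul_sum]
  refine Finset.sum_congr rfl fun k hk => ?_
  rw [← hfib, Finset.mem_filter] at hk
  rw [torusChar_eq_prod, ← hc k]
  have : (fun i => ((k i).natAbs : ℤ)) = fun i => (abs k₀ i : ℤ) := by
    funext i; exact congrArg Nat.cast (congrFun hk.2 i)
  rw [this]
  rfl

/-- The restriction of an element of `R(Sp(n))` to the maximal torus is a polynomial in the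
elementary symmetric functions of `uⱼ = tⱼ + tⱼ⁻¹ - 2`. -/
theorem exists_evalE_eq {n : ℕ} (a : repRing (Sp n)) :
    ∃ p, evalE n p = (restrict (torusIncl n) a : (Fin n → Circle) → ℂ) := by
  obtain ⟨P, hP⟩ := exists_evalU_eq (repRing_torus_le n (restrict (torusIncl n) a).2)
    (fun A t => torus_flip a A t)
  have hs : P.IsSymmetric := by
    intro σ
    refine evalU_injective n ?_
    funext t
    have h := torus_perm a σ t
    have h1 := congrFun hP t
    have h2 := congrFun hP (t ∘ σ)
    rw [evalU_apply] at h1 h2 ⊢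
    rw [aeval_rename, evalU_apply, h1]
    exact h2.trans h
  obtain ⟨p, hp⟩ := esymmAlgHom_surjective (σ := Fin n) ℤ (n := n) (by simp) ⟨P, hs⟩
  refine ⟨p, ?_⟩
  rw [← hP]
  show evalU n (esymmAlgHom (Fin n) ℤ n p).1 = _
  rw [hp]

end SymplecticVerlinde
end

noncomputable section

namespace SymplecticVerlinde

open MvPolynomial

/-! ## Exterior powers of a diagonal matrix -/

theorem coeff_prod_one_add {R I : Type} [CommRing R] [Fintype I] (d : I → R) (k : ℕ) :
    (∏ i, (1 + Polynomial.C (d i) * Polynomial.X)).coeff k =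
      ∑ s ∈ Finset.powersetCard k Finset.univ, ∏ i ∈ s, d i := by
  rw [Finset.prod_one_add, Polynomial.finsetSum_coeff, Finset.powersetCard_eq_filter,
    Finset.sum_filter]
  refine Finset.sum_congr rfl fun s _ => ?_
  rw [Finset.prod_mul_distrib, Finset.prod_const, ← map_prod, Polynomial.coeff_C_mul_X_pow]
  exact if_congr eq_comm rfl rfl

theorem prod_add_mul_eq_sum {R : Type} [CommRing R] {n : ℕ} (u : Fin n → R) (x y : R) :
    ∏ j, (y + u j * x) = ∑ k ∈ Finset.range (n + 1),
      (∑ s ∈ Finset.powersetCard k Finset.univ, ∏ j ∈ s, u j) * x ^ k * y ^ (n - k) := by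
  have h : ∀ j, y + u j * x = u j * x + y := fun j => add_comm _ _
  simp only [h]
  rw [Finset.prod_add, Finset.sum_powerset, Finset.card_univ, Fintype.card_fin]
  refine Finset.sum_congr rfl fun k _ => ?_
  rw [Finset.sum_mul, Finset.sum_mul]
  refine Finset.sum_congr rfl fun s hs => ?_
  have hs' := (Finset.mem_powersetCard.1 hs).2
  rw [Finset.prod_mul_distrib, Finset.prod_const, Finset.prod_const, hs',
    Finset.card_sdiff_of_subset (Finset.subset_univ _), hs', Finset.card_univ, Fintype.card_fin]

theorem trace_exteriorPower_diagonal {I : Type} [Fintype I] [DecidableEq I] (d : I → ℂ) (k : ℕ) :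
    LinearMap.trace ℂ (⋀[ℂ]^k (I → ℂ))
      (exteriorPower.map k (Matrix.toLin' (Matrix.diagonal d))) =
      ∑ s ∈ Finset.powersetCard k Finset.univ, ∏ i ∈ s, d i := by
  let : LinearOrder I := LinearOrder.lift' (Fintype.equivFin I) (Fintype.equivFin I).injective
  let b := (Pi.basisFun ℂ I).exteriorPower k
  rw [LinearMap.trace_eq_matrix_trace ℂ b, Matrix.trace]
  have h : ∀ s : Set.powersetCard I k,
      exteriorPower.map k (Matrix.toLin' (Matrix.diagonal d)) (b s) =
        (∏ i ∈ s.1, d i) • b s := by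
    intro s
    have h1 : (Matrix.toLin' (Matrix.diagonal d)) ∘ (Pi.basisFun ℂ I) =
        fun i => d i • Pi.basisFun ℂ I i := by
      funext i
      ext j
      by_cases hj : j = i
      · simp [hj, Matrix.mulVec_diagonal]
      · simp [hj, Matrix.mulVec_diagonal]
    rw [exteriorPower.basis_apply, exteriorPower.map_apply_ιMulti_family, h1]
    refine (AlternatingMap.map_smul_univ (exteriorPower.ιMulti ℂ k)
      (fun i => d (Set.powersetCard.ofFinEmbEquiv.symm s i))
      (fun i => Pi.basisFun ℂ I (Set.powersetCard.ofFinEmbEquiv.symm s i))).trans ?_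
    congr 1
    rw [← Finset.map_orderEmbOfFin_univ s.1 s.2, Finset.prod_map]
    rfl
  have h2 : ∀ s : Set.powersetCard I k, LinearMap.toMatrix b b
      (exteriorPower.map k (Matrix.toLin' (Matrix.diagonal d))) s s = ∏ i ∈ s.1, d i := by
    intro s
    rw [LinearMap.toMatrix_apply, h]
    simp
  simp only [Matrix.diag_apply, h2]
  refine (Finset.sum_subtype (Finset.powersetCard k Finset.univ) (fun s => ?_)
    fun s => ∏ i ∈ s, d i).symm
  simp [Finset.mem_powersetCard, Set.powersetCard]

/-! ## Generating functions -/

/-- The polynomial `∑ⱼ cⱼ Xʲ (1 + X)^(2n - 2j)`, where `j` runs from `0` to `n`. -/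
def lam {B : Type} [CommRing B] (n : ℕ) (c : ℕ → B) : Polynomial B :=
  ∑ j ∈ Finset.range (n + 1),
    Polynomial.C (c j) * Polynomial.X ^ j * ((1 + Polynomial.X) ^ 2) ^ (n - j)

theorem map_lam {B B' : Type} [CommRing B] [CommRing B'] (f : B →+* B') (n : ℕ) (c : ℕ → B) :
    (lam n c).map f = lam n (fun j => f (c j)) := by
  simp [lam, Polynomial.map_sum]

theorem coeff_one_lam {B : Type} [CommRing B] {n : ℕ} (hn : 1 ≤ n) (c : ℕ → B) :
    (lam n c).coeff 1 = 2 * n * c 0 + c 1 := by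
  obtain ⟨m, rfl⟩ := Nat.exists_eq_add_of_le' hn
  rw [lam, Finset.sum_range_succ', Finset.sum_range_succ', Polynomial.coeff_add,
    Polynomial.coeff_add, Polynomial.finsetSum_coeff, Finset.sum_eq_zero]
  · rw [mul_assoc, mul_assoc, Polynomial.coeff_C_mul, Polynomial.coeff_C_mul,
      Polynomial.coeff_X_pow_mul', ← pow_mul, ← pow_mul, pow_zero, one_mul,
      Polynomial.coeff_one_add_X_pow, Polynomial.coeff_one_add_X_pow]
    simp
    ring
  · intro j _
    rw [mul_assoc, Polynomial.coeff_C_mul, Polynomial.coeff_X_pow_mul', if_neg (by omega), mul_zero]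

/-- The elements `1, γ₁, …, γₙ, 0, …` of `ℤ[γ₁, …, γₙ]`. -/
def gVar₀ (n k : ℕ) : MvPolynomial (Fin n) ℤ := if k = 0 then 1 else gVar n k

theorem evalE_gVar₀ {n k : ℕ} (hk : k ≤ n) (t : Fin n → Circle) : evalE n (gVar₀ n k) t =
    ∑ s ∈ Finset.powersetCard k Finset.univ, ∏ j ∈ s, circleU (t j) := by
  have h : evalE n (gVar₀ n k) = evalU n (esymm (Fin n) ℤ k) := by
    rcases k with _ | k
    · simp [gVar₀]
    · rw [gVar₀, if_neg k.succ_ne_zero, gVar, dif_pos (by omega), evalE_X]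
      rfl
  rw [h, evalU_apply, esymm]
  simp

/-- On the torus the exterior powers have generating function `∏ (1 + tⱼX)(1 + tⱼ⁻¹X) = ∏ ((1 + X)²
+ uⱼX)`, and expanding the product in the `uⱼ` yields their elementary symmetric functions. -/
theorem restrict_ext (n k : ℕ) :
    (restrict (torusIncl n) (ext n k) : (Fin n → Circle) → ℂ) =
      evalE n ((lam n (gVar₀ n)).coeff k) := by
  funext t
  have h1 : evalE n ((lam n (gVar₀ n)).coeff k) t =
      ((Pi.evalRingHom (fun _ : Fin n → Circle => ℂ) t).comp (evalE n).toRingHom)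
        ((lam n (gVar₀ n)).coeff k) := rfl
  rw [h1, ← Polynomial.coeff_map, map_lam]
  have h2 : lam n (fun j => ((Pi.evalRingHom (fun _ : Fin n → Circle => ℂ) t).comp
      (evalE n).toRingHom) (gVar₀ n j)) =
      ∏ j, ((1 + Polynomial.X) ^ 2 + Polynomial.C (circleU (t j)) * Polynomial.X) := by
    rw [prod_add_mul_eq_sum, lam]
    refine Finset.sum_congr rfl fun j hj => ?_
    have := evalE_gVar₀ (Finset.mem_range_succ_iff.1 hj) t
    show Polynomial.C (evalE n (gVar₀ n j) t) * _ * _ = _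
    rw [this]
    simp
  rw [h2]
  show LinearMap.trace ℂ _ (exteriorPower.map k (Matrix.toLin' (torusMatrix n t))) = _
  rw [torusMatrix, trace_exteriorPower_diagonal, ← coeff_prod_one_add, Fintype.prod_sum_type,
    ← Finset.prod_mul_distrib]
  congr 1
  refine Finset.prod_congr rfl fun j _ => ?_
  have h3 : Polynomial.C (t j : ℂ) * Polynomial.C (((t j)⁻¹ : Circle) : ℂ) = 1 := by
    rw [← Polynomial.C_mul, ← Circle.coe_mul, mul_inv_cancel]; simp
  simp only [Sum.elim_inl, Sum.elim_inr, circleU, Polynomial.C_sub, Polynomial.C_add]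
  have h4 : Polynomial.C (2 : ℂ) = 2 := rfl
  rw [h4]
  linear_combination Polynomial.X ^ 2 * h3

/-- Coefficient of `Xᵏ` in `(1 + X)⁻ᶜ * Xˡ (1 + X)ᵐ = Xˡ (1 + X)^(m - c)`, by the Chu-Vandermonde
identity. -/
theorem sum_choose_mul_coeff (k l m : ℕ) (c : ℤ) :
    ∑ j ∈ Finset.range (k + 1), Ring.choose (-c) (k - j) *
      ((Polynomial.X ^ l * (1 + Polynomial.X) ^ m : Polynomial ℤ).coeff j) =
      if l ≤ k then Ring.choose ((m : ℤ) - c) (k - l) else 0 := by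
  have hc : ∀ j, (Polynomial.X ^ l * (1 + Polynomial.X) ^ m : Polynomial ℤ).coeff j =
      if l ≤ j then (m.choose (j - l) : ℤ) else 0 := by
    intro j
    rw [Polynomial.coeff_X_pow_mul', Polynomial.coeff_one_add_X_pow]
  simp only [hc]
  split_ifs with h
  · obtain ⟨p, rfl⟩ := Nat.exists_eq_add_of_le h
    rw [add_assoc, Finset.sum_range_add, Finset.sum_eq_zero, zero_add, Nat.add_sub_cancel_left,
      sub_eq_add_neg, Ring.add_choose_eq _ (Commute.all _ _),
      Finset.Nat.sum_antidiagonal_eq_sum_range_succ_mk]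
    · refine Finset.sum_congr rfl fun i hi => ?_
      rw [if_pos (by omega), Nat.add_sub_cancel_left, Nat.add_sub_add_left, mul_comm,
        Ring.choose_natCast]
    · intro j hj
      rw [if_neg (by simpa using hj), mul_zero]
  · refine Finset.sum_eq_zero fun j hj => ?_
    rw [if_neg (by have := Finset.mem_range_succ_iff.1 hj; omega), mul_zero]

theorem restrict_extShift (n k : ℕ) (c : ℤ) :
    (restrict (torusIncl n) (extShift n k c) : (Fin n → Circle) → ℂ) =
      evalE n (∑ l ∈ Finset.range (n + 1),
        (if l ≤ k then Ring.choose (((2 * (n - l) : ℕ) : ℤ) - c) (k - l) else 0) • gVar₀ n l) := by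
  simp only [← sum_choose_mul_coeff, Finset.sum_smul]
  rw [Finset.sum_comm, extShift, map_sum, AddSubmonoidClass.coe_finsetSum, map_sum]
  refine Finset.sum_congr rfl fun j _ => ?_
  rw [map_zsmul, AddSubgroupClass.coe_zsmul, restrict_ext, ← map_zsmul]
  congr 1
  rw [lam, Polynomial.finsetSum_coeff, Finset.smul_sum]
  refine Finset.sum_congr rfl fun l _ => ?_
  rw [mul_smul, mul_assoc, Polynomial.coeff_C_mul]
  congr 1
  have h := Polynomial.coeff_map (Int.castRingHom (MvPolynomial (Fin n) ℤ)) j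
    (p := Polynomial.X ^ l * (1 + Polynomial.X) ^ (2 * (n - l)))
  rw [zsmul_eq_mul, mul_comm]
  congr 1
  rw [← pow_mul, ← eq_intCast (Int.castRingHom (MvPolynomial (Fin n) ℤ)), ← h]
  simp

/-- The shift in the definition of `γₖ` is made for this. With `m = k - 1 - l`, the elementary
symmetric function of index `l < k` enters with coefficient `binom(2m, m+1) - binom(2m, m-1)`, which
vanishes by symmetry, and only index `k` survives. -/
theorem restrict_gam {n k : ℕ} (h1 : 1 ≤ k) (hk : k ≤ n) :
    (restrict (torusIncl n) (gam n k) : (Fin n → Circle) → ℂ) = evalE n (gVar n k) := by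
  have hg : gVar n k = gVar₀ n k := by rw [gVar₀, if_neg (by omega)]
  rw [hg]
  rcases h1.eq_or_lt with rfl | h2
  · rw [gam, if_pos le_rfl, map_sub, AddSubgroupClass.coe_sub, restrict_ext, map_natCast]
    rw [coeff_one_lam (by omega), gVar₀, gVar₀, if_pos rfl, if_neg one_ne_zero, mul_one, map_add,
      map_mul, map_natCast, map_ofNat]
    have h : (((2 * n : ℕ) : repRing (Fin n → Circle)) : (Fin n → Circle) → ℂ) = 2 * n := by
      rw [SubringClass.coe_natCast, Nat.cast_mul, Nat.cast_ofNat]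
    rw [h, add_sub_cancel_left]
  · rw [gam, if_neg (by omega), map_sub, AddSubgroupClass.coe_sub, restrict_extShift,
      restrict_extShift, ← map_sub, ← Finset.sum_sub_distrib]
    congr 1
    simp only [← sub_smul]
    rw [Finset.sum_eq_single_of_mem k (Finset.mem_range_succ_iff.2 hk)]
    · rw [if_pos le_rfl, if_neg (by omega)]
      simp
    · intro l hl hlk
      have hl := Finset.mem_range_succ_iff.1 hl
      convert zero_smul ℤ (gVar₀ n l)
      rcases lt_or_gt_of_ne hlk with h | h
      · obtain ⟨m, rfl⟩ : ∃ m, k = l + 1 + m := ⟨k - l - 1, by omega⟩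
        have h3 : ((2 * (n - l) : ℕ) : ℤ) - (2 * (n : ℤ) - 2 * (((l + 1 + m : ℕ) : ℤ) - 1)) =
            ((2 * m : ℕ) : ℤ) := by
          push_cast [Nat.cast_sub hl]; ring
        rw [h3, Ring.choose_natCast, Ring.choose_natCast, if_pos (by omega)]
        rcases m with _ | m
        · rw [if_neg (by omega)]
          simp
        · rw [if_pos (by omega), sub_eq_zero]
          have h4 : l + 1 + (m + 1) - l = m + 2 := by omega
          have h5 : l + 1 + (m + 1) - 2 - l = m := by omega
          rw [h4, h5, Nat.choose_symm_of_eq_add]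
          omega
      · rw [if_neg (by omega), if_neg (by omega), sub_zero]

end SymplecticVerlinde
end

noncomputable section

namespace SymplecticVerlinde

open MvPolynomial Filter Topology Asymptotics

/-! ## The Atiyah-Hirzebruch filtration in terms of polynomials -/

/-- The weight of a monomial in `γ₁, …, γₙ`, where `γᵢ` has weight `i`. -/
def wt {n : ℕ} (m : Fin n →₀ ℕ) : ℕ := Finsupp.weight (fun i : Fin n => (i : ℕ) + 1) m

/-- The ideal of `ℤ[γ₁, …, γₙ]` generated by the monomials of weight at least `d`. -/
def weightIdeal (n d : ℕ) : Ideal (MvPolynomial (Fin n) ℤ) :=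
  Ideal.span {q | ∃ m : Fin n →₀ ℕ, d ≤ wt m ∧ q = monomial m 1}

theorem mem_weightIdeal {n d : ℕ} {p : MvPolynomial (Fin n) ℤ}
    (h : ∀ m, coeff m p ≠ 0 → d ≤ wt m) : p ∈ weightIdeal n d := by
  rw [p.as_sum]
  refine Ideal.sum_mem _ fun m hm => ?_
  rw [← mul_one (coeff m p), ← C_mul_monomial]
  exact Ideal.mul_mem_left _ _ (Ideal.subset_span ⟨m, h m (mem_support_iff.1 hm), rfl⟩)

/-! ### Filtrations under ring homomorphisms and the filtration by weight -/

namespace RingFiltration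

variable {R : Type} [CommRing R] (F : RingFiltration R)

theorem mul_mem {i j : ℕ} {x y : R} (hx : x ∈ F.piece i) (hy : y ∈ F.piece j) :
    x * y ∈ F.piece (i + j) := F.mul_le _ _ (Ideal.mul_mem_mul hx hy)

theorem pow_mem {i : ℕ} {x : R} (hx : x ∈ F.piece i) (a : ℕ) : x ^ a ∈ F.piece (a * i) := by
  induction a with
  | zero => rw [zero_mul, F.piece_zero]; trivial
  | succ a ih =>
    rw [pow_succ, Nat.succ_mul]
    exact F.mul_mem ih hx

theorem map_mem_of_mem_weightIdeal {n d : ℕ} (φ : MvPolynomial (Fin n) ℤ →+* R)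
    (hφ : ∀ i : Fin n, φ (X i) ∈ F.piece ((i : ℕ) + 1)) {p : MvPolynomial (Fin n) ℤ}
    (hp : p ∈ weightIdeal n d) : φ p ∈ F.piece d := by
  have h : weightIdeal n d ≤ (F.piece d).comap φ := by
    refine Ideal.span_le.2 ?_
    rintro _ ⟨m, hm, rfl⟩
    refine F.antitone hm ?_
    show φ (monomial m 1) ∈ _
    rw [monomial_eq, C_1, one_mul, wt, Finsupp.weight_apply, Finsupp.prod, Finsupp.sum, map_prod]
    have : ∀ s : Finset (Fin n), ∏ i ∈ s, φ (X i ^ m i) ∈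
        F.piece (∑ i ∈ s, m i • ((i : ℕ) + 1)) := by
      intro s
      induction s using Finset.induction_on with
      | empty => rw [Finset.sum_empty, F.piece_zero]; trivial
      | insert i s hi ih =>
        rw [Finset.prod_insert hi, Finset.sum_insert hi, map_pow]
        exact F.mul_mem (F.pow_mem (hφ i) _) ih
    exact this _
  exact h hp

/-- The image of a filtration under a ring homomorphism. -/
def map {R' : Type} [CommRing R'] (φ : R →+* R') : RingFiltration R' where
  piece k := (F.piece k).map φ
  piece_zero := by rw [F.piece_zero, Ideal.map_top]
  antitone _ _ h := Ideal.map_mono (F.antitone h)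
  mul_le i j := by
    rw [← Ideal.map_mul]
    exact Ideal.map_mono (F.mul_le i j)

end RingFiltration

/-- The filtration of `ℤ[γ₁, …, γₙ]` by weight. -/
def weightFiltration (n : ℕ) : RingFiltration (MvPolynomial (Fin n) ℤ) where
  piece := weightIdeal n
  piece_zero := (Ideal.eq_top_iff_one _).2 (Ideal.subset_span ⟨0, Nat.zero_le _, rfl⟩)
  antitone i j h := Ideal.span_mono fun _ ⟨m, hm, hq⟩ => ⟨m, h.trans hm, hq⟩
  mul_le i j := by
    rw [weightIdeal, weightIdeal, Ideal.span_mul_span']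
    refine Ideal.span_mono ?_
    rintro _ ⟨_, ⟨m, hm, rfl⟩, _, ⟨m', hm', rfl⟩, rfl⟩
    refine ⟨m + m', ?_, ?_⟩
    · rw [wt, map_add]
      exact add_le_add hm hm'
    · simp [monomial_mul]

theorem gVar_mem_weightIdeal {n k : ℕ} (h1 : 1 ≤ k) (hk : k ≤ n) :
    gVar n k ∈ weightIdeal n k := by
  rw [gVar, dif_pos (by omega)]
  refine Ideal.subset_span ⟨Finsupp.single ⟨k - 1, by omega⟩ 1, ?_, rfl⟩
  rw [wt, Finsupp.weight_single, one_smul]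
  show k ≤ k - 1 + 1
  omega

theorem evalU_X_mem (n : ℕ) (j : Fin n) :
    (fun t : Fin n → Circle => circleU (t j)) ∈ repRing (Fin n → Circle) := by
  have h : (fun t : Fin n → Circle => circleU (t j)) =
      (torusChar (Pi.single j 1) : (Fin n → Circle) → ℂ) + torusChar (Pi.single j (-1)) - 2 := by
    funext t
    simp only [Pi.sub_apply, Pi.add_apply, torusChar_apply]
    rw [Finset.prod_eq_single j (fun i _ hi => by simp [hi]) (by simp),
      Finset.prod_eq_single j (fun i _ hi => by simp [hi]) (by simp)]
    simp [circleU]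
  rw [h]
  exact sub_mem (add_mem (torusChar_mem_repRing _) (torusChar_mem_repRing _))
    (natCast_mem (repRing (Fin n → Circle)) 2)

theorem evalU_X_mem_sq (n : ℕ) (j : Fin n) :
    (⟨_, evalU_X_mem n j⟩ : repRing (Fin n → Circle)) ∈
      augmentationIdeal (Fin n → Circle) ^ 2 := by
  let τ : ℤ → repRing (Fin n → Circle) := fun k => ⟨_, torusChar_mem_repRing (Pi.single j k)⟩
  have hτ : ∀ k t, (τ k : (Fin n → Circle) → ℂ) t = ((t j ^ k : Circle) : ℂ) := by
    intro k t
    show torusChar _ t = _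
    rw [torusChar_apply, Finset.prod_eq_single j (fun i _ hi => by simp [hi]) (by simp)]
    simp
  have h : ∀ k, τ k - 1 ∈ augmentationIdeal (Fin n → Circle) := by
    intro k
    show (τ k : (Fin n → Circle) → ℂ) 1 - 1 = 0
    rw [hτ]
    simp
  -- The identity `t + t⁻¹ - 2 = -(t - 1)(t⁻¹ - 1)` exhibits `uⱼ` as a product of two elements of
  -- the augmentation ideal.
  have he : (⟨_, evalU_X_mem n j⟩ : repRing (Fin n → Circle)) = -((τ 1 - 1) * (τ (-1) - 1)) := by
    refine Subtype.ext (funext fun t => ?_)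
    show circleU (t j) = -(((τ 1 : (Fin n → Circle) → ℂ) t - 1) *
      ((τ (-1) : (Fin n → Circle) → ℂ) t - 1))
    rw [hτ, hτ, zpow_one, zpow_neg_one, circleU]
    have h3 : (t j : ℂ) * (((t j)⁻¹ : Circle) : ℂ) = 1 := by
      rw [← Circle.coe_mul, mul_inv_cancel]; simp
    linear_combination h3
  rw [he, sq]
  exact neg_mem (Ideal.mul_mem_mul (h 1) (h (-1)))

theorem gam_mem_ahFiltration {n k : ℕ} (h1 : 1 ≤ k) (hk : k ≤ n) :
    gam n k ∈ (ahFiltration n).piece k := by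
  show restrict (torusIncl n) (gam n k) ∈ augmentationIdeal (Fin n → Circle) ^ (2 * k)
  have h : restrict (torusIncl n) (gam n k) = ∑ s ∈ Finset.powersetCard k Finset.univ,
      ∏ j ∈ s, (⟨_, evalU_X_mem n j⟩ : repRing (Fin n → Circle)) := by
    refine Subtype.ext (funext fun t => ?_)
    have hg : gVar n k = gVar₀ n k := by rw [gVar₀, if_neg (by omega)]
    rw [restrict_gam h1 hk, hg, evalE_gVar₀ hk]
    rw [AddSubmonoidClass.coe_finsetSum, Finset.sum_apply]
    refine Finset.sum_congr rfl fun s _ => ?_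
    rw [SubmonoidClass.coe_finsetProd, Finset.prod_apply]
  rw [h]
  refine Ideal.sum_mem _ fun s hs => ?_
  rw [← (Finset.mem_powersetCard.1 hs).2, pow_mul, ← Finset.prod_const]
  exact Ideal.prod_mem_prod fun j _ => evalU_X_mem_sq n j

/-- The ring homomorphism from polynomials to `R(Sp(n))` defined by the elements `γᵢ`. -/
def aevalGam (n : ℕ) : MvPolynomial (Fin n) ℤ →ₐ[ℤ] repRing (Sp n) :=
  aeval fun i => gam n (i + 1)

theorem restrict_aevalGam (n : ℕ) (p : MvPolynomial (Fin n) ℤ) :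
    (restrict (torusIncl n) (aevalGam n p) : (Fin n → Circle) → ℂ) = evalE n p := by
  have h : (((repRing (Fin n → Circle)).subtype.comp (restrict (torusIncl n))).comp
      (aevalGam n).toRingHom) = (evalE n).toRingHom := by
    refine ringHom_ext (fun _ => by simp) fun i => ?_
    show (restrict (torusIncl n) (aevalGam n (X i)) : (Fin n → Circle) → ℂ) = evalE n (X i)
    rw [aevalGam, aeval_X, restrict_gam (by omega) (by omega), gVar, dif_pos (by simp)]
    rfl
  exact DFunLike.congr_fun h p

theorem aevalGam_mem {n d : ℕ} {p : MvPolynomial (Fin n) ℤ} (hp : p ∈ weightIdeal n d) :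
    aevalGam n p ∈ (ahFiltration n).piece d := by
  refine (ahFiltration n).map_mem_of_mem_weightIdeal (aevalGam n).toRingHom (fun i => ?_) hp
  show aevalGam n (X i) ∈ _
  rw [aevalGam, aeval_X]
  exact gam_mem_ahFiltration (by omega) (by omega)

/-- A curve on the torus along which `tⱼ + tⱼ⁻¹ - 2` equals `-s²wⱼ²` for small `s`. -/
def torusCurve {n : ℕ} (w : Fin n → ℝ) (s : ℝ) : Fin n → Circle :=
  fun j => Circle.exp (2 * Real.arcsin (s * w j / 2))

theorem torusCurve_zero {n : ℕ} (w : Fin n → ℝ) : torusCurve w 0 = 1 := by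
  funext j
  simp [torusCurve]

theorem circleU_torusCurve {n : ℕ} (w : Fin n → ℝ) (j : Fin n) {s : ℝ} (hs : |s * w j| ≤ 2) :
    circleU (torusCurve w s j) = (s : ℂ) ^ 2 * (-(w j : ℂ) ^ 2) := by
  obtain ⟨h1, h2⟩ := abs_le.1 hs
  rw [torusCurve, circleU_exp, Real.cos_two_mul, Real.cos_sq', Real.sin_arcsin (by linarith)
    (by linarith)]
  push_cast
  ring

theorem differentiableAt_torusCurve {n : ℕ} (w : Fin n → ℝ) {f : (Fin n → Circle) → ℂ}
    (hf : f ∈ repRing (Fin n → Circle)) :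
    DifferentiableAt ℝ (fun s => f (torusCurve w s)) 0 := by
  obtain ⟨c, rfl⟩ := repRing_torus_le n hf
  show DifferentiableAt ℝ (fun s => laurent n c (torusCurve w s)) 0
  simp only [laurent_apply, torusChar_eq_prod]
  refine DifferentiableAt.fun_sum fun k _ => DifferentiableAt.const_mul ?_ _
  refine DifferentiableAt.fun_finsetProd fun j _ => ?_
  have h : ∀ s : ℝ, ((torusCurve w s j : Circle) : ℂ) ^ k j =
      Complex.exp (((k j * (2 * Real.arcsin (s * w j / 2)) : ℝ) : ℂ) * Complex.I) := by
    intro s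
    rw [torusCurve, ← Circle.coe_zpow, ← Circle.exp_zsmul, Circle.coe_exp, zsmul_eq_mul]
  simp only [h]
  have h1 : DifferentiableAt ℝ (fun s : ℝ => Real.arcsin (s * w j / 2)) 0 := by
    have h2 : DifferentiableAt ℝ Real.arcsin (0 * w j / 2) :=
      Real.differentiableAt_arcsin.2 (by norm_num)
    exact DifferentiableAt.comp (g := Real.arcsin) (f := fun s : ℝ => s * w j / 2) (0 : ℝ) h2
      (by fun_prop)
  refine DifferentiableAt.cexp (DifferentiableAt.mul_const ?_ _)
  have h3 : DifferentiableAt ℝ (fun s : ℝ => (k j * (2 * Real.arcsin (s * w j / 2)) : ℝ)) 0 :=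
    (h1.const_mul _).const_mul _
  exact Complex.ofRealCLM.differentiableAt.comp (0 : ℝ) h3

/-- The curve passes through `1` at `s = 0` and virtual characters are differentiable along it, so
each factor from the augmentation ideal contributes one order of vanishing. -/
theorem isBigO_torusCurve {n : ℕ} (w : Fin n → ℝ) (m : ℕ) {f : repRing (Fin n → Circle)}
    (hf : f ∈ augmentationIdeal (Fin n → Circle) ^ m) :
    (fun s => (f : (Fin n → Circle) → ℂ) (torusCurve w s)) =O[𝓝 0] fun s : ℝ => s ^ m := by
  induction m generalizing f with
  | zero =>
    simp only [pow_zero]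
    exact (differentiableAt_torusCurve w f.2).continuousAt.isBigO_one ℝ
  | succ m ih =>
    rw [pow_succ] at hf
    induction hf using Submodule.mul_induction_on' with
    | mem_mul_mem a ha b hb =>
      simp only [pow_succ]
      refine (ih ha).mul ?_
      have h := (differentiableAt_torusCurve w b.2).isBigO_sub
      have hb' : (b : (Fin n → Circle) → ℂ) 1 = 0 := hb
      simpa [torusCurve_zero, hb'] using h
    | add a _ b _ h1 h2 => exact h1.add h2

theorem X_pow_dvd_of_isBigO (m : ℕ) {q : Polynomial ℂ}
    (h : (fun s : ℝ => q.eval (s : ℂ)) =O[𝓝[≠] 0] fun s : ℝ => s ^ m) :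
    Polynomial.X ^ m ∣ q := by
  induction m generalizing q with
  | zero => simp
  | succ m ih =>
    have h0 : q.eval 0 = 0 := by
      have h1 : Tendsto (fun s : ℝ => s ^ (m + 1)) (𝓝[≠] 0) (𝓝 0) := by
        have : ContinuousAt (fun s : ℝ => s ^ (m + 1)) 0 := by fun_prop
        simpa using this.tendsto.mono_left nhdsWithin_le_nhds
      have h2 : Tendsto (fun s : ℝ => q.eval (s : ℂ)) (𝓝[≠] 0) (𝓝 (q.eval 0)) := by
        have : ContinuousAt (fun s : ℝ => q.eval (s : ℂ)) 0 :=
          (q.continuous.comp Complex.continuous_ofReal).continuousAt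
        simpa using this.tendsto.mono_left nhdsWithin_le_nhds
      exact tendsto_nhds_unique h2 (h.trans_tendsto h1)
    obtain ⟨q', rfl⟩ := Polynomial.X_dvd_iff.2 ((Polynomial.coeff_zero_eq_eval_zero q).trans h0)
    rw [pow_succ']
    refine mul_dvd_mul_left _ (ih ?_)
    obtain ⟨c, hc⟩ := h.bound
    refine IsBigO.of_bound c ?_
    filter_upwards [hc, self_mem_nhdsWithin] with s hs hs0
    have hs0' : 0 < ‖s‖ := norm_pos_iff.2 hs0
    rw [Polynomial.eval_mul, Polynomial.eval_X, norm_mul, Complex.norm_real, pow_succ', norm_mul,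
      mul_left_comm] at hs
    exact le_of_mul_le_mul_left hs hs0'

theorem aeval_esymm_mul {n : ℕ} (s : ℂ) (u : Fin n → ℂ) (k : ℕ) :
    aeval (fun j => s ^ 2 * u j) (esymm (Fin n) ℤ k) =
      s ^ (2 * k) * aeval u (esymm (Fin n) ℤ k) := by
  rw [esymm, map_sum, map_sum, Finset.mul_sum]
  refine Finset.sum_congr rfl fun t ht => ?_
  rw [map_prod, map_prod]
  simp only [aeval_X]
  rw [Finset.prod_mul_distrib, Finset.prod_const, (Finset.mem_powersetCard.1 ht).2, pow_mul]

/-- Along the curves the `i`-th elementary symmetric function of the `uⱼ` is `s^(2i)` times its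
value at `-wⱼ²`, so twice the weight becomes the order in `s`. A component of `p` of weight below
`d` then gives a coefficient of a polynomial in `s` that is `O(s^(2d))`. It vanishes for all `w`,
and algebraic independence of the elementary symmetric polynomials makes the component zero. -/
theorem mem_weightIdeal_of_restrict {n d : ℕ} {a : repRing (Sp n)} {p : MvPolynomial (Fin n) ℤ}
    (ha : a ∈ (ahFiltration n).piece d)
    (hp : evalE n p = (restrict (torusIncl n) a : (Fin n → Circle) → ℂ)) :
    p ∈ weightIdeal n d := by
  refine mem_weightIdeal fun m hm => ?_
  by_contra! hlt
  refine hm ?_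
  let w : Fin n → ℕ := fun i => (i : ℕ) + 1
  suffices h : weightedHomogeneousComponent w (wt m) p = 0 by
    have h1 := coeff_weightedHomogeneousComponent (w := w) (wt m) p m
    rw [h, if_pos (show Finsupp.weight w m = wt m from rfl)] at h1
    exact h1.symm
  refine esymmAlgHom_injective (σ := Fin n) ℤ (n := n) (by simp) ?_
  rw [map_zero]
  refine Subtype.ext ?_
  have hinf : (Set.range fun x : ℝ => -(x : ℂ) ^ 2).Infinite := by
    refine Set.infinite_of_injOn_mapsTo (s := Set.Ici (0 : ℝ))
      (f := fun x : ℝ => -(x : ℂ) ^ 2) ?_ (fun x _ => ⟨_, rfl⟩) (Set.Ici_infinite 0)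
    intro x hx y hy h
    have h' : x ^ 2 = y ^ 2 := by
      have := neg_injective h
      exact_mod_cast this
    exact (sq_eq_sq₀ hx hy).1 h'
  refine eq_zero_of_aeval_eq_zero (fun _ => hinf) fun x hx => ?_
  choose v hv using fun i => hx i (Set.mem_univ i)
  let E : Fin n → ℂ := fun i => aeval x (esymm (Fin n) ℤ (i + 1))
  have hcomp : ∀ (y : Fin n → ℂ) (q : MvPolynomial (Fin n) ℤ),
      aeval y (esymmAlgHom (Fin n) ℤ n q : MvPolynomial (Fin n) ℤ) =
        aeval (fun i : Fin n => aeval y (esymm (Fin n) ℤ (i + 1))) q := by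
    intro y q
    rw [esymmAlgHom_apply, ← AlgHom.comp_apply, comp_aeval]
  -- `q` is the restriction of `p` to the curve, as a polynomial in the parameter.
  let q : Polynomial ℂ := aeval (fun i : Fin n => Polynomial.C (E i) *
    Polynomial.X ^ (2 * ((i : ℕ) + 1))) p
  have hq : ∀ s : ℂ, q.eval s = aeval (fun i : Fin n => s ^ (2 * ((i : ℕ) + 1)) * E i) p := by
    intro s
    have h1 := DFunLike.congr_fun (comp_aeval (R := ℤ) (fun i : Fin n => Polynomial.C (E i) *
      Polynomial.X ^ (2 * ((i : ℕ) + 1))) ((Polynomial.aeval (R := ℂ) s).restrictScalars ℤ)) p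
    simp only [AlgHom.comp_apply] at h1
    refine (show q.eval s = (Polynomial.aeval (R := ℂ) s) q from ?_).trans (h1.trans ?_)
    · rw [Polynomial.coe_aeval_eq_eval]
    · congr 2
      funext i
      show Polynomial.aeval s (Polynomial.C (E i) * Polynomial.X ^ (2 * ((i : ℕ) + 1))) = _
      rw [Polynomial.coe_aeval_eq_eval, Polynomial.eval_mul, Polynomial.eval_C,
        Polynomial.eval_pow, Polynomial.eval_X, mul_comm]
  have hO : (fun s : ℝ => q.eval (s : ℂ)) =O[𝓝[≠] 0] fun s : ℝ => s ^ (2 * d) := by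
    refine IsBigO.congr' ((isBigO_torusCurve v (2 * d) ha).mono nhdsWithin_le_nhds) ?_
      EventuallyEq.rfl
    refine nhdsWithin_le_nhds ?_
    have hev : ∀ᶠ s : ℝ in 𝓝 0, ∀ j, |s * v j| ≤ 2 := by
      rw [eventually_all]
      intro j
      have hc : ContinuousAt (fun s : ℝ => |s * v j|) 0 := by fun_prop
      have := hc.eventually (eventually_le_nhds (b := 2) (by simp))
      exact this
    filter_upwards [hev] with s hs
    rw [← hp, hq]
    show evalU n (esymmAlgHom (Fin n) ℤ n p : MvPolynomial (Fin n) ℤ) _ = _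
    rw [evalU_apply, hcomp]
    congr 2
    funext i
    rw [← aeval_esymm_mul]
    congr 2
    funext j
    rw [circleU_torusCurve v j (hs j), ← hv j]
  have hdvd := X_pow_dvd_of_isBigO _ hO
  have hcoeff := Polynomial.X_pow_dvd_iff.1 hdvd (2 * wt m) (by omega)
  have hE : q.coeff (2 * wt m) = aeval E (weightedHomogeneousComponent w (wt m) p) := by
    have hmon : ∀ k : Fin n →₀ ℕ, ∀ a : ℤ, aeval (fun i : Fin n => Polynomial.C (E i) *
        Polynomial.X ^ (2 * ((i : ℕ) + 1))) (monomial k a) =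
        Polynomial.C (aeval E (monomial k a)) * Polynomial.X ^ (2 * wt k) := by
      intro k a
      rw [aeval_monomial, aeval_monomial, Finsupp.prod, Finsupp.prod, wt, Finsupp.weight_apply,
        Finsupp.sum]
      simp only [mul_pow, Finset.prod_mul_distrib, ← pow_mul, Finset.prod_pow_eq_pow_sum, map_mul,
        map_prod, map_pow, Finset.mul_sum, smul_eq_mul, mul_assoc, mul_comm, mul_left_comm]
      simp
    rw [weightedHomogeneousComponent_apply, map_sum]
    have hq' : q = ∑ k ∈ p.support, aeval (fun i : Fin n => Polynomial.C (E i) *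
        Polynomial.X ^ (2 * ((i : ℕ) + 1))) (monomial k (coeff k p)) := by
      rw [← map_sum, ← p.as_sum]
    rw [hq', Polynomial.finsetSum_coeff, Finset.sum_filter]
    refine Finset.sum_congr rfl fun k _ => ?_
    rw [hmon, Polynomial.coeff_C_mul_X_pow]
    refine if_congr ?_ rfl rfl
    show 2 * wt m = 2 * wt k ↔ wt k = wt m
    omega
  rw [hcomp]
  show aeval E _ = 0
  rw [← hE, hcoeff]

end SymplecticVerlinde
end

noncomputable section

namespace SymplecticVerlinde

open Polynomial

/-! ## The minimal relation of the Verlinde algebra -/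

/-- The polynomials `d₀ = X - 2`, `dᵢ₊₁ = dᵢ² - 2`, so that `dᵢ(q + 2 + q⁻¹) = q^(2ⁱ) + q^(-2ⁱ)`. -/
def dPol : ℕ → ℤ[X]
  | 0 => X - 2
  | i + 1 => dPol i ^ 2 - 2

/-- The product `d₀ d₁ ⋯ dᵣ₋₁`. -/
def cPol (r : ℕ) : ℤ[X] := ∏ i ∈ Finset.range r, dPol i

theorem cPol_succ (r : ℕ) : cPol (r + 1) = cPol r * dPol r := Finset.prod_range_succ _ _

theorem monic_dPol_natDegree (i : ℕ) : (dPol i).Monic ∧ (dPol i).natDegree = 2 ^ i := by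
  induction i with
  | zero => exact ⟨monic_X_sub_C 2, natDegree_X_sub_C 2⟩
  | succ i ih =>
    have h1 : (dPol i ^ 2).natDegree = 2 ^ (i + 1) := by
      rw [ih.1.natDegree_pow, ih.2, pow_succ, mul_comm]
    have h2 : (C (2 : ℤ)).degree < (dPol i ^ 2).degree := by
      rw [degree_eq_natDegree (ih.1.pow 2).ne_zero, h1]
      refine lt_of_le_of_lt degree_C_le ?_
      exact_mod_cast Nat.two_pow_pos _
    exact ⟨(ih.1.pow 2).sub_of_left h2, by
      rw [show dPol (i + 1) = dPol i ^ 2 - C 2 from rfl, natDegree_sub_C, h1]⟩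

theorem monic_cPol (r : ℕ) : (cPol r).Monic :=
  monic_prod_of_monic _ _ fun i _ => (monic_dPol_natDegree i).1

theorem natDegree_cPol (r : ℕ) : (cPol r).natDegree = 2 ^ r - 1 := by
  rw [cPol, natDegree_prod_of_monic _ _ fun i _ => (monic_dPol_natDegree i).1]
  simp only [fun i => (monic_dPol_natDegree i).2]
  exact Nat.geomSum_eq le_rfl r |>.trans (by simp)

theorem exists_dPol_eq (i : ℕ) : ∃ p, dPol i = X ^ 2 ^ i + 2 * p := by
  induction i with
  | zero => exact ⟨-1, by rw [dPol]; ring⟩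
  | succ i ih =>
    obtain ⟨p, hp⟩ := ih
    exact ⟨2 * p * X ^ 2 ^ i + 2 * p ^ 2 - 1, by rw [dPol, hp, pow_succ 2 i, pow_mul]; ring⟩

theorem eval_zero_dPol_succ (i : ℕ) : (dPol (i + 1)).eval 0 = 2 := by
  induction i with
  | zero => simp [dPol]
  | succ i ih =>
    rw [dPol, eval_sub, eval_pow, ih]
    simp

theorem exists_dPol_succ_eq (i : ℕ) : ∃ p, dPol (i + 1) = X ^ 2 ^ (i + 1) + 2 * (1 + X * p) := by
  obtain ⟨p, hp⟩ := exists_dPol_eq (i + 1)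
  have h := eval_zero_dPol_succ i
  rw [hp] at h
  have h0 : (p - 1).coeff 0 = 0 := by
    rw [coeff_zero_eq_eval_zero]
    simp at h
    simp
    omega
  obtain ⟨q, hq⟩ := X_dvd_iff.2 h0
  exact ⟨q, by rw [hp, ← hq]; ring⟩

theorem exists_cPol_eq (r : ℕ) : ∃ p, cPol r = X ^ (2 ^ r - 1) + 2 * p := by
  induction r with
  | zero => exact ⟨0, by simp [cPol]⟩
  | succ r ih =>
    obtain ⟨p, hp⟩ := ih
    obtain ⟨q, hq⟩ := exists_dPol_eq r
    have h : 2 ^ (r + 1) - 1 = (2 ^ r - 1) + 2 ^ r := by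
      have := Nat.two_pow_pos r
      rw [pow_succ]; omega
    exact ⟨p * X ^ 2 ^ r + X ^ (2 ^ r - 1) * q + 2 * p * q, by
      rw [cPol_succ, hp, hq, h, pow_add]; ring⟩

theorem eval_zero_cPol_succ (r : ℕ) : (cPol (r + 1)).eval 0 = -2 ^ (r + 1) := by
  induction r with
  | zero => simp [cPol, dPol]
  | succ r ih =>
    rw [cPol_succ, eval_mul, ih, eval_zero_dPol_succ]
    ring

/-- At `s + 2 + s⁻¹ = (1 + s)² / s` the factor `dPol i` is `s^(2^i) + s^(-2^i)`, and `(1 - s²)(1 +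
s²)(1 + s⁴)⋯` telescopes. -/
theorem eval₂_cPol (r : ℕ) {s : ℚ} (hs : s ≠ 0) :
    (1 - s ^ 2) * (s ^ (2 ^ r - 1) * (cPol r).eval₂ (Int.castRingHom ℚ) ((1 + s) ^ 2 / s)) =
      1 - s ^ 2 ^ (r + 1) := by
  have hd : ∀ i, s ^ 2 ^ i * (dPol i).eval₂ (Int.castRingHom ℚ) ((1 + s) ^ 2 / s) =
      1 + s ^ 2 ^ (i + 1) := by
    intro i
    induction i with
    | zero =>
      simp [dPol]
      field_simp
      ring
    | succ i ih =>
      rw [dPol, eval₂_sub, eval₂_pow, mul_sub, pow_succ 2 i, pow_mul, ← mul_pow, ih]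
      have : (2 : ℤ[X]).eval₂ (Int.castRingHom ℚ) ((1 + s) ^ 2 / s) = 2 := by simp
      rw [this]
      ring
  induction r with
  | zero => simp [cPol]
  | succ r ih =>
    have h : 2 ^ (r + 1) - 1 = (2 ^ r - 1) + 2 ^ r := by
      have := Nat.two_pow_pos r
      rw [pow_succ]; omega
    rw [cPol_succ, eval₂_mul, h, pow_add]
    have h2 := hd r
    calc _ = ((1 - s ^ 2) * (s ^ (2 ^ r - 1) *
          (cPol r).eval₂ (Int.castRingHom ℚ) ((1 + s) ^ 2 / s))) *
          (s ^ 2 ^ r * (dPol r).eval₂ (Int.castRingHom ℚ) ((1 + s) ^ 2 / s)) := by ring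
      _ = _ := by rw [ih, h2]; ring

/-- The coefficients of `cPol r`, starting from the leading one. -/
def eCoeff (r k : ℕ) : ℤ := (cPol r).coeff (2 ^ r - 1 - k)

theorem eCoeff_zero (r : ℕ) : eCoeff r 0 = 1 := by
  have := monic_cPol r
  rwa [Monic, leadingCoeff, natDegree_cPol] at this

/-- `lam` with these coefficients is `cPol r` homogenised at `((1 + X)², X)`, so the identity is
`eval₂_cPol` at infinitely many rational points. -/
theorem lam_eCoeff (r : ℕ) :
    (1 - X ^ 2) * lam (2 ^ r - 1) (eCoeff r) = 1 - X ^ 2 ^ (r + 1) := by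
  refine map_injective (Int.castRingHom ℚ) Int.cast_injective ?_
  refine eq_of_infinite_eval_eq _ _ (Set.Infinite.mono (s := {0}ᶜ) ?_
    (Set.finite_singleton (0 : ℚ)).infinite_compl)
  intro s hs
  show _ = _
  simp only [Polynomial.map_mul, Polynomial.map_sub, Polynomial.map_one, Polynomial.map_pow, map_X,
    map_lam, eval_mul, eval_sub, eval_one, eval_pow, eval_X]
  rw [← eval₂_cPol r hs]
  congr 1
  rw [lam, eval_finsetSum, eval₂_eq_sum_range, natDegree_cPol, Finset.mul_sum,
    ← Finset.sum_range_reflect]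
  refine Finset.sum_congr rfl fun j hj => ?_
  have hj' := Finset.mem_range_succ_iff.1 hj
  have h1 : 2 ^ r - 1 + 1 - 1 - j = 2 ^ r - 1 - j := by omega
  have h2 : 2 ^ r - 1 - (2 ^ r - 1 - j) = j := by omega
  have hs' : s ≠ 0 := hs
  simp only [h1, h2, eval_mul, eval_C, eval_pow, eval_X, eval_add, eval_one, eCoeff]
  rw [div_pow]
  have h3 : s ^ (2 ^ r - 1) = s ^ (2 ^ r - 1 - j) * s ^ j := by
    rw [← pow_add]; congr 1; omega
  rw [h3]
  simp only [Int.coe_castRingHom]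
  field_simp

/-! ## Recursions and generating functions -/

section

variable {B : Type} [CommRing B]

theorem coeff_lam_of_lt {n k : ℕ} {c : ℕ → B} (hk : k ≤ n) (h : ∀ j < k, c j = 0) :
    (lam n c).coeff k = c k := by
  rw [lam, finsetSum_coeff, Finset.sum_eq_single_of_mem k (Finset.mem_range_succ_iff.2 hk)]
  · rw [mul_assoc, coeff_C_mul, coeff_X_pow_mul', if_pos le_rfl, Nat.sub_self,
      coeff_zero_eq_eval_zero]
    simp
  · intro j _ hjk
    rcases lt_or_gt_of_ne hjk with h1 | h1
    · rw [h j h1]; simp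
    · rw [mul_assoc, coeff_C_mul, coeff_X_pow_mul', if_neg (by omega), mul_zero]

/-- The passage from `c` to the first `n + 1` coefficients of `lam n c` is unitriangular. -/
theorem eq_zero_of_X_pow_dvd_lam {n : ℕ} {c : ℕ → B} (h : X ^ (n + 1) ∣ lam n c) :
    ∀ k ≤ n, c k = 0 := by
  intro k
  induction k using Nat.strong_induction_on with
  | _ k ih =>
    intro hk
    rw [← coeff_lam_of_lt hk fun j hj => ih j hj (by omega)]
    exact X_pow_dvd_iff.1 h k (by omega)

/-- The coefficients of `lam n c * ((1 + X)² - v X)`. -/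
def shiftCoeff (n : ℕ) (v : B) (c : ℕ → B) (k : ℕ) : B :=
  (if k ≤ n then c k else 0) - if k = 0 then 0 else v * c (k - 1)

/-- Through this identity the recursion for the `aₖ`, which is multiplication of their generating
function by `1 - (v - 2)X + X² = (1 + X)² - vX`, becomes a recursion for the `γₖ`. The cutoff in
`shiftCoeff` sets `γₙ₊₁ = 0`. -/
theorem lam_mul (n : ℕ) (v : B) (c : ℕ → B) :
    lam n c * ((1 + X) ^ 2 - C v * X) = lam (n + 1) (shiftCoeff n v c) := by
  simp only [lam, shiftCoeff, C_sub, sub_mul, Finset.sum_sub_distrib, mul_sub]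
  congr 1
  · rw [Finset.sum_range_succ _ (n + 1), if_neg (by omega), C_0, zero_mul, zero_mul, add_zero,
      Finset.sum_mul]
    refine Finset.sum_congr rfl fun k hk => ?_
    have hk' := Finset.mem_range_succ_iff.1 hk
    rw [if_pos hk', Nat.succ_sub hk', pow_succ ((1 + X) ^ 2 : B[X]), mul_assoc]
  · rw [Finset.sum_range_succ' _ (n + 1), if_pos rfl, C_0, zero_mul, zero_mul, add_zero,
      Finset.sum_mul]
    refine Finset.sum_congr rfl fun k hk => ?_
    rw [if_neg k.succ_ne_zero, Nat.add_sub_cancel, Nat.add_sub_add_right, C_mul, pow_succ]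
    ring

theorem lam_sub (n : ℕ) (c c' : ℕ → B) : lam n (fun k => c k - c' k) = lam n c - lam n c' := by
  simp [lam, sub_mul, Finset.sum_sub_distrib]

theorem coeff_mul_quadratic (p : B[X]) (y : B) (k : ℕ) :
    (p * (1 - C y * X + X ^ 2)).coeff (k + 2) =
      p.coeff (k + 2) - y * p.coeff (k + 1) + p.coeff k := by
  have h : p * (1 - C y * X + X ^ 2) = p - C y * (p * X) + p * X ^ 2 := by ring
  rw [h, coeff_add, coeff_sub, coeff_C_mul, coeff_mul_X_pow, coeff_mul_X]

/-- `aₖ = y aₖ₋₁ - aₖ₋₂` for `2 ≤ k ≤ n + 1`, if the `cₖ` satisfy the recursion of the `γₖ`. -/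
theorem fund_rec_of_gam_rec {r n : ℕ} (hn : n + 1 = 2 ^ r - 1) {v : B} {c : ℕ → B}
    (hc : ∀ k ≤ n + 1, shiftCoeff n v c k = eCoeff r k) (k : ℕ) (hk : k + 2 ≤ n + 1) :
    ((1 - X ^ 2) * lam n c).coeff (k + 2) - (v - 2) * ((1 - X ^ 2) * lam n c).coeff (k + 1) +
      ((1 - X ^ 2) * lam n c).coeff k = 0 := by
  have h1 : lam (n + 1) (shiftCoeff n v c) = (lam (n + 1) (eCoeff r)).map (Int.castRingHom B) := by
    rw [map_lam]
    exact Finset.sum_congr rfl fun j hj => by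
      rw [hc j (Finset.mem_range_succ_iff.1 hj)]; rfl
  have h2 : (1 - X ^ 2) * lam n c * (1 - C (v - 2) * X + X ^ 2) = 1 - X ^ 2 ^ (r + 1) := by
    have h3 : (1 - C (v - 2) * X + X ^ 2 : B[X]) = (1 + X) ^ 2 - C v * X := by
      rw [C_sub, show C (2 : B) = 2 from rfl]; ring
    rw [h3, mul_assoc, lam_mul, h1]
    have h4 := congrArg (Polynomial.map (Int.castRingHom B)) (lam_eCoeff r)
    rw [← hn] at h4
    simpa using h4
  rw [← coeff_mul_quadratic, h2, coeff_sub, coeff_one, coeff_X_pow, if_neg (by omega), if_neg,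
    sub_zero]
  rw [pow_succ]
  omega

/-- The recursion controls the generating function only modulo `X^(n+2)`. That suffices: `1 - X²` is
coprime to `X`, and the coefficients of `lam (n + 1)` are determined modulo `X^(n+2)`. -/
theorem gam_rec_of_fund_rec {r n : ℕ} (hn : n + 1 = 2 ^ r - 1) (hn1 : 1 ≤ n) {v : B} {c : ℕ → B}
    (h0 : c 0 = 1) (hv : v - 2 = 2 * n + c 1)
    (h : ∀ k, k + 2 ≤ n + 1 → ((1 - X ^ 2) * lam n c).coeff (k + 2) -
      (v - 2) * ((1 - X ^ 2) * lam n c).coeff (k + 1) + ((1 - X ^ 2) * lam n c).coeff k = 0) :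
    ∀ k ≤ n + 1, shiftCoeff n v c k = eCoeff r k := by
  have h1 : X ^ (n + 2) ∣ (1 - X ^ 2) * lam (n + 1) (shiftCoeff n v c) - 1 := by
    have h3 : (1 + X) ^ 2 - C v * X = (1 - C (v - 2) * X + X ^ 2 : B[X]) := by
      rw [C_sub, show C (2 : B) = 2 from rfl]; ring
    rw [← lam_mul, h3, ← mul_assoc, X_pow_dvd_iff]
    intro k hk
    rw [coeff_sub, coeff_one]
    rcases k with _ | _ | k
    · rw [coeff_zero_eq_eval_zero]
      have : (lam n c).eval 0 = 1 := by
        rw [← coeff_zero_eq_eval_zero, coeff_lam_of_lt (by omega) (by omega), h0]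
      simp [this]
    · have h4 : (1 - X ^ 2) * lam n c * (1 - C (v - 2) * X + X ^ 2) = lam n c - lam n c * X ^ 2 -
          C (v - 2) * ((lam n c - lam n c * X ^ 2) * X) +
            (lam n c - lam n c * X ^ 2) * X ^ 2 := by ring
      have h5 : (lam n c).coeff 0 = 1 := by rw [coeff_lam_of_lt (by omega) (by omega), h0]
      rw [h4, coeff_add, coeff_sub, coeff_sub, coeff_C_mul, coeff_mul_X, coeff_sub,
        coeff_mul_X_pow', coeff_mul_X_pow', coeff_mul_X_pow', if_neg (by omega), if_neg (by omega),
        if_neg (by omega), coeff_one_lam hn1, h5, h0, hv]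
      simp
    · rw [coeff_mul_quadratic, h k (by omega), if_neg (by omega), sub_zero]
  have h2 : X ^ (n + 2) ∣ (1 - X ^ 2) * lam (n + 1)
      (fun k => shiftCoeff n v c k - (eCoeff r k : B)) := by
    rw [lam_sub, mul_sub]
    have h4 := congrArg (Polynomial.map (Int.castRingHom B)) (lam_eCoeff r)
    rw [← hn, Polynomial.map_mul, map_lam] at h4
    simp only [Polynomial.map_sub, Polynomial.map_one, Polynomial.map_pow, map_X,
      Int.coe_castRingHom] at h4
    rw [h4]
    have h5 : (X : B[X]) ^ (n + 2) ∣ X ^ 2 ^ (r + 1) := pow_dvd_pow _ (by rw [pow_succ]; omega)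
    have h6 := dvd_add h1 h5
    rwa [sub_add] at h6
  have h3 : X ^ (n + 2) ∣ lam (n + 1) (fun k => shiftCoeff n v c k - (eCoeff r k : B)) := by
    have hu : IsCoprime (X ^ (n + 2) : B[X]) (1 - X ^ 2) := by
      refine IsCoprime.pow_left ⟨X, 1, by ring⟩
    exact hu.dvd_of_dvd_mul_left h2
  intro k hk
  exact sub_eq_zero.1 (eq_zero_of_X_pow_dvd_lam h3 k hk)

end

end SymplecticVerlinde
end

noncomputable section

namespace SymplecticVerlinde

open Polynomial

/-! ## Virtual characters as polynomials -/

/-- The polynomial in `γ₁, …, γₙ` which has the same restriction to the maximal torus as a given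
virtual character. -/
def toPoly (n : ℕ) : repRing (Sp n) →+* MvPolynomial (Fin n) ℤ where
  toFun a := (exists_evalE_eq a).choose
  map_one' := evalE_injective n (by rw [(exists_evalE_eq (1 : repRing (Sp n))).choose_spec]; simp)
  map_zero' := evalE_injective n (by rw [(exists_evalE_eq (0 : repRing (Sp n))).choose_spec]; simp)
  map_mul' a b := evalE_injective n (by
    rw [map_mul (evalE n), (exists_evalE_eq a).choose_spec, (exists_evalE_eq b).choose_spec]
    exact (exists_evalE_eq (a * b)).choose_spec.trans (by rw [map_mul]; rfl))
  map_add' a b := evalE_injective n (by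
    rw [map_add (evalE n), (exists_evalE_eq a).choose_spec, (exists_evalE_eq b).choose_spec]
    exact (exists_evalE_eq (a + b)).choose_spec.trans (by rw [map_add]; rfl))

theorem evalE_toPoly {n : ℕ} (a : repRing (Sp n)) :
    evalE n (toPoly n a) = (restrict (torusIncl n) a : (Fin n → Circle) → ℂ) :=
  (exists_evalE_eq a).choose_spec

theorem toPoly_eq {n : ℕ} {a : repRing (Sp n)} {p : MvPolynomial (Fin n) ℤ}
    (h : (restrict (torusIncl n) a : (Fin n → Circle) → ℂ) = evalE n p) : toPoly n a = p :=
  evalE_injective n ((evalE_toPoly a).trans h)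

theorem toPoly_gam {n k : ℕ} (h1 : 1 ≤ k) (hk : k ≤ n) : toPoly n (gam n k) = gVar n k :=
  toPoly_eq (restrict_gam h1 hk)

theorem toPoly_ext (n k : ℕ) : toPoly n (ext n k) = (lam n (gVar₀ n)).coeff k :=
  toPoly_eq (restrict_ext n k)

theorem toPoly_aevalGam (n : ℕ) (p : MvPolynomial (Fin n) ℤ) : toPoly n (aevalGam n p) = p :=
  toPoly_eq (restrict_aevalGam n p)

/-- Membership depends only on the restriction to the torus, so `a` may be exchanged for the
polynomial in the `γᵢ` with the same restriction. -/
theorem mem_piece_iff {n d : ℕ} {a : repRing (Sp n)} :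
    a ∈ (ahFiltration n).piece d ↔ toPoly n a ∈ weightIdeal n d := by
  refine ⟨fun h => mem_weightIdeal_of_restrict h (evalE_toPoly a), fun h => ?_⟩
  have h1 := aevalGam_mem h
  have h2 : restrict (torusIncl n) (aevalGam n (toPoly n a)) = restrict (torusIncl n) a :=
    Subtype.ext ((restrict_aevalGam n _).trans (evalE_toPoly a))
  show restrict (torusIncl n) a ∈ augmentationIdeal (Fin n → Circle) ^ (2 * d)
  rw [← h2]
  exact h1

/-- The coefficient of a polynomial with integral index. -/
def intCoeff {B : Type} [CommRing B] (p : B[X]) (k : ℤ) : B := if 0 ≤ k then p.coeff k.toNat else 0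

theorem intCoeff_of_neg {B : Type} [CommRing B] (p : B[X]) {k : ℤ} (hk : k < 0) :
    intCoeff p k = 0 := if_neg (by omega)

theorem intCoeff_natCast {B : Type} [CommRing B] (p : B[X]) (k : ℕ) :
    intCoeff p k = p.coeff k := by
  rw [intCoeff, if_pos (by omega), Int.toNat_natCast]

section

variable {B : Type} [CommRing B] {n : ℕ} (φ : MvPolynomial (Fin n) ℤ →+* B)

theorem map_toPoly_extZ (k : ℤ) :
    φ (toPoly n (extZ n k)) = intCoeff (lam n fun j => φ (gVar₀ n j)) k := by
  rw [extZ, intCoeff]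
  split_ifs with h
  · rw [toPoly_ext, ← coeff_map, map_lam]
  · rw [map_zero, map_zero]

theorem map_toPoly_fund (k : ℤ) :
    φ (toPoly n (fund n k)) = intCoeff ((1 - X ^ 2) * lam n fun j => φ (gVar₀ n j)) k := by
  rw [fund, map_sub, map_sub, map_toPoly_extZ, map_toPoly_extZ]
  rcases lt_or_ge k 0 with h | h
  · rw [intCoeff_of_neg _ h, intCoeff_of_neg _ h, intCoeff_of_neg _ (by omega), sub_zero]
  · obtain ⟨k, rfl⟩ := Int.eq_ofNat_of_zero_le h
    rw [intCoeff_natCast, intCoeff_natCast, sub_mul, one_mul, coeff_sub,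
      coeff_X_pow_mul']
    split_ifs with h2
    · obtain ⟨k, rfl⟩ := Nat.exists_eq_add_of_le' h2
      rw [Nat.add_sub_cancel, show ((k + 2 : ℕ) : ℤ) - 2 = k by push_cast; ring, intCoeff_natCast]
    · rw [intCoeff_of_neg _ (by omega)]

theorem map_toPoly_irrepClass (μ : Fin 2 → ℕ) (a : ℤ → B)
    (ha : ∀ k, φ (toPoly n (fund n k)) = a k) :
    φ (toPoly n (irrepClass n 2 μ)) =
      a (μ 0) * (a (μ 1) + a (μ 1 - 2)) - (a (μ 0 + 1) + a (μ 0 - 1)) * a (μ 1 - 1) := by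
  have h : irrepClass n 2 μ = fund n (μ 0) * (fund n (μ 1) + fund n (μ 1 - 2)) -
      (fund n (μ 0 + 1) + fund n (μ 0 - 1)) * fund n (μ 1 - 1) := by
    rw [irrepClass, Matrix.det_fin_two]
    simp only [Matrix.of_apply, bent, Fin.val_zero, Fin.val_one, if_true, Nat.cast_zero, sub_zero,
      if_neg one_ne_zero, Nat.cast_one, sub_add_cancel]
    rw [sub_sub, one_add_one_eq_two]
  rw [h]
  simp only [map_sub, map_mul, map_add, ha]

theorem intCoeff_rec {r : ℕ} (hn : n + 1 = 2 ^ r - 1) (hn1 : 1 ≤ n) {v : B} {c : ℕ → B}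
    (h0 : c 0 = 1) (hv : v - 2 = 2 * n + c 1)
    (hc : ∀ k ≤ n + 1, shiftCoeff n v c k = eCoeff r k) {k : ℤ} (hk : 0 ≤ k) (hkn : k ≤ n) :
    intCoeff ((1 - X ^ 2) * lam n c) (k + 1) + intCoeff ((1 - X ^ 2) * lam n c) (k - 1) =
      (v - 2) * intCoeff ((1 - X ^ 2) * lam n c) k := by
  obtain ⟨k, rfl⟩ := Int.eq_ofNat_of_zero_le hk
  rcases k with _ | k
  · rw [intCoeff_of_neg _ (k := ((0 : ℕ) : ℤ) - 1) (by simp), add_zero]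
    show intCoeff _ ((1 : ℕ) : ℤ) = _ * intCoeff _ ((0 : ℕ) : ℤ)
    have h5 : (lam n c).coeff 0 = 1 := by rw [coeff_lam_of_lt (by omega) (by omega), h0]
    rw [intCoeff_natCast, intCoeff_natCast, sub_mul, one_mul, coeff_sub, coeff_sub,
      coeff_X_pow_mul', coeff_X_pow_mul', if_neg (by omega), if_neg (by omega), coeff_one_lam hn1,
      h5, h0, hv]
    ring
  · have h := fund_rec_of_gam_rec hn hc k (by simp at hkn; omega)
    have h1 : (((k + 1 : ℕ) : ℤ) + 1) = ((k + 2 : ℕ) : ℤ) := by simp; ring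
    have h2 : (((k + 1 : ℕ) : ℤ) - 1) = ((k : ℕ) : ℤ) := by simp
    rw [h1, h2, intCoeff_natCast, intCoeff_natCast, intCoeff_natCast]
    linear_combination h

end

/-! ## The Verlinde algebra as a quotient of a polynomial ring in one variable -/

/-- The ring `ℤ[X] / (cPol r)`. -/
abbrev Model (r : ℕ) : Type := ℤ[X] ⧸ Ideal.span {cPol r}

/-- The class of the variable. -/
def Model.v (r : ℕ) : Model r := Ideal.Quotient.mk _ X

/-- The polynomial which represents `γₖ`. -/
def gPol (r k : ℕ) : ℤ[X] := ∑ j ∈ Finset.range (k + 1), C (eCoeff r j) * X ^ (k - j)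

theorem gPol_zero (r : ℕ) : gPol r 0 = 1 := by simp [gPol, eCoeff_zero]

theorem gPol_succ (r k : ℕ) : gPol r (k + 1) = X * gPol r k + C (eCoeff r (k + 1)) := by
  rw [gPol, Finset.sum_range_succ, Nat.sub_self, pow_zero, mul_one, gPol, Finset.mul_sum]
  congr 1
  refine Finset.sum_congr rfl fun j hj => ?_
  rw [Nat.succ_sub (Finset.mem_range_succ_iff.1 hj), pow_succ]
  ring

theorem gPol_last (r : ℕ) : gPol r (2 ^ r - 1) = cPol r := by
  conv_rhs => rw [(cPol r).as_sum_range_C_mul_X_pow, natDegree_cPol, ← Finset.sum_range_reflect]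
  exact Finset.sum_congr rfl fun j hj => by
    rw [show 2 ^ r - 1 + 1 - 1 - j = 2 ^ r - 1 - j by omega, eCoeff]

/-- The image of `γₖ` in `ℤ[X] / (cPol r)`. -/
def Model.g (r k : ℕ) : Model r := Ideal.Quotient.mk _ (gPol r k)

theorem Model.g_zero (r : ℕ) : Model.g r 0 = 1 := by rw [Model.g, gPol_zero, map_one]

theorem Model.g_succ (r k : ℕ) :
    Model.g r (k + 1) = Model.v r * Model.g r k + (eCoeff r (k + 1) : Model r) := by
  rw [Model.g, gPol_succ, map_add, map_mul, eq_intCast C, map_intCast]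
  rfl

theorem Model.g_last (r : ℕ) : Model.g r (2 ^ r - 1) = 0 := by
  rw [Model.g, gPol_last, Ideal.Quotient.eq_zero_iff_mem]
  exact Ideal.mem_span_singleton_self _

/-- The homomorphism from `ℤ[γ₁, …, γₙ]` to `ℤ[X] / (cPol r)`. -/
def toModel (n r : ℕ) : MvPolynomial (Fin n) ℤ →+* Model r :=
  MvPolynomial.eval₂Hom (Int.castRingHom _) fun i => Model.g r (i + 1)

theorem toModel_gVar {n k : ℕ} (r : ℕ) (h1 : 1 ≤ k) (hk : k ≤ n) :
    toModel n r (gVar n k) = Model.g r k := by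
  rw [gVar, dif_pos (by omega), toModel, MvPolynomial.eval₂Hom_X']
  congr 1
  show k - 1 + 1 = k
  omega

theorem toModel_gVar₀ {n k : ℕ} (r : ℕ) (hk : k ≤ n) :
    toModel n r (gVar₀ n k) = Model.g r k := by
  rw [gVar₀]
  split_ifs with h
  · rw [h, map_one, Model.g_zero]
  · exact toModel_gVar r (by omega) hk

section

variable {n r : ℕ}

/-- Fixes the normalisation `v = x + 2`: since `γ₁ = v + e₁` in the model, `v - 2 = γ₁ + 2n = x`. -/
theorem eCoeff_one (hn : n + 1 = 2 ^ r - 1) (hn1 : 1 ≤ n) : eCoeff r 1 = -(2 * n + 2) := by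
  have h := congrArg (fun p => p.coeff 1) (lam_eCoeff r)
  rw [sub_mul, one_mul, coeff_sub, coeff_sub, coeff_one_lam (by omega), coeff_X_pow_mul',
    if_neg (by omega), eCoeff_zero, coeff_one, if_neg (by omega), coeff_X_pow, if_neg] at h
  · rw [← hn] at h
    push_cast at h
    linarith
  · rw [pow_succ]
    omega

theorem shiftCoeff_g (hn : n + 1 = 2 ^ r - 1) {c : ℕ → Model r} (hc : ∀ k ≤ n, c k = Model.g r k) :
    ∀ k ≤ n + 1, shiftCoeff n (Model.v r) c k = eCoeff r k := by
  intro k hk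
  rw [shiftCoeff]
  rcases k with _ | k
  · rw [if_pos (by omega), if_pos rfl, hc 0 (by omega), Model.g_zero, eCoeff_zero]
    simp
  · rw [if_neg k.succ_ne_zero, Nat.add_sub_cancel, hc k (by omega)]
    have h := Model.g_succ r k
    rcases Nat.lt_or_ge k n with h1 | h1
    · rw [if_pos (show k + 1 ≤ n from h1), hc _ h1, h, add_sub_cancel_left]
    · have : k = n := by omega
      rw [if_neg (by omega)]
      rw [this, hn, Model.g_last] at h
      rw [this, hn]
      linear_combination h

/-- In the model the recursion `aₖ₊₁ + aₖ₋₁ = (v - 2) aₖ` makes the second column of every level `2`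
determinant equal to `v - 2` times the first. -/
theorem toModel_levelIdeal (hn : n + 1 = 2 ^ r - 1) (hn1 : 1 ≤ n) {a : repRing (Sp n)} (ha : a ∈ levelIdeal n 2) :
    toModel n r (toPoly n a) = 0 := by
  have h : levelIdeal n 2 ≤ RingHom.ker ((toModel n r).comp (toPoly n)) := by
    refine Ideal.span_le.2 ?_
    rintro _ ⟨μ, -, hμ, rfl⟩
    show (toModel n r) (toPoly n _) = 0
    rw [map_toPoly_irrepClass _ _ _ (map_toPoly_fund (toModel n r))]
    have hc : ∀ k ≤ n, (toModel n r) (gVar₀ n k) = Model.g r k :=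
      fun k hk => toModel_gVar₀ r hk
    have hv : Model.v r - 2 = 2 * n + (toModel n r) (gVar₀ n 1) := by
      have h1 := Model.g_succ r 0
      rw [hc 1 hn1, h1, Model.g_zero, eCoeff_one hn hn1]
      push_cast
      ring
    have hrec := fun k => intCoeff_rec hn hn1 (hc 0 (by omega) |>.trans (Model.g_zero r)) hv
      (shiftCoeff_g hn hc) (k := k)
    have h0 := hrec (μ 0) (by omega) (by exact_mod_cast (hμ 0).2)
    have h1 := hrec (μ 1 - 1) (by have := (hμ 1).1; omega) (by have := (hμ 1).2; omega)
    rw [sub_add_cancel, sub_sub, one_add_one_eq_two] at h1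
    rw [h0, h1]
    ring
  exact h ha

/-- The diagrams with second column of length `1` already impose the recursion on the quotient.
There `γₖ` is then `gPol r k` at `v` and `cPol r` vanishes at `v`, so the quotient map factors
through the model. -/
theorem mem_map_of_toModel_eq_zero (hn : n + 1 = 2 ^ r - 1) (hn1 : 1 ≤ n) {p : MvPolynomial (Fin n) ℤ}
    (hp : toModel n r p = 0) : p ∈ (levelIdeal n 2).map (toPoly n) := by
  let J := (levelIdeal n 2).map (toPoly n)
  let φ := Ideal.Quotient.mk J
  let c : ℕ → MvPolynomial (Fin n) ℤ ⧸ J := fun j => φ (gVar₀ n j)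
  let v : MvPolynomial (Fin n) ℤ ⧸ J := 2 * n + c 1 + 2
  let a : ℤ → MvPolynomial (Fin n) ℤ ⧸ J := intCoeff ((1 - X ^ 2) * lam n c)
  have h0 : c 0 = 1 := by show φ (gVar₀ n 0) = 1; simp [gVar₀]
  have hl0 : (lam n c).coeff 0 = 1 := by rw [coeff_lam_of_lt (by omega) (by omega), h0]
  have ha0 : a 0 = 1 := by
    show intCoeff _ ((0 : ℕ) : ℤ) = 1
    rw [intCoeff_natCast, sub_mul, one_mul, coeff_sub, coeff_X_pow_mul', if_neg (by omega), hl0,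
      sub_zero]
  have ha1 : a 1 = v - 2 := by
    show intCoeff _ ((1 : ℕ) : ℤ) = _
    rw [intCoeff_natCast, sub_mul, one_mul, coeff_sub, coeff_X_pow_mul', if_neg (by omega),
      coeff_one_lam hn1, h0]
    ring
  have hrec : ∀ k ≤ n + 1, shiftCoeff n v c k = eCoeff r k := by
    refine gam_rec_of_fund_rec hn hn1 h0 (by ring) fun k hk => ?_
    have h1 : φ (toPoly n (irrepClass n 2 ![k + 1, 1])) = 0 := by
      refine Ideal.Quotient.eq_zero_iff_mem.2 (Ideal.mem_map_of_mem _ (Ideal.subset_span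
        ⟨![k + 1, 1], ?_, ?_, rfl⟩))
      · intro i j hij
        fin_cases i <;> fin_cases j <;> simp_all
      · intro i
        fin_cases i
        · exact ⟨by simp, by simp; omega⟩
        · exact ⟨by simp, by simpa using hn1⟩
    rw [map_toPoly_irrepClass φ _ a (map_toPoly_fund φ)] at h1
    have e1 : ((![k + 1, 1] 0 : ℕ) : ℤ) + 1 = ((k + 2 : ℕ) : ℤ) := by simp; ring
    have e2 : ((![k + 1, 1] 0 : ℕ) : ℤ) - 1 = ((k : ℕ) : ℤ) := by simp
    have e3 : ((![k + 1, 1] 0 : ℕ) : ℤ) = ((k + 1 : ℕ) : ℤ) := by simp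
    have e4 : ((![k + 1, 1] 1 : ℕ) : ℤ) = 1 := by simp
    rw [e1, e2, e3, e4, sub_self, ha0, ha1] at h1
    have e5 : a (1 - 2) = 0 := intCoeff_of_neg _ (by norm_num)
    rw [e5] at h1
    have e6 : ∀ j : ℕ, a j = ((1 - X ^ 2) * lam n c).coeff j := intCoeff_natCast _
    rw [e6, e6, e6] at h1
    linear_combination -h1
  have hg : ∀ k ≤ n, aeval v (gPol r k) = c k := by
    intro k
    induction k with
    | zero => intro _; rw [gPol_zero, map_one, h0]
    | succ k ih =>
      intro hk
      have h1 := hrec (k + 1) (by omega)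
      rw [shiftCoeff, if_pos hk, if_neg k.succ_ne_zero, Nat.add_sub_cancel] at h1
      rw [gPol_succ, map_add, map_mul, aeval_X, ih (by omega), eq_intCast C,
        map_intCast, ← h1]
      ring
  have hf : aeval v (cPol r) = 0 := by
    have h1 := hrec (n + 1) le_rfl
    rw [shiftCoeff, if_neg (by omega), if_neg n.succ_ne_zero, Nat.add_sub_cancel] at h1
    rw [← gPol_last, ← hn, gPol_succ, map_add, map_mul, aeval_X, hg n le_rfl, eq_intCast C,
      map_intCast, ← h1]
    ring
  let ψ : Model r →+* MvPolynomial (Fin n) ℤ ⧸ J :=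
    Ideal.Quotient.lift _ (aeval v).toRingHom (fun q hq => by
      obtain ⟨q', rfl⟩ := Ideal.mem_span_singleton.1 hq
      show aeval v _ = 0
      rw [map_mul, hf, zero_mul])
  have hcomp : ψ.comp (toModel n r) = φ := by
    refine MvPolynomial.ringHom_ext (fun z => by simp) fun i => ?_
    show ψ (toModel n r (MvPolynomial.X i)) = φ (MvPolynomial.X i)
    rw [toModel, MvPolynomial.eval₂Hom_X']
    refine (hg (i + 1) i.2).trans ?_
    show φ (gVar₀ n (i + 1)) = _
    rw [gVar₀, if_neg (by omega), gVar, dif_pos (by simp)]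
    rfl
  refine Ideal.Quotient.eq_zero_iff_mem.1 (?_ : φ p = 0)
  rw [← hcomp]
  show ψ (toModel n r p) = 0
  rw [hp, map_zero]

theorem toModel_surjective (hn1 : 1 ≤ n) : Function.Surjective (toModel n r) := by
  have hv : Model.v r ∈ (toModel n r).range := by
    have h1 := Model.g_succ r 0
    rw [Model.g_zero, mul_one] at h1
    rw [← sub_eq_iff_eq_add.2 h1]
    exact sub_mem ⟨gVar n 1, toModel_gVar r le_rfl hn1⟩ (intCast_mem _ _)
  intro x
  obtain ⟨p, rfl⟩ := Ideal.Quotient.mk_surjective x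
  suffices h : Ideal.Quotient.mk _ p ∈ (toModel n r).range from h
  rw [p.as_sum_range_C_mul_X_pow, map_sum]
  refine sum_mem fun i _ => ?_
  rw [map_mul, map_pow]
  refine mul_mem ?_ (pow_mem hv _)
  rw [eq_intCast C, map_intCast]
  exact intCast_mem _ _

end

/-- The homomorphism from the Verlinde algebra to `ℤ[X] / (cPol r)`. -/
def verlindeToModel {n r : ℕ} (hn : n + 1 = 2 ^ r - 1) (hn1 : 1 ≤ n) :
    VerlindeAlgebra n 1 →+* Model r :=
  Ideal.Quotient.lift _ ((toModel n r).comp (toPoly n))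
    fun _ ha => toModel_levelIdeal hn hn1 ha

section

variable {n r : ℕ} (hn : n + 1 = 2 ^ r - 1) (hn1 : 1 ≤ n)

theorem verlindeToModel_mk (a : repRing (Sp n)) :
    verlindeToModel hn hn1 (Ideal.Quotient.mk _ a) = toModel n r (toPoly n a) := rfl

theorem verlindeToModel_gamV {k : ℕ} (h1 : 1 ≤ k) (hk : k ≤ n) :
    verlindeToModel hn hn1 (gamV n 1 k) = Model.g r k := by
  rw [gamV, verlindeToModel_mk, toPoly_gam h1 hk, toModel_gVar r h1 hk]

theorem mem_verlindeFiltration_iff {k : ℕ} {x : VerlindeAlgebra n 1} :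
    x ∈ (verlindeFiltration n 1).piece k ↔
      verlindeToModel hn hn1 x ∈ (weightIdeal n k).map (toModel n r) := by
  have hpoly : Function.Surjective (toPoly n) := fun p => ⟨_, toPoly_aevalGam n p⟩
  show x ∈ ((ahFiltration n).piece k).map (Ideal.Quotient.mk _) ↔ _
  rw [Ideal.mem_map_iff_of_surjective _ Ideal.Quotient.mk_surjective,
    Ideal.mem_map_iff_of_surjective _ (toModel_surjective hn1)]
  constructor
  · rintro ⟨a, ha, rfl⟩
    exact ⟨toPoly n a, mem_piece_iff.1 ha, rfl⟩
  · rintro ⟨s, hs, hx⟩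
    obtain ⟨a, rfl⟩ := Ideal.Quotient.mk_surjective x
    rw [verlindeToModel_mk, eq_comm, ← sub_eq_zero, ← map_sub] at hx
    have h := mem_map_of_toModel_eq_zero hn hn1 hx
    obtain ⟨j, hj, hjs⟩ := (Ideal.mem_map_iff_of_surjective _ hpoly).1 h
    -- Subtracting `j` leaves the class in the Verlinde algebra unchanged and turns the polynomial
    -- of `a` into `s`, which has the required weight.
    refine ⟨a - j, mem_piece_iff.2 ?_, ?_⟩
    · rw [map_sub, hjs, sub_sub_cancel]
      exact hs
    · rw [map_sub, sub_eq_self]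
      exact Ideal.Quotient.eq_zero_iff_mem.2 hj

end

end SymplecticVerlinde
end

noncomputable section

namespace SymplecticVerlinde

open Polynomial

/-! ## The filtration by powers of `2` and of a second element -/

/-- The filtration of a ring in which `2` has weight `N` and `v` has weight `1`. -/
def twoFiltration {B : Type} [CommRing B] (N : ℕ) (v : B) : RingFiltration B where
  piece k := Ideal.span {x | ∃ a b, k ≤ N * a + b ∧ x = 2 ^ a * v ^ b}
  piece_zero := (Ideal.eq_top_iff_one _).2 (Ideal.subset_span ⟨0, 0, Nat.zero_le _, by simp⟩)
  antitone i j h := Ideal.span_mono fun _ ⟨a, b, hab, hx⟩ => ⟨a, b, h.trans hab, hx⟩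
  mul_le i j := by
    rw [Ideal.span_mul_span']
    refine Ideal.span_mono ?_
    rintro _ ⟨_, ⟨a, b, h, rfl⟩, _, ⟨a', b', h', rfl⟩, rfl⟩
    exact ⟨a + a', b + b', by rw [mul_add]; omega, by ring⟩

section

variable {B : Type} [CommRing B] {N : ℕ} {v : B}

theorem mem_twoFiltration {k a b : ℕ} (h : k ≤ N * a + b) (c : B) :
    2 ^ a * v ^ b * c ∈ (twoFiltration N v).piece k :=
  Ideal.mul_mem_right _ _ (Ideal.subset_span ⟨a, b, h, rfl⟩)

theorem map_twoFiltration_le {B' : Type} [CommRing B'] (φ : B →+* B') {v' : B'} (hv : φ v = v')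
    {k : ℕ} {x : B} (hx : x ∈ (twoFiltration N v).piece k) :
    φ x ∈ (twoFiltration N v').piece k := by
  have h : (twoFiltration N v).piece k ≤ ((twoFiltration N v').piece k).comap φ := by
    refine Ideal.span_le.2 ?_
    rintro _ ⟨a, b, hab, rfl⟩
    refine Ideal.subset_span ⟨a, b, hab, ?_⟩
    rw [map_mul, map_pow, map_pow, map_ofNat, hv]
  exact h hx

theorem RingFiltration.mul_congr (F : RingFiltration B) {i j : ℕ} {x x' y y' : B}
    (hx' : x' ∈ F.piece i) (hy : y ∈ F.piece j) (h : x - x' ∈ F.piece (i + 1))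
    (h' : y - y' ∈ F.piece (j + 1)) : x * y - x' * y' ∈ F.piece (i + j + 1) := by
  have h1 : x * y - x' * y' = (x - x') * y + x' * (y - y') := by ring
  rw [h1]
  have h2 := F.mul_mem h hy
  have h3 := F.mul_mem hx' h'
  rw [add_right_comm] at h2
  exact add_mem h2 h3

theorem RingFiltration.mem_of_congr (F : RingFiltration B) {i : ℕ} {x x' : B}
    (hx' : x' ∈ F.piece i) (h : x - x' ∈ F.piece (i + 1)) : x ∈ F.piece i := by
  have := add_mem (F.antitone (Nat.le_succ i) h) hx'
  rwa [sub_add_cancel] at this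

theorem RingFiltration.pow_congr (F : RingFiltration B) {i : ℕ} {x x' : B}
    (hx' : x' ∈ F.piece i) (h : x - x' ∈ F.piece (i + 1)) (a : ℕ) :
    x ^ a - x' ^ a ∈ F.piece (a * i + 1) := by
  induction a with
  | zero => simp
  | succ a ih =>
    rw [pow_succ, pow_succ, Nat.succ_mul]
    exact F.mul_congr (F.pow_mem hx' a) (F.mem_of_congr hx' h) ih h

/-- The greatest common divisor of `2 (1 + 2c)` and `2^(m+1)` is `2`. -/
theorem two_mem_of_odd_mem {I : Ideal B} {c : ℤ} {m : ℕ} (h1 : ((2 + 4 * c : ℤ) : B) ∈ I)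
    (h2 : ((2 ^ (m + 1) : ℤ) : B) ∈ I) : (2 : B) ∈ I := by
  have hc : IsCoprime (1 + 2 * c) (2 ^ m : ℤ) := IsCoprime.pow_right ⟨1, -c, by ring⟩
  obtain ⟨x, y, hxy⟩ := hc
  have h : (2 : B) = x * ((2 + 4 * c : ℤ) : B) + y * ((2 ^ (m + 1) : ℤ) : B) := by
    have := congrArg (fun z : ℤ => 2 * (z : B)) hxy
    push_cast at this ⊢
    linear_combination -this
  rw [h]
  exact add_mem (I.mul_mem_left _ h1) (I.mul_mem_left _ h2)

end

/-! ## Divisibility properties of the coefficients of the minimal relation -/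

/-- With `N = 2^(s+1)`, multiply `cPol (s+1) = X^(N-1) + 2p` by `dPol (s+1) = X^N + 2(1 + Xq)`. The
constant term `2` of the second factor produces the term `2 X^(N-1)`, on which the special role of
`γ_N` rests. -/
theorem exists_cPol_eq_four (s : ℕ) : ∃ p q, cPol (s + 2) = X ^ (2 * 2 ^ (s + 1) - 1) +
    2 * X ^ (2 ^ (s + 1) - 1) + 2 * X ^ 2 ^ (s + 1) * p + 4 * q := by
  obtain ⟨p, hp⟩ := exists_cPol_eq (s + 1)
  obtain ⟨q, hq⟩ := exists_dPol_succ_eq s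
  refine ⟨p + q, p * (1 + X * q), ?_⟩
  have h1 := Nat.two_pow_pos (s + 1)
  have h2 : 2 * 2 ^ (s + 1) - 1 = (2 ^ (s + 1) - 1) + 2 ^ (s + 1) := by omega
  have h3 : (X : ℤ[X]) ^ 2 ^ (s + 1) = X ^ (2 ^ (s + 1) - 1) * X := by
    rw [← pow_succ]; congr 1; omega
  have key : ∀ x y : ℤ[X], y = x * X → (x + 2 * p) * (y + 2 * (1 + X * q)) =
      x * y + 2 * x + 2 * y * (p + q) + 4 * (p * (1 + X * q)) := by
    intro x y h
    linear_combination (-2 * q) * h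
  rw [cPol_succ, hp, hq, h2, pow_add (X : ℤ[X])]
  exact key _ _ h3

section

variable {s j : ℕ}

theorem eCoeff_eq_sub (s j : ℕ) : eCoeff (s + 2) j = (cPol (s + 2)).coeff (2 * 2 ^ (s + 1) - 1 - j) := by
  rw [eCoeff, pow_succ 2 (s + 1), mul_comm]

theorem coeff_ofNat_mul (a : ℕ) [a.AtLeastTwo] (p : ℤ[X]) (i : ℕ) :
    ((OfNat.ofNat a : ℤ[X]) * p).coeff i = (OfNat.ofNat a : ℤ) * p.coeff i :=
  coeff_C_mul (a := (OfNat.ofNat a : ℤ)) p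

theorem two_dvd_eCoeff (h1 : 1 ≤ j) (hj : j < 2 * 2 ^ (s + 1)) : 2 ∣ eCoeff (s + 2) j := by
  obtain ⟨p, q, h⟩ := exists_cPol_eq_four s
  rw [eCoeff_eq_sub, h]
  have h4 : (4 : ℤ[X]) * q = 2 * (2 * q) := by ring
  rw [coeff_add, coeff_add, coeff_add, coeff_X_pow, if_neg (by omega), h4, mul_assoc,
    coeff_ofNat_mul, coeff_ofNat_mul, coeff_ofNat_mul, zero_add]
  exact dvd_add (dvd_add (dvd_mul_right _ _) (dvd_mul_right _ _)) (dvd_mul_right _ _)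

theorem four_dvd_eCoeff (h1 : 2 ^ (s + 1) < j) (hj : j < 2 * 2 ^ (s + 1)) :
    4 ∣ eCoeff (s + 2) j := by
  obtain ⟨p, q, h⟩ := exists_cPol_eq_four s
  rw [eCoeff_eq_sub, h]
  rw [coeff_add, coeff_add, coeff_add, coeff_X_pow, if_neg (by omega), mul_assoc,
    coeff_ofNat_mul, coeff_ofNat_mul, coeff_ofNat_mul, coeff_X_pow, if_neg (by omega),
    coeff_X_pow_mul', if_neg (by omega)]
  simp

theorem eCoeff_middle (s : ℕ) : ∃ c, eCoeff (s + 2) (2 ^ (s + 1)) = 2 + 4 * c := by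
  obtain ⟨p, q, h⟩ := exists_cPol_eq_four s
  have h0 := Nat.two_pow_pos (s + 1)
  have h1 : 2 * 2 ^ (s + 1) - 1 - 2 ^ (s + 1) = 2 ^ (s + 1) - 1 := by omega
  refine ⟨q.coeff (2 ^ (s + 1) - 1), ?_⟩
  rw [eCoeff_eq_sub, h, h1]
  rw [coeff_add, coeff_add, coeff_add, coeff_X_pow, if_neg (by omega), mul_assoc,
    coeff_ofNat_mul, coeff_ofNat_mul, coeff_ofNat_mul, coeff_X_pow, if_pos rfl,
    coeff_X_pow_mul', if_neg (by omega)]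
  simp

theorem eCoeff_last (s : ℕ) : eCoeff (s + 2) (2 * 2 ^ (s + 1) - 1) = -2 ^ (s + 2) := by
  rw [eCoeff_eq_sub, Nat.sub_self, coeff_zero_eq_eval_zero, eval_zero_cPol_succ]

end

/-! ## The filtration of the Verlinde algebra -/

/-- The filtration of `ℤ[X] / (cPol (s + 2))` in which `2` has weight `2 ^ (s + 1)` and the
class of `X` has weight `1`. -/
def modelFiltration (s : ℕ) : RingFiltration (Model (s + 2)) :=
  twoFiltration (2 ^ (s + 1)) (Model.v (s + 2))

theorem Model.g_eq_sum (r k : ℕ) :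
    Model.g r k = ∑ j ∈ Finset.range (k + 1), (eCoeff r j : Model r) * Model.v r ^ (k - j) := by
  rw [Model.g, gPol, map_sum]
  refine Finset.sum_congr rfl fun j _ => ?_
  rw [map_mul, map_pow, eq_intCast C, map_intCast]
  rfl

theorem mem_modelFiltration {s k a b : ℕ} (h : k ≤ 2 ^ (s + 1) * a + b) (c : Model (s + 2)) :
    2 ^ a * Model.v (s + 2) ^ b * c ∈ (modelFiltration s).piece k :=
  mem_twoFiltration h c

/-- The leading form of the image of `γₖ`. -/
def Model.lead (s k : ℕ) : Model (s + 2) :=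
  Model.v (s + 2) ^ k +
    if 2 ^ (s + 1) ≤ k then 2 * Model.v (s + 2) ^ (k - 2 ^ (s + 1)) else 0

theorem Model.g_sub_lead {s k : ℕ} (hk : k < 2 * 2 ^ (s + 1)) :
    Model.g (s + 2) k - Model.lead s k ∈ (modelFiltration s).piece (k + 1) := by
  set N := 2 ^ (s + 1) with hN
  have hN0 : 0 < N := Nat.two_pow_pos _
  set v := Model.v (s + 2)
  have h : Model.g (s + 2) k - Model.lead s k = ∑ j ∈ Finset.range (k + 1),
      ((eCoeff (s + 2) j - (if j = 0 then 1 else 0) - (if j = N then 2 else 0) : ℤ) :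
        Model (s + 2)) * v ^ (k - j) := by
    rw [Model.g_eq_sum, Model.lead]
    push_cast
    simp only [sub_mul, Finset.sum_sub_distrib, ite_mul, one_mul, zero_mul, Finset.sum_ite_eq',
      Finset.mem_range, Nat.lt_succ_iff, Nat.zero_le, if_true, Nat.sub_zero]
    rw [sub_sub]
  rw [h]
  refine sum_mem fun j hj => ?_
  have hj' := Finset.mem_range_succ_iff.1 hj
  -- After removal of the leading terms, the coefficient of `v^(k-j)` is even for `0 < j < N` and
  -- divisible by `4` for `j ≥ N`. The weight gained, at least `N` or `2N`, exceeds `j`.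
  rcases Nat.eq_zero_or_pos j with rfl | hj0
  · rw [if_pos rfl, if_neg (by omega), eCoeff_zero]
    simp
  rw [if_neg (by omega), sub_zero]
  rcases lt_trichotomy j N with h1 | h1 | h1
  · obtain ⟨c, hc⟩ := two_dvd_eCoeff (s := s) hj0 (by omega)
    rw [if_neg (by omega), sub_zero, hc]
    have := mem_modelFiltration (s := s) (k := k + 1) (a := 1) (b := k - j)
      (by rw [mul_one]; omega) (c : Model (s + 2))
    refine (congrArg (· ∈ (modelFiltration s).piece (k + 1)) ?_).mpr this
    push_cast
    ring
  · obtain ⟨c, hc⟩ := eCoeff_middle s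
    rw [if_pos h1, h1, hc]
    have := mem_modelFiltration (s := s) (k := k + 1) (a := 2) (b := k - N)
      (by omega) (c : Model (s + 2))
    refine (congrArg (· ∈ (modelFiltration s).piece (k + 1)) ?_).mpr this
    push_cast
    ring
  · obtain ⟨c, hc⟩ := four_dvd_eCoeff (s := s) h1 (by omega)
    rw [if_neg (by omega), sub_zero, hc]
    have := mem_modelFiltration (s := s) (k := k + 1) (a := 2) (b := k - j)
      (by omega) (c : Model (s + 2))
    refine (congrArg (· ∈ (modelFiltration s).piece (k + 1)) ?_).mpr this
    push_cast
    ring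

theorem Model.lead_mem (s k : ℕ) : Model.lead s k ∈ (modelFiltration s).piece k := by
  refine add_mem ?_ ?_
  · simpa using mem_modelFiltration (s := s) (k := k) (a := 0) (b := k)
      (by omega) 1
  · split_ifs with h
    · simpa using mem_modelFiltration (s := s) (k := k) (a := 1)
        (b := k - 2 ^ (s + 1)) (by omega) 1
    · exact zero_mem _

theorem Model.g_mem {s k : ℕ} (hk : k < 2 * 2 ^ (s + 1)) :
    Model.g (s + 2) k ∈ (modelFiltration s).piece k :=
  (modelFiltration s).mem_of_congr (Model.lead_mem s k) (Model.g_sub_lead hk)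

theorem map_weightIdeal_eq {n s : ℕ} (hn : n = 2 * 2 ^ (s + 1) - 2) (k : ℕ) :
    (weightIdeal n k).map (toModel n (s + 2)) = (modelFiltration s).piece k := by
  set N := 2 ^ (s + 1) with hN
  have hN0 : 2 ≤ N := by have := Nat.two_pow_pos s; rw [hN, pow_succ]; omega
  refine le_antisymm (Ideal.map_le_iff_le_comap.2 fun p hp => ?_) (Ideal.span_le.2 ?_)
  · refine (modelFiltration s).map_mem_of_mem_weightIdeal (toModel n (s + 2)) (fun i => ?_) hp
    rw [toModel, MvPolynomial.eval₂Hom_X']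
    exact Model.g_mem (by omega)
  · let F := (weightFiltration n).map (toModel n (s + 2))
    show _ ⊆ ((F.piece k : Ideal _) : Set (Model (s + 2)))
    have hg : ∀ j, 1 ≤ j → j ≤ n → Model.g (s + 2) j ∈ F.piece j := by
      intro j h1 hj
      rw [← toModel_gVar (s + 2) h1 hj]
      exact Ideal.mem_map_of_mem (toModel n (s + 2)) (gVar_mem_weightIdeal h1 hj)
    obtain ⟨c, hc⟩ := eCoeff_middle s
    have hr : 2 ^ (s + 2) - 1 = n + 1 := by rw [pow_succ, ← hN]; omega
    -- This is `cPol = 0`, read as `γₙ₊₁ = 0`, with constant coefficient `-2^(s+2)`.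
    have hlast : ((2 ^ (s + 2) : ℤ) : Model (s + 2)) = Model.v (s + 2) * Model.g (s + 2) n := by
      have h1 := Model.g_last (s + 2)
      have h2 : n + 1 = 2 * 2 ^ (s + 1) - 1 := by omega
      rw [hr, Model.g_succ, h2, eCoeff_last] at h1
      push_cast at h1 ⊢
      linear_combination -h1
    have hmid : ((2 + 4 * c : ℤ) : Model (s + 2)) =
        Model.g (s + 2) N - Model.v (s + 2) * Model.g (s + 2) (N - 1) := by
      have h1 := Model.g_succ (s + 2) (N - 1)
      rw [show N - 1 + 1 = N by omega, hc] at h1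
      rw [h1, add_sub_cancel_left]
    -- A bootstrap: `2` in the first piece puts `v = γ₁ - e₁` there, as `e₁` is even. With `v` of
    -- weight `1`, the same argument then places `2` in piece `N`.
    have h21 : (2 : Model (s + 2)) ∈ F.piece 1 := by
      refine two_mem_of_odd_mem (c := c) (m := s + 1) ?_ ?_
      · rw [hmid]
        exact sub_mem (F.antitone (by omega) (hg N (by omega) (by omega)))
          (Ideal.mul_mem_left _ _ (F.antitone (by omega) (hg (N - 1) (by omega) (by omega))))
      · rw [hlast]
        exact Ideal.mul_mem_left _ _ (F.antitone (by omega) (hg n (by omega) le_rfl))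
    have hv1 : Model.v (s + 2) ∈ F.piece 1 := by
      obtain ⟨d, hd⟩ := two_dvd_eCoeff (s := s) (j := 1) le_rfl (by omega)
      have h1 := Model.g_succ (s + 2) 0
      rw [Model.g_zero, mul_one, zero_add, hd] at h1
      rw [← sub_eq_iff_eq_add.2 h1]
      refine sub_mem (hg 1 le_rfl (by omega)) ?_
      push_cast
      exact Ideal.mul_mem_right _ _ h21
    have h2N : (2 : Model (s + 2)) ∈ F.piece N := by
      refine two_mem_of_odd_mem (c := c) (m := s + 1) ?_ ?_
      · rw [hmid]
        refine sub_mem (hg N (by omega) (by omega)) ?_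
        have := F.mul_mem hv1 (hg (N - 1) (by omega) (by omega))
        rwa [show 1 + (N - 1) = N by omega] at this
      · rw [hlast]
        exact Ideal.mul_mem_left _ _ (F.antitone (by omega) (hg n (by omega) le_rfl))
    rintro _ ⟨a, b, hab, rfl⟩
    refine F.antitone hab ?_
    have := F.mul_mem (F.pow_mem h2N a) (F.pow_mem hv1 b)
    rwa [mul_one, mul_comm a] at this

/-- The filtration of the Verlinde algebra, in terms of the one-variable model. -/
theorem mem_piece_iff_model {n s : ℕ} (hn : n = 2 * 2 ^ (s + 1) - 2) (hr : n + 1 = 2 ^ (s + 2) - 1)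
    (hn1 : 1 ≤ n) {k : ℕ} {x : VerlindeAlgebra n 1} :
    x ∈ (verlindeFiltration n 1).piece k ↔
      verlindeToModel hr hn1 x ∈ (modelFiltration s).piece k := by
  rw [mem_verlindeFiltration_iff hr hn1, map_weightIdeal_eq hn]

end SymplecticVerlinde
end

noncomputable section

namespace SymplecticVerlinde

open Polynomial

/-! ## The two components of the model -/

section

variable {B : Type} [CommRing B] {N : ℕ} {v p : B}

/-- The factor `1 + vp` is inverted modulo `v^N` by a finite geometric sum. -/
theorem exists_two_eq_pow_mul (h : v ^ N + 2 * (1 + v * p) = 0) : ∃ x, 2 = v ^ N * x := by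
  have h1 := mul_neg_geom_sum (-(v * p)) N
  refine ⟨2 * (-p) ^ N - ∑ i ∈ Finset.range N, (-(v * p)) ^ i, ?_⟩
  have h2 : (-(v * p)) ^ N = v ^ N * (-p) ^ N := by rw [← mul_pow, mul_neg]
  rw [h2] at h1
  linear_combination (-2 : B) * h1 + (∑ i ∈ Finset.range N, (-(v * p)) ^ i) * h

theorem pow_dvd_of_mem_twoFiltration (h : v ^ N + 2 * (1 + v * p) = 0) {k : ℕ} {x : B}
    (hx : x ∈ (twoFiltration N v).piece k) : v ^ k ∣ x := by
  obtain ⟨y, hy⟩ := exists_two_eq_pow_mul h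
  have hle : (twoFiltration N v).piece k ≤ Ideal.span {v ^ k} := by
    refine Ideal.span_le.2 ?_
    rintro _ ⟨a, b, hab, rfl⟩
    refine Ideal.mem_span_singleton.2 ((pow_dvd_pow v hab).trans ⟨y ^ a, ?_⟩)
    rw [hy, mul_pow, pow_add, pow_mul]
    ring
  exact Ideal.mem_span_singleton.1 (hle hx)

theorem pow_succ_dvd_add_two (h : v ^ N + 2 * (1 + v * p) = 0) : v ^ (N + 1) ∣ v ^ N + 2 := by
  obtain ⟨y, hy⟩ := exists_two_eq_pow_mul h
  refine ⟨-(y * p), ?_⟩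
  rw [pow_succ]
  linear_combination h - v * p * hy

theorem exists_pow_mul_eq (hN : 1 ≤ N) (h : v ^ (N - 1) + 2 * p = 0) (e : ℕ) :
    ∃ x, v ^ (N * e) = 2 ^ e * v ^ e * x := by
  refine ⟨(-p) ^ e, ?_⟩
  have h1 : v ^ N = 2 * v * -p := by
    obtain ⟨M, rfl⟩ := Nat.exists_eq_add_of_le' hN
    rw [Nat.add_sub_cancel] at h
    rw [pow_succ]
    linear_combination v * h
  rw [pow_mul, h1, mul_pow, mul_pow]

/-- The ideal generated by `2ᵇ⁺¹` and `2ᵇvᵃ⁺¹`. -/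
def nearIdeal (v : B) (a b : ℕ) : Ideal B := Ideal.span {2 ^ (b + 1), 2 ^ b * v ^ (a + 1)}

/-- Since `v^N` is a multiple of `2v`, trading `v^(Ne)` for `2^e` leaves an extra factor `v^e`. A
surplus in the exponent of `v` therefore persists. -/
theorem mem_nearIdeal {a b c d : ℕ} (hN : 1 ≤ N) (h : v ^ (N - 1) + 2 * p = 0)
    (hcd : b < c ∨ ∃ e d', b = c + e ∧ d = N * e + d' ∧ a < e + d') :
    2 ^ c * v ^ d ∈ nearIdeal v a b := by
  rcases hcd with hcd | ⟨e, d', rfl, rfl, hlt⟩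
  · obtain ⟨c, rfl⟩ := Nat.exists_eq_add_of_lt hcd
    have : (2 : B) ^ (b + c + 1) * v ^ d = 2 ^ c * v ^ d * 2 ^ (b + 1) := by ring
    rw [this]
    exact Ideal.mul_mem_left _ _ (Ideal.subset_span (by simp))
  · obtain ⟨x, hx⟩ := exists_pow_mul_eq hN h e
    obtain ⟨f, hf⟩ := Nat.exists_eq_add_of_lt hlt
    have : (2 : B) ^ c * v ^ (N * e + d') = v ^ f * x * (2 ^ (c + e) * v ^ (a + 1)) := by
      rw [pow_add v, hx]
      have : v ^ e * v ^ d' = v ^ (a + 1) * v ^ f := by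
        rw [← pow_add, ← pow_add, hf]; congr 1; omega
      linear_combination 2 ^ c * 2 ^ e * x * this
    rw [this]
    exact Ideal.mul_mem_left _ _ (Ideal.subset_span (by simp))

theorem mem_nearIdeal_of_mem_twoFiltration {a b : ℕ} (hN : 1 ≤ N) (h : v ^ (N - 1) + 2 * p = 0)
    {x : B} (hx : x ∈ (twoFiltration N v).piece (N * b + a + 1)) : x ∈ nearIdeal v a b := by
  have hle : (twoFiltration N v).piece (N * b + a + 1) ≤ nearIdeal v a b := by
    refine Ideal.span_le.2 ?_
    rintro _ ⟨c, d, hcd, rfl⟩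
    refine mem_nearIdeal hN h ?_
    rcases Nat.lt_or_ge b c with hbc | hbc
    · exact Or.inl hbc
    · obtain ⟨e, rfl⟩ := Nat.exists_eq_add_of_le hbc
      rw [mul_add] at hcd
      exact Or.inr ⟨e, d - N * e, rfl, by omega, by omega⟩
  exact hle hx

end

/-- As `X` is prime and does not divide `dPol (s + 1)`, the factor `Xᵏ` cancels. Evaluation at `0`,
where `dPol (s + 1)` is `2`, then gives the parity of `q`. -/
theorem two_dvd_of_pow_succ_dvd {s k : ℕ} {q : ℤ}
    (h : Ideal.Quotient.mk (Ideal.span {dPol (s + 1)}) X ^ (k + 1) ∣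
      (q : ℤ[X] ⧸ Ideal.span {dPol (s + 1)}) *
        Ideal.Quotient.mk (Ideal.span {dPol (s + 1)}) X ^ k) : 2 ∣ q := by
  obtain ⟨x, hx⟩ := h
  obtain ⟨x, rfl⟩ := Ideal.Quotient.mk_surjective x
  rw [← map_intCast (Ideal.Quotient.mk (Ideal.span {dPol (s + 1)})), ← map_pow, ← map_pow,
    ← map_mul, ← map_mul, Ideal.Quotient.eq, Ideal.mem_span_singleton] at hx
  obtain ⟨y, hy⟩ := hx
  have h0 := eval_zero_dPol_succ s
  have hX : ¬ X ∣ dPol (s + 1) := by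
    rw [X_dvd_iff, coeff_zero_eq_eval_zero, h0]
    norm_num
  have h1 : X ^ k ∣ dPol (s + 1) * y := by
    rw [← hy, pow_succ, mul_assoc, mul_comm _ (X ^ k), ← mul_sub]
    exact dvd_mul_right _ _
  obtain ⟨z, rfl⟩ := prime_X.pow_dvd_of_dvd_mul_left k hX h1
  have h2 : (q : ℤ[X]) - X * x = dPol (s + 1) * z := by
    refine mul_left_cancel₀ (pow_ne_zero k X_ne_zero) ?_
    linear_combination hy
  have h3 := congrArg (eval 0) h2
  simp [h0] at h3
  exact ⟨_, h3⟩

/-- As `2` is prime and `cPol (s + 1)` is monic, the factor `2ᵇ` cancels. Modulo `2`, `cPol (s + 1)`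
is `X^(2^(s+1) - 1)`, whose exponent exceeds `a`, so only `q` contributes to the coefficient of
`Xᵃ`. -/
theorem two_dvd_of_mem_nearIdeal {s a b : ℕ} {q : ℤ} (ha : a + 2 ≤ 2 ^ (s + 1))
    (h : (q : ℤ[X] ⧸ Ideal.span {cPol (s + 1)}) *
      (2 ^ b * Ideal.Quotient.mk (Ideal.span {cPol (s + 1)}) X ^ a) ∈
        nearIdeal (Ideal.Quotient.mk (Ideal.span {cPol (s + 1)}) X) a b) : 2 ∣ q := by
  obtain ⟨x, y, hxy⟩ := Ideal.mem_span_pair.1 h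
  obtain ⟨x, rfl⟩ := Ideal.Quotient.mk_surjective x
  obtain ⟨y, rfl⟩ := Ideal.Quotient.mk_surjective y
  have h2 : (2 : ℤ[X] ⧸ Ideal.span {cPol (s + 1)}) = Ideal.Quotient.mk _ 2 := (map_ofNat _ 2).symm
  rw [← map_intCast (Ideal.Quotient.mk (Ideal.span {cPol (s + 1)})), h2] at hxy
  simp only [← map_pow, ← map_mul, ← map_add] at hxy
  rw [Ideal.Quotient.eq, Ideal.mem_span_singleton] at hxy
  obtain ⟨z, hz⟩ := hxy
  obtain ⟨p, hp⟩ := exists_cPol_eq (s + 1)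
  have hprime : Prime (2 : ℤ[X]) := prime_C_iff.2 Int.prime_two
  have hnd : ¬ (2 : ℤ[X]) ∣ cPol (s + 1) := by
    intro hd
    have := C_dvd_iff_dvd_coeff (2 : ℤ) _ |>.1 hd (cPol (s + 1)).natDegree
    rw [show (cPol (s + 1)).coeff (cPol (s + 1)).natDegree = 1 from monic_cPol (s + 1)] at this
    norm_num at this
  have h1 : (2 : ℤ[X]) ^ b ∣ cPol (s + 1) * z := by
    rw [← hz]
    exact ⟨x * 2 + y * X ^ (a + 1) - (q : ℤ[X]) * X ^ a, by ring⟩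
  obtain ⟨w, rfl⟩ := hprime.pow_dvd_of_dvd_mul_left b hnd h1
  have h3 : x * 2 + y * X ^ (a + 1) - (q : ℤ[X]) * X ^ a = cPol (s + 1) * w := by
    refine mul_left_cancel₀ (pow_ne_zero b hprime.ne_zero) ?_
    linear_combination hz
  have h4 : C q * X ^ a = 2 * (x - p * w) + X ^ (a + 1) * y - X ^ (2 ^ (s + 1) - 1) * w := by
    rw [eq_intCast C, ← sub_eq_zero]
    rw [hp] at h3
    linear_combination -h3
  have h5 := congrArg (fun f => f.coeff a) h4
  simp only [coeff_C_mul_X_pow, if_true, coeff_sub, coeff_add] at h5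
  rw [coeff_ofNat_mul, coeff_X_pow_mul', if_neg (by omega), coeff_X_pow_mul', if_neg (by omega), add_zero,
    sub_zero] at h5
  exact ⟨_, h5⟩

/-- Homogeneous elements of the second generator whose sum has larger filtration. -/
theorem two_dvd_of_sum_mem {s k : ℕ} {S : Finset (ℕ × ℕ)} {q : ℕ × ℕ → ℤ}
    (hS : ∀ m ∈ S, 2 ^ (s + 1) * m.2 + m.1 = k)
    (h : ∑ m ∈ S, (q m : Model (s + 2)) * (Model.v (s + 2) ^ m.1 *
      (Model.v (s + 2) ^ 2 ^ (s + 1) + 2) ^ m.2) ∈ (modelFiltration s).piece (k + 1))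
    {m : ℕ × ℕ} (hm : m ∈ S) : 2 ∣ q m ∨ (1 ≤ m.2 ∧ 2 ^ (s + 1) ≤ m.1 + 1) := by
  obtain ⟨a, b⟩ := m
  have hk : 2 ^ (s + 1) * b + a = k := hS _ hm
  have hN1 : 2 ≤ 2 ^ (s + 1) := by have := Nat.two_pow_pos s; rw [pow_succ]; omega
  rcases Nat.eq_zero_or_pos b with rfl | hb
  · left
    -- A pure power of `v` is read off modulo `dPol (s + 1)`. There `v^N + 2` is divisible by
    -- `v^(N+1)`, so all other terms of degree `k` are divisible by `v^(k+1)`.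
    have hle : Ideal.span {cPol (s + 2)} ≤ Ideal.span {dPol (s + 1)} := by
      rw [Ideal.span_singleton_le_span_singleton, cPol_succ]
      exact dvd_mul_left _ _
    obtain ⟨p, hp⟩ := exists_dPol_succ_eq s
    let w := Ideal.Quotient.mk (Ideal.span {dPol (s + 1)}) X
    have hw : w ^ 2 ^ (s + 1) + 2 * (1 + w * Ideal.Quotient.mk _ p) = 0 := by
      have h0 := Ideal.Quotient.eq_zero_iff_mem.2 (Ideal.mem_span_singleton_self (dPol (s + 1)))
      rw [hp, map_add, map_mul, map_add, map_mul, map_pow, map_one, map_ofNat, ← hp] at h0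
      exact h0
    have h1 := map_twoFiltration_le (Ideal.Quotient.factor hle) (v' := w) rfl h
    have h2 := pow_dvd_of_mem_twoFiltration hw h1
    rw [map_sum, ← Finset.add_sum_erase _ _ hm] at h2
    rw [mul_zero, zero_add] at hk
    refine two_dvd_of_pow_succ_dvd (s := s) (k := k) ?_
    have h4 : w ^ (k + 1) ∣ ∑ m ∈ S.erase (a, 0), Ideal.Quotient.factor hle
        ((q m : Model (s + 2)) * (Model.v (s + 2) ^ m.1 *
          (Model.v (s + 2) ^ 2 ^ (s + 1) + 2) ^ m.2)) := by
      refine Finset.dvd_sum fun m hm' => ?_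
      obtain ⟨hne, hmS⟩ := Finset.mem_erase.1 hm'
      have hm2 : 1 ≤ m.2 := by
        by_contra h0
        have h00 : m.2 = 0 := by omega
        have := hS m hmS
        rw [h00] at this
        exact hne (Prod.ext (by simp; omega) h00)
      obtain ⟨y, hy⟩ := pow_succ_dvd_add_two hw
      have h3 : k + 1 ≤ m.1 + (2 ^ (s + 1) + 1) * m.2 := by
        have := hS m hmS
        rw [add_mul]
        omega
      refine (pow_dvd_pow w h3).trans ⟨q m * y ^ m.2, ?_⟩
      rw [map_mul, map_mul, map_intCast, map_pow, map_pow, map_add, map_pow, map_ofNat]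
      show (q m : ℤ[X] ⧸ Ideal.span {dPol (s + 1)}) * (w ^ m.1 * (w ^ 2 ^ (s + 1) + 2) ^ m.2) = _
      rw [hy, mul_pow, pow_add w m.1, pow_mul]
      ring
    · refine (dvd_add_left h4).1 ?_
      have h3 : Ideal.Quotient.factor hle ((q (a, 0) : Model (s + 2)) * (Model.v (s + 2) ^ a *
          (Model.v (s + 2) ^ 2 ^ (s + 1) + 2) ^ 0)) = q (a, 0) * w ^ k := by
        rw [pow_zero, mul_one, map_mul, map_intCast, map_pow, hk]
        rfl
      rw [← h3]
      exact h2
  · rw [or_iff_not_imp_right]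
    intro hab
    have ha : a + 2 ≤ 2 ^ (s + 1) := by
      by_contra h0
      exact hab ⟨hb, by simp; omega⟩
    -- A term with `b ≥ 1` and `a ≤ N - 2` is read off modulo `cPol (s + 1)`, where `v^N + 2 = 2 (1
    -- - v p')` behaves like `2`.
    have hle : Ideal.span {cPol (s + 2)} ≤ Ideal.span {cPol (s + 1)} := by
      rw [Ideal.span_singleton_le_span_singleton, cPol_succ (s + 1)]
      exact dvd_mul_right _ _
    obtain ⟨p, hp⟩ := exists_cPol_eq (s + 1)
    let w := Ideal.Quotient.mk (Ideal.span {cPol (s + 1)}) X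
    let p' := Ideal.Quotient.mk (Ideal.span {cPol (s + 1)}) p
    have hw : w ^ (2 ^ (s + 1) - 1) + 2 * p' = 0 := by
      have h0 := Ideal.Quotient.eq_zero_iff_mem.2 (Ideal.mem_span_singleton_self (cPol (s + 1)))
      rw [hp, map_add, map_mul, map_pow, map_ofNat, ← hp] at h0
      exact h0
    have hw2 : w ^ 2 ^ (s + 1) + 2 = 2 * (1 - w * p') := by
      have : w ^ 2 ^ (s + 1) = w ^ (2 ^ (s + 1) - 1) * w := by
        rw [← pow_succ]; congr 1; omega
      rw [this]
      linear_combination w * hw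
    rw [← hk] at h
    have h1 := map_twoFiltration_le (Ideal.Quotient.factor hle) (v' := w) rfl h
    have h2 := mem_nearIdeal_of_mem_twoFiltration (by omega) hw h1
    have hterm : ∀ m : ℕ × ℕ, Ideal.Quotient.factor hle ((q m : Model (s + 2)) *
        (Model.v (s + 2) ^ m.1 * (Model.v (s + 2) ^ 2 ^ (s + 1) + 2) ^ m.2)) =
        q m * (2 ^ m.2 * w ^ m.1 * (1 - w * p') ^ m.2) := by
      intro m
      rw [map_mul, map_mul, map_intCast, map_pow, map_pow, map_add, map_pow, map_ofNat]
      show (q m : ℤ[X] ⧸ Ideal.span {cPol (s + 1)}) * (w ^ m.1 * (w ^ 2 ^ (s + 1) + 2) ^ m.2) = _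
      rw [hw2, mul_pow]
      ring
    rw [map_sum, ← Finset.add_sum_erase _ _ hm] at h2
    simp only [hterm] at h2
    have h3 : ∑ m ∈ S.erase (a, b), (q m : ℤ[X] ⧸ Ideal.span {cPol (s + 1)}) *
        (2 ^ m.2 * w ^ m.1 * (1 - w * p') ^ m.2) ∈ nearIdeal w a b := by
      refine sum_mem fun m hm' => ?_
      obtain ⟨hne, hmS⟩ := Finset.mem_erase.1 hm'
      refine Ideal.mul_mem_left _ _ (Ideal.mul_mem_right _ _ (mem_nearIdeal (N := 2 ^ (s + 1))
        (by omega) hw ?_))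
      have hmk := (hS m hmS).trans hk.symm
      -- No other term has a larger power of the second generator, because `a < N`. Terms with a
      -- smaller power contain extra factors `v^N` and fall into the near ideal.
      have hlt : m.2 < b := by
        rcases lt_trichotomy m.2 b with h | h | h
        · exact h
        · rw [h] at hmk
          exact absurd (Prod.ext (by simp; omega) h) hne
        · obtain ⟨e, he⟩ := Nat.exists_eq_add_of_lt h
          rw [he, mul_add, mul_add] at hmk
          omega
      obtain ⟨e, he⟩ := Nat.exists_eq_add_of_lt hlt
      refine Or.inr ⟨e + 1, a, he, ?_, by omega⟩
      rw [he, add_assoc, mul_add] at hmk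
      omega
    have h4 := (Ideal.add_mem_iff_left _ h3).1 h2
    obtain ⟨y, hy⟩ := sub_dvd_pow_sub_pow (1 - w * p') 1 b
    have h5 : (q (a, b) : ℤ[X] ⧸ Ideal.span {cPol (s + 1)}) * (2 ^ b * w ^ a) =
        q (a, b) * (2 ^ b * w ^ a * (1 - w * p') ^ b) +
          q (a, b) * p' * y * (2 ^ b * w ^ (a + 1)) := by
      rw [one_pow] at hy
      rw [pow_succ]
      linear_combination -q (a, b) * 2 ^ b * w ^ a * hy
    refine two_dvd_of_mem_nearIdeal ha (b := b) ?_
    show _ * (2 ^ b * w ^ a) ∈ nearIdeal w a b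
    rw [h5]
    exact add_mem h4 (Ideal.mul_mem_left _ _ (Ideal.subset_span (by simp)))

end SymplecticVerlinde
end

noncomputable section

namespace SymplecticVerlinde

/-! ## Classes in the associated graded ring -/

namespace RingFiltration

variable {R : Type} [CommRing R] {F : RingFiltration R}

/-- `x` is the class of `a` in the degree `k` part of the associated graded ring. -/
def IsCls (F : RingFiltration R) (k : ℕ) (a : R) (x : F.Gr) : Prop :=
  ∃ ha : a ∈ F.piece k, x = F.cls k a ha

theorem isCls_cls {k : ℕ} {a : R} (ha : a ∈ F.piece k) : F.IsCls k a (F.cls k a ha) := ⟨ha, rfl⟩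

theorem IsCls.eq {k : ℕ} {a b : R} {x y : F.Gr} (hx : F.IsCls k a x) (hy : F.IsCls k b y)
    (h : a - b ∈ F.piece (k + 1)) : x = y := by
  obtain ⟨ha, rfl⟩ := hx
  obtain ⟨hb, rfl⟩ := hy
  refine Ideal.Quotient.eq.2 fun j => ?_
  show (Polynomial.monomial k a - Polynomial.monomial k b).coeff j ∈ _
  rw [← map_sub, Polynomial.coeff_monomial]
  split_ifs with hj
  · exact hj ▸ h
  · exact Ideal.zero_mem _

theorem IsCls.zero (k : ℕ) : F.IsCls k 0 0 := by
  refine ⟨Ideal.zero_mem _, (Ideal.Quotient.eq_zero_iff_mem.2 fun j => ?_).symm⟩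
  show (Polynomial.monomial k (0 : R)).coeff j ∈ _
  rw [map_zero]
  exact Ideal.zero_mem _

theorem IsCls.eq_zero {k : ℕ} {a : R} {x : F.Gr} (hx : F.IsCls k a x)
    (h : a ∈ F.piece (k + 1)) : x = 0 :=
  hx.eq (IsCls.zero k) (by rwa [sub_zero])

theorem IsCls.add {k : ℕ} {a b : R} {x y : F.Gr} (hx : F.IsCls k a x) (hy : F.IsCls k b y) :
    F.IsCls k (a + b) (x + y) := by
  obtain ⟨ha, rfl⟩ := hx
  obtain ⟨hb, rfl⟩ := hy
  refine ⟨add_mem ha hb, ?_⟩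
  refine (map_add (Ideal.Quotient.mk F.reesIdeal) _ _).symm.trans ?_
  refine congrArg (Ideal.Quotient.mk F.reesIdeal) (Subtype.ext ?_)
  exact (map_add (Polynomial.monomial k) a b).symm

theorem IsCls.mul {i j : ℕ} {a b : R} {x y : F.Gr} (hx : F.IsCls i a x) (hy : F.IsCls j b y) :
    F.IsCls (i + j) (a * b) (x * y) := by
  obtain ⟨ha, rfl⟩ := hx
  obtain ⟨hb, rfl⟩ := hy
  refine ⟨F.mul_mem ha hb, ?_⟩
  refine (map_mul (Ideal.Quotient.mk F.reesIdeal) _ _).symm.trans ?_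
  refine congrArg (Ideal.Quotient.mk F.reesIdeal) (Subtype.ext ?_)
  exact Polynomial.monomial_mul_monomial i j a b

theorem IsCls.intCast (z : ℤ) : F.IsCls 0 z z := by
  refine ⟨by rw [F.piece_zero]; trivial, ?_⟩
  refine (map_intCast (Ideal.Quotient.mk F.reesIdeal) z).symm.trans ?_
  refine congrArg (Ideal.Quotient.mk F.reesIdeal) (Subtype.ext ?_)
  exact ((map_intCast (Polynomial.C : R →+* Polynomial R) z).symm : ((z : Polynomial R)) = Polynomial.C (z : R))

theorem IsCls.pow {i : ℕ} {a : R} {x : F.Gr} (hx : F.IsCls i a x) (m : ℕ) :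
    F.IsCls (m * i) (a ^ m) (x ^ m) := by
  induction m with
  | zero => simpa using IsCls.intCast (F := F) 1
  | succ m ih =>
    rw [pow_succ, pow_succ, Nat.succ_mul]
    exact ih.mul hx

/-- A relation in the associated graded ring holds degree by degree, since membership in the Rees
ideal is tested on each coefficient. -/
theorem sum_mem_of_sum_eq_zero {ι : Type} {S : Finset ι} {d : ι → ℕ} {a : ι → R} {x : ι → F.Gr}
    (hx : ∀ i, F.IsCls (d i) (a i) (x i)) (h : ∑ i ∈ S, x i = 0) (k : ℕ) :
    ∑ i ∈ S with d i = k, a i ∈ F.piece (k + 1) := by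
  choose ha hx using hx
  simp only [hx] at h
  have h1 := (map_sum (Ideal.Quotient.mk F.reesIdeal) _ S).trans h
  have h2 := Ideal.Quotient.eq_zero_iff_mem.1 h1 k
  rw [AddSubmonoidClass.coe_finsetSum, Polynomial.finsetSum_coeff] at h2
  rw [Finset.sum_filter]
  simpa only [Polynomial.coeff_monomial] using h2

theorem mem_of_cls_mem {Q : Subring F.Gr} (h : ∀ k a (ha : a ∈ F.piece k), F.cls k a ha ∈ Q)
    (x : F.Gr) : x ∈ Q := by
  obtain ⟨p, rfl⟩ := Ideal.Quotient.mk_surjective (I := F.reesIdeal) x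
  have hm : ∀ k, Polynomial.monomial k ((p : Polynomial R).coeff k) ∈ F.rees := by
    intro k j
    rw [Polynomial.coeff_monomial]
    split_ifs with hj
    · exact hj ▸ p.2 k
    · exact Ideal.zero_mem _
  have hp : p = ∑ k ∈ (p : Polynomial R).support,
      (⟨Polynomial.monomial k ((p : Polynomial R).coeff k), hm k⟩ : F.rees) := by
    refine Subtype.ext ?_
    rw [AddSubmonoidClass.coe_finsetSum]
    exact (p : Polynomial R).as_sum_support
  rw [hp, map_sum]
  exact sum_mem fun k _ => h k _ (p.2 k)

section

variable {n : ℕ} {π : MvPolynomial (Fin n) ℤ →+* R} {Ψ : MvPolynomial (Fin n) ℤ →+* F.Gr}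

theorem isCls_monomial
    (hΨ : ∀ i : Fin n, F.IsCls ((i : ℕ) + 1) (π (MvPolynomial.X i)) (Ψ (MvPolynomial.X i)))
    (m : Fin n →₀ ℕ) :
    F.IsCls (wt m) (π (MvPolynomial.monomial m 1)) (Ψ (MvPolynomial.monomial m 1)) := by
  induction m using Finsupp.induction_linear with
  | zero =>
    have h : MvPolynomial.monomial (0 : Fin n →₀ ℕ) (1 : ℤ) = 1 := rfl
    rw [wt, map_zero, h, map_one, map_one]
    simpa using IsCls.intCast (F := F) 1
  | add f g hf hg =>
    have h : MvPolynomial.monomial (f + g) (1 : ℤ) =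
        MvPolynomial.monomial f 1 * MvPolynomial.monomial g 1 := by
      rw [MvPolynomial.monomial_mul, one_mul]
    rw [wt, map_add, h, map_mul, map_mul]
    exact hf.mul hg
  | single i a =>
    rw [wt, Finsupp.weight_single, ← MvPolynomial.X_pow_eq_monomial, map_pow, map_pow]
    exact (hΨ i).pow a

/-- In degree `0` only the constant term of a polynomial survives. This handles the polynomial
multipliers in the span induction of `exists_isCls_of_mem_weightIdeal`. -/
theorem exists_isCls_intCast
    (hΨ : ∀ i : Fin n, F.IsCls ((i : ℕ) + 1) (π (MvPolynomial.X i)) (Ψ (MvPolynomial.X i)))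
    (p : MvPolynomial (Fin n) ℤ) : ∃ z : ℤ, F.IsCls 0 (π p) z := by
  induction p using MvPolynomial.induction_on with
  | C z =>
    refine ⟨z, ?_⟩
    rw [eq_intCast MvPolynomial.C, map_intCast]
    exact IsCls.intCast z
  | add p q hp hq =>
    obtain ⟨y, hy⟩ := hp
    obtain ⟨z, hz⟩ := hq
    refine ⟨y + z, ?_⟩
    rw [map_add, Int.cast_add]
    exact hy.add hz
  | mul_X p i _ =>
    have h0 : π (p * MvPolynomial.X i) ∈ F.piece 1 := by
      rw [map_mul]
      exact Ideal.mul_mem_left _ _ (F.antitone (Nat.le_add_left 1 i) (hΨ i).1)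
    have h1 := isCls_cls (F.antitone (Nat.zero_le 1) h0)
    have h2 := h1.eq_zero h0
    rw [h2] at h1
    exact ⟨0, by rwa [Int.cast_zero]⟩

theorem exists_isCls_of_mem_weightIdeal
    (hΨ : ∀ i : Fin n, F.IsCls ((i : ℕ) + 1) (π (MvPolynomial.X i)) (Ψ (MvPolynomial.X i)))
    {k : ℕ} {p : MvPolynomial (Fin n) ℤ} (hp : p ∈ weightIdeal n k) :
    ∃ q, F.IsCls k (π p) (Ψ q) := by
  induction hp using Submodule.span_induction with
  | mem p hp =>
    obtain ⟨m, hm, rfl⟩ := hp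
    have h := isCls_monomial hΨ m
    rcases hm.eq_or_lt with rfl | hlt
    · exact ⟨_, h⟩
    · have h1 := isCls_cls (F.antitone hm h.1)
      rw [h1.eq_zero (F.antitone hlt h.1)] at h1
      exact ⟨0, by rwa [map_zero]⟩
  | zero => exact ⟨0, by rw [map_zero, map_zero]; exact IsCls.zero k⟩
  | add p q _ _ hp hq =>
    obtain ⟨p', hp⟩ := hp
    obtain ⟨q', hq⟩ := hq
    exact ⟨p' + q', by rw [map_add, map_add]; exact hp.add hq⟩
  | smul c p _ hp =>
    obtain ⟨p', hp⟩ := hp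
    obtain ⟨z, hz⟩ := exists_isCls_intCast hΨ c
    refine ⟨z * p', ?_⟩
    have := hz.mul hp
    rw [zero_add] at this
    rwa [smul_eq_mul, map_mul, map_mul, map_intCast]

theorem surjective_of_forall_exists_weightIdeal
    (hΨ : ∀ i : Fin n, F.IsCls ((i : ℕ) + 1) (π (MvPolynomial.X i)) (Ψ (MvPolynomial.X i)))
    (h : ∀ k, ∀ a ∈ F.piece k, ∃ p ∈ weightIdeal n k, a - π p ∈ F.piece (k + 1)) :
    Function.Surjective Ψ := by
  refine mem_of_cls_mem (Q := Ψ.range) fun k a ha => ?_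
  obtain ⟨p, hp, hap⟩ := h k a ha
  obtain ⟨q, hq⟩ := exists_isCls_of_mem_weightIdeal hΨ hp
  exact ⟨q, hq.eq (isCls_cls ha) (by rw [← neg_sub]; exact neg_mem hap)⟩

end

end RingFiltration

/-! ## The relations in the model -/

section

variable {s : ℕ}

theorem Model.v_mem (s : ℕ) : Model.v (s + 2) ∈ (modelFiltration s).piece 1 := by
  simpa using mem_modelFiltration (s := s) (k := 1) (a := 0) (b := 1) (by omega) 1

theorem Model.two_mem (s : ℕ) : (2 : Model (s + 2)) ∈ (modelFiltration s).piece (2 ^ (s + 1)) := by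
  simpa using mem_modelFiltration (s := s) (k := 2 ^ (s + 1)) (a := 1) (b := 0) (by omega) 1

theorem two_le_two_pow_succ (s : ℕ) : 2 ≤ 2 ^ (s + 1) := by
  have := Nat.two_pow_pos s
  rw [pow_succ]
  omega

theorem Model.g_sub_pow {i : ℕ} (hi : i < 2 ^ (s + 1)) :
    Model.g (s + 2) i - Model.v (s + 2) ^ i ∈ (modelFiltration s).piece (i + 1) := by
  have h := Model.g_sub_lead (s := s) (k := i) (by omega)
  rwa [Model.lead, if_neg (by omega), add_zero] at h

theorem Model.g_sub_add {i : ℕ} (h1 : 2 ^ (s + 1) ≤ i) (h2 : i < 2 * 2 ^ (s + 1)) :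
    Model.g (s + 2) i - (Model.v (s + 2) ^ i + 2 * Model.v (s + 2) ^ (i - 2 ^ (s + 1))) ∈
      (modelFiltration s).piece (i + 1) := by
  have h := Model.g_sub_lead h2
  rwa [Model.lead, if_pos h1] at h

/-- Monomials in the images of `γ₁` and `γ_N`, up to higher filtration. -/
theorem Model.monomial_congr (s a b : ℕ) :
    Model.g (s + 2) 1 ^ a * Model.g (s + 2) (2 ^ (s + 1)) ^ b -
      Model.v (s + 2) ^ a * (Model.v (s + 2) ^ 2 ^ (s + 1) + 2) ^ b ∈
        (modelFiltration s).piece (2 ^ (s + 1) * b + a + 1) := by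
  have hN := two_le_two_pow_succ s
  let W := modelFiltration s
  have h1 := Model.g_sub_pow (s := s) (i := 1) (by omega)
  rw [pow_one] at h1
  have h2 := Model.g_sub_add (s := s) le_rfl (by omega)
  rw [Nat.sub_self, pow_zero, mul_one] at h2
  have h3 : Model.v (s + 2) ^ 2 ^ (s + 1) + 2 ∈ W.piece (2 ^ (s + 1)) := by
    refine add_mem ?_ (Model.two_mem s)
    simpa using W.pow_mem (Model.v_mem s) (2 ^ (s + 1))
  have h4 := W.mul_congr (W.pow_mem (Model.v_mem s) a) (W.pow_mem (W.mem_of_congr h3 h2) b)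
    (W.pow_congr (Model.v_mem s) h1 a) (W.pow_congr h3 h2 b)
  rwa [mul_one, add_comm a, mul_comm b] at h4

theorem Model.g_add_pow_mem {i : ℕ} (hi : i < 2 ^ (s + 1)) :
    Model.g (s + 2) i + Model.g (s + 2) 1 ^ i ∈ (modelFiltration s).piece (i + 1) := by
  have h1 := Model.g_sub_pow hi
  have h2 := Model.monomial_congr s i 0
  -- The sum is `2 vⁱ` up to higher filtration, and this term has weight `N + i`.
  have h3 := mem_modelFiltration (s := s) (k := i + 1) (a := 1) (b := i) (by omega) 1
  rw [mul_zero, zero_add, pow_zero, pow_zero, mul_one, mul_one] at h2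
  have h4 := add_mem (add_mem h1 h2) h3
  refine (congrArg (· ∈ (modelFiltration s).piece (i + 1)) ?_).mp h4
  ring

theorem Model.g_add_mul_mem {i : ℕ} (h1 : 2 ^ (s + 1) < i) (h2 : i < 2 * 2 ^ (s + 1)) :
    Model.g (s + 2) i +
      Model.g (s + 2) (2 ^ (s + 1)) * Model.g (s + 2) 1 ^ (i - 2 ^ (s + 1)) ∈
        (modelFiltration s).piece (i + 1) := by
  have hN := two_le_two_pow_succ s
  have h3 := Model.g_sub_add h1.le h2
  have h4 := Model.monomial_congr s (i - 2 ^ (s + 1)) 1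
  have h5 := mem_modelFiltration (s := s) (k := i + 1) (a := 1) (b := i) (by omega) 1
  have h6 := mem_modelFiltration (s := s) (k := i + 1) (a := 2) (b := i - 2 ^ (s + 1))
    (by omega) 1
  rw [show 2 ^ (s + 1) * 1 + (i - 2 ^ (s + 1)) = i by omega] at h4
  have h7 := add_mem (add_mem (add_mem h3 h4) h5) h6
  refine (congrArg (· ∈ (modelFiltration s).piece (i + 1)) ?_).mp h7
  have h8 : Model.v (s + 2) ^ i =
      Model.v (s + 2) ^ (i - 2 ^ (s + 1)) * Model.v (s + 2) ^ 2 ^ (s + 1) := by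
    rw [← pow_add, Nat.sub_add_cancel h1.le]
  linear_combination h8

/-- The leading form of the product, `v^(2N-1) + 2 v^(N-1)`, is also that of `cPol (s + 2)`, which
vanishes in the model. -/
theorem Model.g_mul_pow_mem (s : ℕ) :
    Model.g (s + 2) (2 ^ (s + 1)) * Model.g (s + 2) 1 ^ (2 ^ (s + 1) - 1) ∈
      (modelFiltration s).piece (2 * 2 ^ (s + 1)) := by
  have hN := two_le_two_pow_succ s
  have h1 := Model.monomial_congr s (2 ^ (s + 1) - 1) 1
  rw [show 2 ^ (s + 1) * 1 + (2 ^ (s + 1) - 1) + 1 = 2 * 2 ^ (s + 1) by omega] at h1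
  obtain ⟨p, q, h⟩ := exists_cPol_eq_four s
  have h0 := Ideal.Quotient.eq_zero_iff_mem.2 (Ideal.mem_span_singleton_self (cPol (s + 2)))
  have h2 : Model.v (s + 2) ^ (2 * 2 ^ (s + 1) - 1) +
      2 * Model.v (s + 2) ^ (2 ^ (s + 1) - 1) + 2 * Model.v (s + 2) ^ 2 ^ (s + 1) *
        Ideal.Quotient.mk _ p + 4 * Ideal.Quotient.mk _ q = 0 := by
    have h2 := (congrArg (Ideal.Quotient.mk (Ideal.span {cPol (s + 2)})) h).symm.trans h0
    simp only [map_add, map_mul, map_pow, map_ofNat] at h2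
    exact h2
  have h3 := mem_modelFiltration (s := s) (k := 2 * 2 ^ (s + 1)) (a := 1) (b := 2 ^ (s + 1))
    (by omega) (Ideal.Quotient.mk _ p)
  have h4 := mem_modelFiltration (s := s) (k := 2 * 2 ^ (s + 1)) (a := 2) (b := 0)
    (by omega) (Ideal.Quotient.mk _ q)
  have h5 := sub_mem (sub_mem h1 h3) h4
  refine (congrArg (· ∈ (modelFiltration s).piece (2 * 2 ^ (s + 1))) ?_).mp h5
  have h6 : Model.v (s + 2) ^ (2 * 2 ^ (s + 1) - 1) =
      Model.v (s + 2) ^ (2 ^ (s + 1) - 1) * Model.v (s + 2) ^ 2 ^ (s + 1) := by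
    rw [← pow_add]
    congr 1
    omega
  linear_combination h6 - h2

theorem Model.g_add_pow_sub_two_mem (s : ℕ) :
    Model.g (s + 2) (2 ^ (s + 1)) + Model.g (s + 2) 1 ^ 2 ^ (s + 1) - 2 ∈
      (modelFiltration s).piece (2 ^ (s + 1) + 1) := by
  have hN := two_le_two_pow_succ s
  have h1 := Model.g_sub_add (s := s) le_rfl (by omega)
  have h2 := Model.monomial_congr s (2 ^ (s + 1)) 0
  have h3 := mem_modelFiltration (s := s) (k := 2 ^ (s + 1) + 1) (a := 1) (b := 2 ^ (s + 1))
    (by omega) 1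
  rw [Nat.sub_self, pow_zero, mul_one] at h1
  rw [mul_zero, zero_add, pow_zero, pow_zero, mul_one, mul_one] at h2
  have h4 := add_mem (add_mem h1 h2) h3
  refine (congrArg (· ∈ (modelFiltration s).piece (2 ^ (s + 1) + 1)) ?_).mp h4
  ring

theorem Model.two_notMem (s : ℕ) :
    (2 : Model (s + 2)) ∉ (modelFiltration s).piece (2 ^ (s + 1) + 1) := by
  intro h
  have hN := two_le_two_pow_succ s
  have hne : ((0, 1) : ℕ × ℕ) ∉ ({(2 ^ (s + 1), 0)} : Finset (ℕ × ℕ)) := by simp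
  -- Written as `2 = (v^N + 2) - v^N`, the element has the odd coefficient `1` at the monomial `(0,
  -- 1)`, which is not among the exceptions because `N ≥ 2`.
  have h1 := two_dvd_of_sum_mem (s := s) (k := 2 ^ (s + 1))
    (S := insert (0, 1) {(2 ^ (s + 1), 0)}) (q := fun m => if m.2 = 0 then -1 else 1) ?_ ?_
    (m := (0, 1)) (Finset.mem_insert_self _ _)
  · rcases h1 with h1 | h1
    · norm_num at h1
    · have := h1.2
      simp only [zero_add] at this
      omega
  · intro m hm
    rcases Finset.mem_insert.1 hm with rfl | hm
    · simp
    · rw [Finset.mem_singleton.1 hm]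
      simp
  · rw [Finset.sum_insert hne, Finset.sum_singleton]
    refine (congrArg (· ∈ (modelFiltration s).piece (2 ^ (s + 1) + 1)) ?_).mp h
    simp
    ring

end

end SymplecticVerlinde
end

noncomputable section

namespace SymplecticVerlinde

open MvPolynomial RingFiltration

/-! ## The presented ring -/

section

variable {n N : ℕ}

theorem gP_eq_mk_X (i : Fin n) :
    Ideal.Quotient.mk (Ideal.span (relations n N)) (X i) = gP n N (i + 1) := by
  rw [gP, gVar, dif_pos (by simp)]
  rfl

theorem two_eq_zero (n N : ℕ) : (2 : PresentedRing n N) = 0 :=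
  Ideal.Quotient.eq_zero_iff_mem.2
    (Ideal.subset_span (Or.inl (Or.inl (Or.inl (rfl : (2 : MvPolynomial (Fin n) ℤ) = 2)))))

theorem gP_add_pow {i : ℕ} (h1 : 2 ≤ i) (h2 : i < N) : gP n N i + gP n N 1 ^ i = 0 :=
  Ideal.Quotient.eq_zero_iff_mem.2 (Ideal.subset_span (Or.inl (Or.inl (Or.inr ⟨i, h1, h2, rfl⟩))))

theorem gP_add_mul {i : ℕ} (h1 : N < i) (h2 : i ≤ n) :
    gP n N i + gP n N N * gP n N 1 ^ (i - N) = 0 :=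
  Ideal.Quotient.eq_zero_iff_mem.2 (Ideal.subset_span (Or.inl (Or.inr ⟨i, h1, h2, rfl⟩)))

theorem gP_mul_pow (n N : ℕ) : gP n N N * gP n N 1 ^ (N - 1) = 0 :=
  Ideal.Quotient.eq_zero_iff_mem.2 (Ideal.subset_span (Or.inr rfl))

theorem adjoin_gP_eq_top (n N : ℕ) :
    Algebra.adjoin ℤ ({gP n N 1, gP n N N} : Set (PresentedRing n N)) = ⊤ := by
  set A := Algebra.adjoin ℤ ({gP n N 1, gP n N N} : Set (PresentedRing n N))
  have h1 : gP n N 1 ∈ A := Algebra.subset_adjoin (by simp)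
  have h2 : gP n N N ∈ A := Algebra.subset_adjoin (by simp)
  refine top_unique fun x _ => ?_
  obtain ⟨p, rfl⟩ := Ideal.Quotient.mk_surjective x
  induction p using MvPolynomial.induction_on with
  | C z =>
    rw [eq_intCast C, map_intCast]
    exact intCast_mem _ _
  | add p q hp hq =>
    rw [map_add]
    exact add_mem (hp trivial) (hq trivial)
  | mul_X p i hp =>
    rw [map_mul, gP_eq_mk_X]
    refine mul_mem (hp trivial) ?_
    rcases Nat.eq_zero_or_pos (i : ℕ) with h0 | h0
    · rwa [h0]
    · rcases lt_trichotomy ((i : ℕ) + 1) N with h | h | h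
      · rw [eq_neg_of_add_eq_zero_left (gP_add_pow (n := n) (by omega) h)]
        exact neg_mem (pow_mem h1 _)
      · rwa [h]
      · rw [eq_neg_of_add_eq_zero_left (gP_add_mul h (by omega))]
        exact neg_mem (mul_mem h2 (pow_mem h1 _))

theorem exists_sum_eq (x : PresentedRing n N) : ∃ c : ℕ × ℕ →₀ ℤ,
    ∑ m ∈ c.support, (c m : PresentedRing n N) * (gP n N 1 ^ m.1 * gP n N N ^ m.2) = x := by
  have h : x ∈ Submodule.span ℤ
      (Set.range fun m : ℕ × ℕ => gP n N 1 ^ m.1 * gP n N N ^ m.2) := by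
    have h1 : x ∈ Subalgebra.toSubmodule
        (Algebra.adjoin ℤ ({gP n N 1, gP n N N} : Set (PresentedRing n N))) := by
      rw [adjoin_gP_eq_top]
      trivial
    rw [Algebra.adjoin_eq_span] at h1
    refine Submodule.span_mono ?_ h1
    intro y hy
    obtain ⟨a, b, rfl⟩ := (Submonoid.mem_closure_pair _ _ _).1 hy
    exact ⟨(a, b), rfl⟩
  obtain ⟨c, hc⟩ := Finsupp.mem_span_range_iff_exists_finsupp.1 h
  refine ⟨c, ?_⟩
  rw [← hc]
  exact Finset.sum_congr rfl fun m _ => (zsmul_eq_mul _ _).symm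

end

/-! ## The associated graded ring of the Verlinde algebra -/

section

variable {n s : ℕ}

theorem exists_hom_model (hn : n = 2 * 2 ^ (s + 1) - 2) :
    ∃ θ : VerlindeAlgebra n 1 →+* Model (s + 2),
      (∀ k, 1 ≤ k → k ≤ n → θ (gamV n 1 k) = Model.g (s + 2) k) ∧
      ∀ k x, x ∈ (verlindeFiltration n 1).piece k ↔ θ x ∈ (modelFiltration s).piece k := by
  have hN := two_le_two_pow_succ s
  have hr : n + 1 = 2 ^ (s + 2) - 1 := by
    rw [pow_succ 2 (s + 1)]
    omega
  exact ⟨verlindeToModel hr (by omega), fun k h1 hk => verlindeToModel_gamV hr _ h1 hk,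
    fun k x => mem_piece_iff_model hn hr _⟩

theorem gamV_mem (n : ℕ) {i : ℕ} (h1 : 1 ≤ i) (hi : i ≤ n) :
    gamV n 1 i ∈ (verlindeFiltration n 1).piece i :=
  Ideal.mem_map_of_mem _ (gam_mem_ahFiltration h1 hi)

/-- The homomorphism from `ℤ[γ₁, …, γₙ]` to the associated graded ring of the Verlinde algebra. -/
def toGr (n : ℕ) : MvPolynomial (Fin n) ℤ →+* (verlindeFiltration n 1).Gr :=
  eval₂Hom (Int.castRingHom _) fun i => (verlindeFiltration n 1).cls (i + 1) (gamV n 1 (i + 1))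
    (gamV_mem n (by omega) (by omega))

theorem isCls_toGr_X (i : Fin n) :
    (verlindeFiltration n 1).IsCls ((i : ℕ) + 1) (gamV n 1 (i + 1)) (toGr n (X i)) := by
  rw [toGr, eval₂Hom_X']
  exact isCls_cls _

theorem isCls_toGr_gVar {k : ℕ} (h1 : 1 ≤ k) (hk : k ≤ n) :
    (verlindeFiltration n 1).IsCls k (gamV n 1 k) (toGr n (gVar n k)) := by
  rw [gVar, dif_pos (by omega)]
  have h := isCls_toGr_X (⟨k - 1, by omega⟩ : Fin n)
  rwa [show ((⟨k - 1, by omega⟩ : Fin n) : ℕ) + 1 = k by simp; omega] at h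

theorem toGr_surjective (n : ℕ) : Function.Surjective (toGr n) := by
  refine surjective_of_forall_exists_weightIdeal
    (π := (Ideal.Quotient.mk (levelIdeal n 2)).comp (aevalGam n).toRingHom) (fun i => ?_) ?_
  · have h : (Ideal.Quotient.mk (levelIdeal n 2)).comp (aevalGam n).toRingHom (X i) =
        gamV n 1 (i + 1) := by
      show Ideal.Quotient.mk _ (aevalGam n (X i)) = _
      rw [aevalGam, aeval_X]
      rfl
    rw [h]
    exact isCls_toGr_X i
  · intro k a ha
    obtain ⟨b, hb, rfl⟩ := (Ideal.mem_map_iff_of_surjective _ Ideal.Quotient.mk_surjective).1 ha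
    -- The difference restricts to zero on the torus, so it lies in every piece.
    refine ⟨toPoly n b, mem_piece_iff.1 hb, ?_⟩
    have h : b - aevalGam n (toPoly n b) ∈ (ahFiltration n).piece (k + 1) := by
      rw [mem_piece_iff, map_sub, toPoly_aevalGam, sub_self]
      exact Ideal.zero_mem _
    exact Ideal.mem_map_of_mem (Ideal.Quotient.mk (levelIdeal n 2)) h

theorem toGr_relations (hn : n = 2 * 2 ^ (s + 1) - 2) {p : MvPolynomial (Fin n) ℤ}
    (hp : p ∈ relations n (2 ^ (s + 1))) : toGr n p = 0 := by
  have hN := two_le_two_pow_succ s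
  obtain ⟨θ, hθ, hF⟩ := exists_hom_model hn
  have h1 := isCls_toGr_gVar (n := n) le_rfl (by omega)
  have hNN := isCls_toGr_gVar (n := n) (k := 2 ^ (s + 1)) (by omega) (by omega)
  have hθ1 := hθ 1 le_rfl (by omega)
  have hθN := hθ (2 ^ (s + 1)) (by omega) (by omega)
  rcases hp with ((hp | ⟨i, h2, hi, rfl⟩) | ⟨i, h2, hi, rfl⟩) | hp
  · rw [Set.mem_singleton_iff.1 hp, map_ofNat]
    have h := IsCls.intCast (F := verlindeFiltration n 1) 2
    rw [Int.cast_ofNat, Int.cast_ofNat] at h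
    refine h.eq_zero ((hF _ _).2 ?_)
    rw [map_ofNat]
    exact (modelFiltration s).antitone (by omega) (Model.two_mem s)
  · have h := h1.pow i
    rw [mul_one] at h
    have h' := (isCls_toGr_gVar (n := n) (k := i) (by omega) (by omega)).add h
    rw [← map_pow, ← map_add] at h'
    refine h'.eq_zero ((hF _ _).2 ?_)
    rw [map_add, map_pow, hθ1, hθ i (by omega) (by omega)]
    exact Model.g_add_pow_mem hi
  · have h := hNN.mul (h1.pow (i - 2 ^ (s + 1)))
    rw [mul_one, Nat.add_sub_cancel' h2.le] at h
    have h' := (isCls_toGr_gVar (n := n) (k := i) (by omega) hi).add h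
    rw [← map_pow, ← map_mul, ← map_add] at h'
    refine h'.eq_zero ((hF _ _).2 ?_)
    rw [map_add, map_mul, map_pow, hθ1, hθN, hθ i (by omega) hi]
    exact Model.g_add_mul_mem h2 (by omega)
  · rw [Set.mem_singleton_iff.1 hp]
    have h := hNN.mul (h1.pow (2 ^ (s + 1) - 1))
    rw [mul_one, ← map_pow, ← map_mul] at h
    refine h.eq_zero ((hF _ _).2 ?_)
    rw [map_mul, map_pow, hθ1, hθN,
      show 2 ^ (s + 1) + (2 ^ (s + 1) - 1) + 1 = 2 * 2 ^ (s + 1) by omega]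
    exact Model.g_mul_pow_mem s

/-- The homomorphism from the presented ring to the associated graded ring. -/
def presentedToGr (hn : n = 2 * 2 ^ (s + 1) - 2) :
    PresentedRing n (2 ^ (s + 1)) →+* (verlindeFiltration n 1).Gr :=
  Ideal.Quotient.lift _ (toGr n) fun _ hp =>
    (Ideal.span_le (I := RingHom.ker (toGr n))).2 (fun _ => toGr_relations hn) hp

theorem isCls_presentedToGr_gP (hn : n = 2 * 2 ^ (s + 1) - 2) {k : ℕ} (h1 : 1 ≤ k) (hk : k ≤ n) :
    (verlindeFiltration n 1).IsCls k (gamV n 1 k) (presentedToGr hn (gP n _ k)) :=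
  isCls_toGr_gVar h1 hk

theorem isCls_presentedToGr_monomial (hn : n = 2 * 2 ^ (s + 1) - 2) (z : ℤ) (a b : ℕ) :
    (verlindeFiltration n 1).IsCls (2 ^ (s + 1) * b + a)
      ((z : VerlindeAlgebra n 1) * (gamV n 1 1 ^ a * gamV n 1 (2 ^ (s + 1)) ^ b))
      (presentedToGr hn ((z : PresentedRing n (2 ^ (s + 1))) *
        (gP n _ 1 ^ a * gP n _ (2 ^ (s + 1)) ^ b))) := by
  have hN := two_le_two_pow_succ s
  have h1 := (isCls_presentedToGr_gP hn le_rfl (by omega)).pow a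
  have hNN := (isCls_presentedToGr_gP hn (k := 2 ^ (s + 1)) (by omega) (by omega)).pow b
  rw [mul_one] at h1
  rw [mul_comm b] at hNN
  have h := (IsCls.intCast z).mul (h1.mul hNN)
  rw [zero_add, add_comm a] at h
  rw [map_mul (presentedToGr hn), map_mul (presentedToGr hn), map_pow (presentedToGr hn),
    map_pow (presentedToGr hn), map_intCast (presentedToGr hn)]
  exact h

/-- An element of the presented ring is a combination of monomials in `γ₁` and `γ_N`. If it maps to
zero, each degree forces every coefficient to be even or its monomial to be divisible by `γ_N
γ₁^(N-1)`, and both kinds of term are already zero. -/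
theorem presentedToGr_injective (hn : n = 2 * 2 ^ (s + 1) - 2) :
    Function.Injective (presentedToGr hn) := by
  have hN := two_le_two_pow_succ s
  obtain ⟨θ, hθ, hF⟩ := exists_hom_model hn
  have hθ1 := hθ 1 le_rfl (by omega)
  have hθN := hθ (2 ^ (s + 1)) (by omega) (by omega)
  refine (injective_iff_map_eq_zero _).2 fun x hx => ?_
  obtain ⟨c, rfl⟩ := exists_sum_eq x
  rw [map_sum] at hx
  have hcls := fun m : ℕ × ℕ => isCls_presentedToGr_monomial hn (c m) m.1 m.2
  refine Finset.sum_eq_zero fun m hm => ?_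
  have hsum := (hF _ _).1 (sum_mem_of_sum_eq_zero hcls hx (2 ^ (s + 1) * m.2 + m.1))
  rw [map_sum] at hsum
  have hS : ∀ m' ∈ c.support.filter
      (fun i : ℕ × ℕ => 2 ^ (s + 1) * i.2 + i.1 = 2 ^ (s + 1) * m.2 + m.1),
      2 ^ (s + 1) * m'.2 + m'.1 = 2 ^ (s + 1) * m.2 + m.1 :=
    fun m' hm' => (Finset.mem_filter.1 hm').2
  have hdvd := two_dvd_of_sum_mem (q := c) hS ?_ (Finset.mem_filter.2 ⟨hm, rfl⟩)
  · rcases hdvd with ⟨d, hd⟩ | ⟨hb, ha⟩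
    · rw [hd, Int.cast_mul, Int.cast_ofNat, two_eq_zero, zero_mul, zero_mul]
    · obtain ⟨b, hb⟩ := Nat.exists_eq_add_of_le' hb
      obtain ⟨a, ha⟩ := Nat.exists_eq_add_of_le' (Nat.sub_le_iff_le_add.2 ha)
      rw [hb, ha, pow_add (gP n _ 1), pow_add (gP n _ (2 ^ (s + 1))) b]
      linear_combination (c m : PresentedRing n (2 ^ (s + 1))) * gP n _ 1 ^ a *
        gP n _ (2 ^ (s + 1)) ^ b * gP_mul_pow n (2 ^ (s + 1))
  · refine (Submodule.sub_mem_iff_right _ hsum).1 ?_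
    rw [← Finset.sum_sub_distrib]
    refine sum_mem fun m' hm' => ?_
    rw [map_mul, map_intCast, map_mul, map_pow, map_pow, hθ1, hθN, ← mul_sub, ← hS m' hm']
    exact Ideal.mul_mem_left _ _ (Model.monomial_congr s m'.1 m'.2)

theorem presentedToGr_surjective (hn : n = 2 * 2 ^ (s + 1) - 2) :
    Function.Surjective (presentedToGr hn) :=
  Ideal.Quotient.lift_surjective_of_surjective _ _ (toGr_surjective n)

end

end SymplecticVerlinde
end

/-! ### The theorem -/

open SymplecticVerlinde in
theorem mainTheorem8 (r n N : ℕ) (hr : 2 ≤ r) (hn : n = 2 ^ r - 2) (hN : N = 2 ^ (r - 1)) :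
    ∃ (hγ : ∀ i, 1 ≤ i → i ≤ n → gamV n 1 i ∈ (verlindeFiltration n 1).piece i)
      (h2 : (2 : VerlindeAlgebra n 1) ∈ (verlindeFiltration n 1).piece N)
      (Φ : PresentedRing n N ≃+* (verlindeFiltration n 1).Gr),
      (∀ i (h1 : 1 ≤ i) (hi : i ≤ n),
        Φ (gP n N i) = (verlindeFiltration n 1).cls i (gamV n 1 i) (hγ i h1 hi)) ∧
      (2 : VerlindeAlgebra n 1) ∉ (verlindeFiltration n 1).piece (N + 1) ∧
      Φ (gP n N N + gP n N 1 ^ N) = (verlindeFiltration n 1).cls N 2 h2 := by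
  obtain ⟨s, rfl⟩ := Nat.exists_eq_add_of_le' hr
  have hN' : N = 2 ^ (s + 1) := hN
  subst hN'
  have hn' : n = 2 * 2 ^ (s + 1) - 2 := by rw [hn, pow_succ 2 (s + 1), mul_comm]
  have hN2 := two_le_two_pow_succ s
  obtain ⟨θ, hθ, hF⟩ := exists_hom_model hn'
  have h2 : (2 : VerlindeAlgebra n 1) ∈ (verlindeFiltration n 1).piece (2 ^ (s + 1)) := by
    rw [hF, map_ofNat]
    exact Model.two_mem s
  refine ⟨fun i => gamV_mem n, h2, RingEquiv.ofBijective (presentedToGr hn')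
    ⟨presentedToGr_injective hn', presentedToGr_surjective hn'⟩, fun i h1 hi => ?_, ?_, ?_⟩
  · exact (isCls_presentedToGr_gP hn' h1 hi).2
  · rw [hF, map_ofNat]
    exact Model.two_notMem s
  · have h := (isCls_presentedToGr_gP hn' le_rfl (by omega)).pow (2 ^ (s + 1))
    rw [mul_one] at h
    have h' := (isCls_presentedToGr_gP hn' (k := 2 ^ (s + 1)) (by omega) (by omega)).add h
    rw [← map_pow, ← map_add] at h'
    -- Both sides are classes in degree `N`, so it suffices that `γ_N + γ₁^N - 2` lies one step
    -- deeper.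
    refine h'.eq (RingFiltration.isCls_cls h2) ((hF _ _).2 ?_)
    rw [map_sub, map_add, map_pow, map_ofNat, hθ 1 le_rfl (by omega),
      hθ _ (by omega) (by omega)]
    exact Model.g_add_pow_sub_two_mem s
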